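/- Let $d\in\{1,2\}$ and $\mathbb{D}=\mathbb{R}$ or $\mathbb{D}=\mathbb{T}=\mathbb{R}/\mathbb{Z}$; for $\sigma\ge 0$, $H^\sigma=H^\sigma(\mathbb{D}^d)$ is the Sobolev space with norm $\|f\|_{H^\sigma}=\|(1-\Delta)^{\sigma/2}f\|_{L^2}$, norms of vector-valued functions being the sums of the norms of the components. Let $s\in\mathbb{R}$ with $s>d/2$ and $s\ge 2$. There are functions $C,C':\mathbb{R}^4\to[0,\infty)$, nondecreasing in each argument and depending only on $d$, $\mathbb{D}$ and $s$, such that the following holds. Let $\lambda,\mu,h_\star\in(0,\infty)$, $T^\star\in(0,\infty]$, and let $$U=(\zeta,\mathbf{u},\eta-1,w)\in C^2([0,T^\star);H^{s-2})^{d+3}\cap C^1([0,T^\star);H^{s-1})^{d+3}\cap C^0([0,T^\star);H^{s})^{d+3}$$ (real-valued, $\mathbf{u}$ having $d$ components) be a solution of the Favrie--Gavrilyuk system $$\left\{\begin{array}{l} \partial_t\zeta+\nabla\cdot(h\mathbf{u})=0,\\ \partial_t\mathbf{u}+\nabla\zeta+(\mathbf{u}\cdot\nabla)\mathbf{u}-\frac{\lambda\mu}{3h}\nabla\big(\frac{\eta}{h}(\eta-h)\big)=0,\\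 \partial_t\eta+\mathbf{u}\cdot\nabla\eta=w,\\ \partial_t w+\mathbf{u}\cdot\nabla w=-\frac{\lambda}{h^2}(\eta-h), \end{array}\right.\qquad h=1+\zeta,$$ with $h\ge h_\star$ on $[0,T^\star)\times\mathbb{D}^d$. Write $\dot f=\partial_t f+\mathbf{u}\cdot\nabla f$ and $\ddot f=\partial_t\dot f+\mathbf{u}\cdot\nabla\dot f$. Then $\ddot h$ and $\ddot\eta$ are well defined and, at every $t\in[0,T^\star)$, $(\zeta,\mathbf{u})$ satisfies the Green--Naghdi system with remainder $$\partial_t\zeta+\nabla\cdot(h\mathbf{u})=0,\qquad \partial_t\mathbf{u}+\nabla\zeta+(\mathbf{u}\cdot\nabla)\mathbf{u}+\frac{\mu}{3h}\nabla\big(h^2\ddot h\big)=\frac{\mu}{3h}\nabla r,$$ the second equation in the sense of distributions on $\mathbb{D}^d$ (with $h^2\ddot h, r\in L^2$, and $\frac1h\partial_iF$ denoting, for $F\in L^2$, the distribution $\varphi\mapsto-\int F\,\partial_i(\varphi/h)$), where $$r=-h(\eta-h)\ddot\eta-h^2(\ddot\eta-\ddot h)\in C^0([0,T^\star);H^{s-2}).$$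 Moreover, for all $t\in[0,T^\star)$, $$\|r\|_{H^{s-2}}(t)\le C\sum_{j=0}^2\|\partial_t^j(\eta-h)\|_{H^{s-j}}(t),$$ and, for every $t\in[0,T^\star)$ at which the right-hand side is finite (that is, $\partial_t^jw(t)\in H^{s+1-j}$ for $j=0,\dots,3$, where $\partial_t^3w(t)$ is understood in the sense of distributions on $\mathbb{D}^d$), $$\|r\|_{H^{s-2}}(t)\le\lambda^{-1}C'\sum_{j=0}^3\|\partial_t^jw\|_{H^{s+1-j}}(t),$$ where $C$ and $C'$ are evaluated at $\big(h_\star^{-1},\|U(t)\|_{H^s},\|\partial_tU(t)\|_{H^{s-1}},\|\partial_t^2U(t)\|_{H^{s-2}}\big)$. -/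

import Mathlib

open MeasureTheory Filter Topology
open scoped ContDiff ENNReal FourierTransform

namespace FavrieGavrilyuk

noncomputable section

/-! ### The horizontal domain `𝔻ᵈ`, with `𝔻 = ℝ` or `𝔻 = 𝕋 = ℝ/ℤ` -/

/-- The two choices of `𝔻`. -/
inductive Geometry
  | line
  | torus

/-- The space `𝔻ᵈ`. -/
def Pt (D : Geometry) (d : ℕ) : Type :=
  match D with
  | .line => EuclideanSpace ℝ (Fin d)
  | .torus => UnitAddTorus (Fin d)

instance (D : Geometry) (d : ℕ) : AddCommGroup (Pt D d) :=
  match D with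
  | .line => inferInstanceAs (AddCommGroup (EuclideanSpace ℝ (Fin d)))
  | .torus => inferInstanceAs (AddCommGroup (UnitAddTorus (Fin d)))

instance (D : Geometry) (d : ℕ) : TopologicalSpace (Pt D d) :=
  match D with
  | .line => inferInstanceAs (TopologicalSpace (EuclideanSpace ℝ (Fin d)))
  | .torus => inferInstanceAs (TopologicalSpace (UnitAddTorus (Fin d)))

/-- Lebesgue measure: on the torus, the product of the Haar probability measures of the circles. -/
instance (D : Geometry) (d : ℕ) : MeasureSpace (Pt D d) :=
  match D with
  | .line => inferInstanceAs (MeasureSpace (EuclideanSpace ℝ (Fin d)))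
  | .torus =>
    @MeasureSpace.mk (UnitAddTorus (Fin d)) MeasurableSpace.pi
      (Measure.pi fun _ => AddCircle.haarAddCircle)

/-- The covering map `ℝᵈ → 𝔻ᵈ` (the identity if `𝔻 = ℝ`). -/
def proj (D : Geometry) (d : ℕ) (x : EuclideanSpace ℝ (Fin d)) : Pt D d :=
  match D with
  | .line => x
  | .torus => (fun i => ((x i : ℝ) : UnitAddCircle) : UnitAddTorus (Fin d))

/-! ### Fourier transform and Sobolev spaces -/

/-- The frequency space: `ℝᵈ` if `𝔻 = ℝ`, and `ℤᵈ` if `𝔻 = 𝕋`. -/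
def Freq (D : Geometry) (d : ℕ) : Type :=
  match D with
  | .line => EuclideanSpace ℝ (Fin d)
  | .torus => Fin d → ℤ

/-- Lebesgue measure on `ℝᵈ`, counting measure on `ℤᵈ`. -/
instance (D : Geometry) (d : ℕ) : MeasureSpace (Freq D d) :=
  match D with
  | .line => inferInstanceAs (MeasureSpace (EuclideanSpace ℝ (Fin d)))
  | .torus =>
    @MeasureSpace.mk (Fin d → ℤ) MeasurableSpace.pi Measure.count

/-- The squared Euclidean length of a frequency. -/
def freqSq (D : Geometry) (d : ℕ) (ξ : Freq D d) : ℝ :=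
  match D, ξ with
  | .line, (ξ : EuclideanSpace ℝ (Fin d)) => ‖ξ‖ ^ 2
  | .torus, (k : Fin d → ℤ) => ∑ i, (k i : ℝ) ^ 2

open Classical in
/-- The Fourier transform of a square-integrable function on `ℝᵈ` (`0` for other functions). -/
def fourierLine (d : ℕ) (f : EuclideanSpace ℝ (Fin d) → ℂ) : EuclideanSpace ℝ (Fin d) → ℂ :=
  if hf : MemLp f 2 volume then
    ((𝓕 (hf.toLp f) : Lp ℂ 2 (volume : Measure (EuclideanSpace ℝ (Fin d)))) :
      EuclideanSpace ℝ (Fin d) → ℂ)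
  else 0

/-- The Fourier transform on `ℝᵈ`, respectively the Fourier coefficients on `𝕋ᵈ`, of a
square-integrable real function. -/
def fourierT (D : Geometry) (d : ℕ) (f : Pt D d → ℝ) : Freq D d → ℂ :=
  match D, f with
  | .line, (f : EuclideanSpace ℝ (Fin d) → ℝ) => fourierLine d (fun x => (f x : ℂ))
  | .torus, (f : UnitAddTorus (Fin d) → ℝ) =>
      UnitAddTorus.mFourierCoeff (fun x => (f x : ℂ))

variable {D : Geometry} {d : ℕ}

/-- The Fourier transform of `(1 - Δ)^(σ/2) f`. -/
def sobolevFourier (σ : ℝ) (f : Pt D d → ℝ) (ξ : Freq D d) : ℂ :=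
  (((1 + (2 * Real.pi) ^ 2 * freqSq D d ξ) ^ (σ / 2) : ℝ) : ℂ) * fourierT D d f ξ

/-- `f ∈ H^σ(𝔻ᵈ)`; used for `σ ≥ 0`, so that elements of `H^σ` are square-integrable functions. -/
def MemH (σ : ℝ) (f : Pt D d → ℝ) : Prop :=
  MemLp f 2 volume ∧ MemLp (sobolevFourier σ f) 2 volume

/-- The norm of `H^σ(𝔻ᵈ)`, that is `‖(1 - Δ)^(σ/2) f‖_{L²}`. -/
def hNorm (σ : ℝ) (f : Pt D d → ℝ) : ℝ :=
  (eLpNorm (sobolevFourier σ f) 2 volume).toReal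

/-- `f ∈ Cⁿ(I; H^σ(𝔻ᵈ))`. The isometry `f ↦ sobolevFourier σ f` of `H^σ` into `L²` turns this into
`Cⁿ` regularity of an `L²`-valued curve. -/
def CnH (n : ℕ) (σ : ℝ) (I : Set ℝ) (f : ℝ → Pt D d → ℝ) : Prop :=
  ∃ G : ℝ → Lp ℂ 2 (volume : Measure (Freq D d)), ContDiffOn ℝ n G I ∧
    ∀ t ∈ I, MemLp (f t) 2 volume ∧ G t =ᵐ[volume] sobolevFourier σ (f t)

/-- `f ∈ C²(I; H^{s-2}) ∩ C¹(I; H^{s-1}) ∩ C⁰(I; H^s)`. -/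
def Regular (s : ℝ) (I : Set ℝ) (f : ℝ → Pt D d → ℝ) : Prop :=
  CnH 2 (s - 2) I f ∧ CnH 1 (s - 1) I f ∧ CnH 0 s I f

/-! ### Test functions, weak derivatives -/

/-- Smooth compactly supported functions on `𝔻ᵈ` (any smooth function if `𝔻 = 𝕋`). -/
def IsTest (φ : Pt D d → ℝ) : Prop :=
  ContDiff ℝ ∞ (fun x => φ (proj D d x)) ∧ HasCompactSupport φ

/-- The classical `i`-th partial derivative. -/
def partialD (i : Fin d) (φ : Pt D d → ℝ) (x : Pt D d) : ℝ :=
  deriv (fun τ : ℝ => φ (x + proj D d (EuclideanSpace.single i τ))) 0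

/-- The locally integrable function `g` is the `i`-th partial derivative of `f` in the sense of
distributions. -/
def HasWeakDeriv (i : Fin d) (f g : Pt D d → ℝ) : Prop :=
  LocallyIntegrable f volume ∧ LocallyIntegrable g volume ∧
    ∀ φ : Pt D d → ℝ, IsTest φ → ∫ x, f x * partialD i φ x = -∫ x, g x * φ x

/-- The locally integrable function `g` is the time derivative of `f` at time `t ∈ I`, in the sense
of distributions on `𝔻ᵈ` (one-sided if `t` is an endpoint of the interval `I`). -/
def HasTimeDerivAt (I : Set ℝ) (f : ℝ → Pt D d → ℝ) (t : ℝ) (g : Pt D d → ℝ) : Prop :=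
  (∀ τ ∈ I, LocallyIntegrable (f τ) volume) ∧ LocallyIntegrable g volume ∧
    ∀ φ : Pt D d → ℝ, IsTest φ →
      HasDerivWithinAt (fun τ => ∫ x, f τ x * φ x) (∫ x, g x * φ x) I t

open Classical in
/-- The weak derivative `∂ᵢ f` (`0` if there is none), defined up to a null set. -/
def wd (i : Fin d) (f : Pt D d → ℝ) : Pt D d → ℝ :=
  if h : ∃ g, HasWeakDeriv i f g then h.choose else 0

open Classical in
/-- The time derivative `∂ₜ f` (`0` if there is none), defined up to null sets. -/
def dt (I : Set ℝ) (f : ℝ → Pt D d → ℝ) (t : ℝ) : Pt D d → ℝ :=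
  if h : ∃ g, HasTimeDerivAt I f t g then h.choose else 0

/-- The material derivative `∂ₜ f + u · ∇f`. -/
def matD (I : Set ℝ) (u : Fin d → ℝ → Pt D d → ℝ) (f : ℝ → Pt D d → ℝ) (t : ℝ) (x : Pt D d) : ℝ :=
  dt I f t x + ∑ i, u i t x * wd i (f t) x

/-- The derivatives that occur in the material derivative of `f` exist (as functions). -/
def MatDifferentiable (I : Set ℝ) (f : ℝ → Pt D d → ℝ) : Prop :=
  ∀ t ∈ I, (∃ g, HasTimeDerivAt I f t g) ∧ ∀ i, ∃ g, HasWeakDeriv i (f t) g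

/-! ### The two systems -/

/-- The depth `h = 1 + ζ`. -/
def depth (ζ : ℝ → Pt D d → ℝ) (t : ℝ) (x : Pt D d) : ℝ := 1 + ζ t x

/-- `∂ₜ ζ + ∇ · (h u) = 0`. -/
def MassEq (I : Set ℝ) (ζ : ℝ → Pt D d → ℝ) (u : Fin d → ℝ → Pt D d → ℝ) : Prop :=
  ∀ t ∈ I, ∀ᵐ x, dt I ζ t x + ∑ i, wd i (fun y => depth ζ t y * u i t y) x = 0

/-- The `i`-th component of `∂ₜ u + ∇ζ + (u · ∇) u`. -/
def euler (I : Set ℝ) (ζ : ℝ → Pt D d → ℝ) (u : Fin d → ℝ → Pt D d → ℝ) (i : Fin d)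
    (t : ℝ) (x : Pt D d) : ℝ :=
  dt I (u i) t x + wd i (ζ t) x + ∑ j, u j t x * wd j (u i t) x

/-- `(ζ, u, η, w)` solves the Favrie–Gavrilyuk system on the time interval `I`. -/
structure IsFGSolution (lam mu : ℝ) (I : Set ℝ) (ζ : ℝ → Pt D d → ℝ)
    (u : Fin d → ℝ → Pt D d → ℝ) (η w : ℝ → Pt D d → ℝ) : Prop where
  mass : MassEq I ζ u
  momentum : ∀ i, ∀ t ∈ I, ∀ᵐ x,
    euler I ζ u i t x - lam * mu / (3 * depth ζ t x) *
      wd i (fun y => η t y / depth ζ t y * (η t y - depth ζ t y)) x = 0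
  eta_eq : ∀ t ∈ I, ∀ᵐ x, matD I u η t x = w t x
  w_eq : ∀ t ∈ I, ∀ᵐ x, matD I u w t x =
    -(lam / depth ζ t x ^ 2) * (η t x - depth ζ t x)

/-- The value at the test function `φ` of the distribution `(1/h) ∂ᵢ F`, for `F ∈ L²` and
`h = 1 + ζ` bounded below with `∇ζ ∈ L²`. By definition this is `- ∫ F ∂ᵢ(φ/h)`. -/
def invDepthGrad (ζ : ℝ → Pt D d → ℝ) (t : ℝ) (i : Fin d) (F φ : Pt D d → ℝ) : ℝ :=
  -∫ x, F x * (partialD i φ x / depth ζ t x - φ x * wd i (ζ t) x / depth ζ t x ^ 2)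

/-- `∂ₜ u + ∇ζ + (u · ∇) u + μ/(3h) ∇(h² ḧ) = μ/(3h) ∇r`, in the sense of distributions on `𝔻ᵈ` at
every time (`h² ḧ` and `r` being square-integrable). -/
def GNMomentum (mu : ℝ) (I : Set ℝ) (ζ : ℝ → Pt D d → ℝ) (u : Fin d → ℝ → Pt D d → ℝ)
    (r : ℝ → Pt D d → ℝ) : Prop :=
  ∀ t ∈ I,
    MemLp (fun x => depth ζ t x ^ 2 * matD I u (matD I u (depth ζ)) t x) 2 volume ∧
    MemLp (r t) 2 volume ∧
    ∀ i, ∀ φ : Pt D d → ℝ, IsTest φ →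
      (∫ x, euler I ζ u i t x * φ x) + mu / 3 * invDepthGrad ζ t i
          (fun x => depth ζ t x ^ 2 * matD I u (matD I u (depth ζ)) t x) φ
        = mu / 3 * invDepthGrad ζ t i (r t) φ

/-- The remainder `r = - h (η - h) η̈ - h² (η̈ - ḧ)`. -/
def remainder (I : Set ℝ) (ζ : ℝ → Pt D d → ℝ) (u : Fin d → ℝ → Pt D d → ℝ)
    (η : ℝ → Pt D d → ℝ) (t : ℝ) (x : Pt D d) : ℝ :=
  -(depth ζ t x * (η t x - depth ζ t x) * matD I u (matD I u η) t x)
    - depth ζ t x ^ 2 * (matD I u (matD I u η) t x - matD I u (matD I u (depth ζ)) t x)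

/-- `‖∂ₜ^j U(t)‖_{H^σ}` for `U = (ζ, u, η - 1, w)`: the sum of the norms of the `d + 3` components. -/
def stateNorm (I : Set ℝ) (j : ℕ) (σ : ℝ) (ζ : ℝ → Pt D d → ℝ) (u : Fin d → ℝ → Pt D d → ℝ)
    (η w : ℝ → Pt D d → ℝ) (t : ℝ) : ℝ :=
  hNorm σ ((dt I)^[j] ζ t) + ∑ i, hNorm σ ((dt I)^[j] (u i) t)
    + hNorm σ ((dt I)^[j] (fun τ x => η τ x - 1) t) + hNorm σ ((dt I)^[j] w t)

/-- The time interval `[0, T)`, with `T` possibly infinite. -/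
def timeInterval (T : EReal) : Set ℝ := {t : ℝ | 0 ≤ t ∧ (t : EReal) < T}

end

end FavrieGavrilyuk

open FavrieGavrilyuk

/-! The algebra is short. The last two equations give η̈ = ẇ = -(λ/h²)(η - h), so λ(η/h)(η - h) =
-hη η̈, and expanding the definition of r yields r = h²ḧ + λ(η/h)(η - h). The pressure term of the
Favrie–Gavrilyuk system is therefore (μ/3h)∇(r - h²ḧ), which is the Green–Naghdi equation with
remainder.

Since η̈ - ḧ is the second material derivative of η - h, and this is linear in the derivatives ∂ₜʲ(η
- h), each term of r has a factor controlled by these derivatives; product laws give the first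
estimate (`norm_remSob_le`). For the second, λ(η - h) = -h²ẇ and its first two time derivatives
bound ∂ₜʲ(η - h) in H^{s-j} by λ⁻¹ times the norms of w (`IsFlow.norm_sub_le`), and this is inserted
in the first. The estimates themselves never divide by h: the lower bound on h is used only
qualitatively, to justify the identities, and the constants found do not depend on it.

The analysis rests on the product law H^α · H^β ⊂ H^γ for 0 ≤ γ ≤ min(α, β) and α + β - γ > d/2
(`exists_mul`), proved for ℝᵈ and 𝕋ᵈ together on the Fourier side: the convolution theorem for L²
functions (`FT_symm_convolution`), a pointwise bound on the weights (`wt_kernel_le`) and Young's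
inequality (`lintegral_sq_convolution_le'`). It yields the Leibniz rule (`pd_mul`), the embedding in
L^∞ (`exists_sup_bound`) and division by h in H¹ (`exists_div`). The unknowns become curves in the
spaces `Sob` (`Regular.exists_curve`), and the weak derivatives `dt`, `wd` of the statement are
identified, by uniqueness, with the derivatives of those curves.

The delicate point is to differentiate λ(η - h) + h²ẇ = 0 twice. The third derivative of w exists
only at the time considered and only when tested against smooth functions, whereas the product rule
would require testing against h²φ. `second_deriv_identity` instead solves the relation,
differentiated once, for ∂ₜẇ and differentiates the pairing of the quotient with φ;
`hasDerivWithinAt_transport_test` handles the transport terms inside ∂ₜẇ. -/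

namespace FavrieGavrilyuk

/-! ### The Fourier transform of L² functions on ℝᵈ -/

section Line

variable {d : ℕ}

local notation "E" => EuclideanSpace ℝ (Fin d)

/-- A real test function, seen as a complex Schwartz function. -/
noncomputable def schwartzOfTest (φ : EuclideanSpace ℝ (Fin d) → ℝ) (hφ : ContDiff ℝ ∞ φ)
    (hc : HasCompactSupport φ) : SchwartzMap (EuclideanSpace ℝ (Fin d)) ℂ :=
  (show HasCompactSupport (Complex.ofRealCLM ∘ φ) from hc.comp_left rfl).toSchwartzMap
    (by fun_prop)

theorem schwartzOfTest_apply (φ : E → ℝ) (hφ : ContDiff ℝ ∞ φ)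
    (hc : HasCompactSupport φ) (x : E) : schwartzOfTest φ hφ hc x = (φ x : ℂ) := rfl

/-- The L² Fourier transform agrees with the transform of tempered distributions. This pairing lets
identities between L² transforms be checked on test functions. -/
theorem integral_mul_lpFourier (f : Lp ℂ 2 (volume : Measure E)) (φ : SchwartzMap E ℂ) :
    ∫ ξ, φ ξ * (𝓕 f : Lp ℂ 2 (volume : Measure E)) ξ = ∫ x, (𝓕 φ : SchwartzMap E ℂ) x * f x := by
  have h := congrArg (fun T : TemperedDistribution E ℂ => T φ)
    (Lp.fourier_toTemperedDistribution_eq f)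
  simp only [TemperedDistribution.fourier_apply, Lp.toTemperedDistribution_apply,
    smul_eq_mul] at h
  exact h.symm

theorem ae_eq_of_integral_test_mul_eq {f g : E → ℂ} (hf : LocallyIntegrable f)
    (hg : LocallyIntegrable g)
    (h : ∀ (φ : E → ℝ), ContDiff ℝ ∞ φ → HasCompactSupport φ →
      ∫ x, (φ x : ℂ) * f x = ∫ x, (φ x : ℂ) * g x) : f =ᵐ[volume] g := by
  have key : ∀ᵐ x, (f - g) x = 0 := by
    refine ae_eq_zero_of_integral_contDiff_smul_eq_zero (hf.sub hg) fun φ h1 h2 => ?_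
    have e1 : Integrable fun x => φ x • f x :=
      hf.integrable_smul_left_of_hasCompactSupport h1.continuous h2
    have e2 : Integrable fun x => φ x • g x :=
      hg.integrable_smul_left_of_hasCompactSupport h1.continuous h2
    have := h φ h1 h2
    simp only [Pi.sub_apply, smul_sub]
    rw [integral_sub e1 e2, sub_eq_zero]
    simpa [Complex.real_smul] using this
  filter_upwards [key] with x hx
  exact sub_eq_zero.1 hx

theorem integral_mul_fourier_eq (f : E → ℂ) (hf : Integrable f) (φ : SchwartzMap E ℂ) :
    ∫ ξ, φ ξ * (𝓕 f) ξ = ∫ x, (𝓕 φ : SchwartzMap E ℂ) x * f x := by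
  have := VectorFourier.integral_bilin_fourierIntegral_eq_flip (ContinuousLinearMap.mul ℂ ℂ)
    (L := innerₗ E) (μ := volume) (ν := volume) (f := φ) (g := f)
    Real.continuous_fourierChar continuous_inner φ.integrable hf
  simp only [flip_innerₗ, ContinuousLinearMap.mul_apply'] at this
  exact this.symm

theorem memLp_modulation {f : E → ℂ} (hf : MemLp f 2 volume) (ξ : E) :
    MemLp (fun x => (Real.fourierChar (inner ℝ x ξ) : ℂ) * (starRingEnd ℂ) (f x)) 2 volume := by
  refine hf.congr_norm ?_ ?_
  · refine AEStronglyMeasurable.mul ?_ ?_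
    · exact (Continuous.aestronglyMeasurable (by fun_prop))
    · exact Complex.continuous_conj.comp_aestronglyMeasurable hf.1
  · filter_upwards with x
    rw [norm_mul, Circle.norm_coe, RCLike.norm_conj, one_mul]

/-- Modulation and conjugation become reflection, translation and conjugation. After testing, this
reduces to the integral formula for the transform of a Schwartz function. -/
theorem lpFourier_modulation {f : E → ℂ} (hf : MemLp f 2 volume) (ξ : E) :
    (𝓕 ((memLp_modulation hf ξ).toLp _) : Lp ℂ 2 (volume : Measure E)) =ᵐ[volume]
      fun η => (starRingEnd ℂ) ((𝓕 (hf.toLp f) : Lp ℂ 2 (volume : Measure E)) (ξ - η)) := by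
  set F := (𝓕 (hf.toLp f) : Lp ℂ 2 (volume : Measure E)) with hF
  have hmF : MemLp (fun η => (starRingEnd ℂ) (F (ξ - η))) 2 volume := by
    have h1 : MemLp (fun η => F (ξ - η)) 2 volume :=
      (Lp.memLp F).comp_measurePreserving (Measure.measurePreserving_sub_left volume ξ)
    exact h1.congr_norm (Complex.continuous_conj.comp_aestronglyMeasurable h1.1)
      (by filter_upwards with x; simp)
  refine ae_eq_of_integral_test_mul_eq ((Lp.memLp _).locallyIntegrable (by norm_num))
    (hmF.locallyIntegrable (by norm_num)) fun φ hφ hc => ?_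
  have a := integral_mul_lpFourier ((memLp_modulation hf ξ).toLp _) (schwartzOfTest φ hφ hc)
  simp only [schwartzOfTest_apply] at a
  rw [a]
  have hφ' : ContDiff ℝ ∞ (fun η => φ (ξ - η)) := by fun_prop
  have hc' : HasCompactSupport (fun η => φ (ξ - η)) :=
    hc.comp_homeomorph (Homeomorph.subLeft ξ)
  have b := integral_mul_lpFourier (hf.toLp f) (schwartzOfTest _ hφ' hc')
  simp only [schwartzOfTest_apply] at b
  have c : ∫ η, (φ η : ℂ) * (starRingEnd ℂ) (F (ξ - η))
      = (starRingEnd ℂ) (∫ η, (φ (ξ - η) : ℂ) * F η) := by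
    rw [← integral_conj, ← integral_sub_left_eq_self _ volume ξ]
    refine integral_congr_ae (Eventually.of_forall fun η => ?_)
    simp
  rw [c, b, ← integral_conj]
  refine integral_congr_ae ?_
  filter_upwards [hf.coeFn_toLp, (memLp_modulation hf ξ).coeFn_toLp] with x hx hx'
  rw [hx, hx', map_mul, ← mul_assoc]
  congr 1
  rw [SchwartzMap.fourier_coe, SchwartzMap.fourier_coe, Real.fourier_eq, Real.fourier_eq,
    ← integral_conj, ← integral_mul_const]
  conv_rhs => rw [← integral_sub_left_eq_self _ volume ξ]
  refine integral_congr_ae (Eventually.of_forall fun η => ?_)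
  simp only [schwartzOfTest_apply, sub_sub_cancel, Circle.smul_def, smul_eq_mul, map_mul,
    Complex.conj_ofReal]
  rw [← Circle.coe_inv_eq_conj, ← AddChar.map_neg_eq_inv, neg_neg, mul_right_comm, ← Circle.coe_mul,
    ← AddChar.map_add_eq_mul, inner_sub_left, real_inner_comm ξ x]
  congr 3
  ring_nf

end Line

section Line

variable {d : ℕ}

local notation "E" => EuclideanSpace ℝ (Fin d)

/-- Plancherel for g and the modulated conjugate of f: on the frequency side the inner product is
the convolution at ξ, on the space side it is the Fourier integral of the integrable function f g.
-/
theorem integral_lpFourier_mul_lpFourier {f g : E → ℂ} (hf : MemLp f 2 volume)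
    (hg : MemLp g 2 volume) (ξ : E) :
    ∫ η, (𝓕 (hf.toLp f) : Lp ℂ 2 (volume : Measure E)) (ξ - η) *
      (𝓕 (hg.toLp g) : Lp ℂ 2 (volume : Measure E)) η = 𝓕 (fun x => f x * g x) ξ := by
  have h := Lp.inner_fourier_eq ((memLp_modulation hf ξ).toLp _) (hg.toLp g)
  rw [L2.inner_def, L2.inner_def] at h
  rw [Real.fourier_eq]
  refine Eq.trans (integral_congr_ae ?_) (h.trans (integral_congr_ae ?_))
  · filter_upwards [lpFourier_modulation hf ξ] with η hη
    rw [hη]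
    simp [mul_comm]
  · filter_upwards [(memLp_modulation hf ξ).coeFn_toLp, hg.coeFn_toLp] with x hx hx'
    rw [hx, hx']
    simp only [RCLike.inner_apply, map_mul, Circle.smul_def, smul_eq_mul]
    rw [← Circle.coe_inv_eq_conj, ← AddChar.map_neg_eq_inv, RCLike.conj_conj]
    ring

/-- Reconciles the L¹ and L² transforms: writing a test function as a Fourier transform moves both
pairings to the frequency side, where the two functions coincide. -/
theorem lpFourier_symm_ae_eq_of_fourier {p : E → ℂ} (hp : Integrable p)
    (K : Lp ℂ 2 (volume : Measure E)) (hK : K =ᵐ[volume] 𝓕 p) :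
    ((Lp.fourierTransformₗᵢ E ℂ).symm K : Lp ℂ 2 (volume : Measure E)) =ᵐ[volume] p := by
  refine ae_eq_of_integral_test_mul_eq ((Lp.memLp _).locallyIntegrable (by norm_num))
    hp.locallyIntegrable fun φ hφ hc => ?_
  set ψ := schwartzOfTest φ hφ hc
  have e : (𝓕 (𝓕⁻ ψ) : SchwartzMap E ℂ) = ψ := FourierTransform.fourier_fourierInv_eq ψ
  have a := integral_mul_lpFourier ((Lp.fourierTransformₗᵢ E ℂ).symm K) (𝓕⁻ ψ)
  have b := integral_mul_fourier_eq p hp (𝓕⁻ ψ)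
  rw [e] at a b
  have c : (𝓕 ((Lp.fourierTransformₗᵢ E ℂ).symm K) : Lp ℂ 2 (volume : Measure E)) = K :=
    (Lp.fourierTransformₗᵢ E ℂ).apply_symm_apply K
  rw [c] at a
  have : ∀ x, ψ x = (φ x : ℂ) := fun x => rfl
  simp only [this] at a b
  rw [← a, ← b]
  refine integral_congr_ae ?_
  filter_upwards [hK] with x hx
  rw [hx]

theorem integrable_mul_of_memLp_two {α : Type*} [MeasurableSpace α] {μ : Measure α} {f g : α → ℂ}
    (hf : MemLp f 2 μ) (hg : MemLp g 2 μ) : Integrable (fun x => f x * g x) μ :=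
  hf.integrable_mul hg

/-- A priori f g is only integrable; that its convolution of transforms is represented by some K in
L² is what places f g in L². -/
theorem lpFourier_symm_convolution {f g : E → ℂ} (hf : MemLp f 2 volume)
    (hg : MemLp g 2 volume) (K : Lp ℂ 2 (volume : Measure E))
    (hK : K =ᵐ[volume] fun ξ => ∫ η, (𝓕 (hf.toLp f) : Lp ℂ 2 (volume : Measure E)) (ξ - η) *
      (𝓕 (hg.toLp g) : Lp ℂ 2 (volume : Measure E)) η) :
    ((Lp.fourierTransformₗᵢ E ℂ).symm K : Lp ℂ 2 (volume : Measure E)) =ᵐ[volume]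
      fun x => f x * g x := by
  refine lpFourier_symm_ae_eq_of_fourier (integrable_mul_of_memLp_two hf hg) K ?_
  filter_upwards [hK] with ξ hξ
  rw [hξ, integral_lpFourier_mul_lpFourier]

open LineDeriv in
theorem lpFourier_deriv {φ : E → ℝ} (hφ : ContDiff ℝ ∞ φ) (hc : HasCompactSupport φ) (i : Fin d)
    (h2 : MemLp (fun x => (φ x : ℂ)) 2 volume)
    (h2' : MemLp (fun x => ((deriv (fun τ : ℝ => φ (x + EuclideanSpace.single i τ)) 0 : ℝ) : ℂ))
      2 volume) :
    (𝓕 (h2'.toLp _) : Lp ℂ 2 (volume : Measure E)) =ᵐ[volume]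
      fun ξ => (2 * Real.pi * Complex.I * (ξ i : ℂ)) *
        (𝓕 (h2.toLp _) : Lp ℂ 2 (volume : Measure E)) ξ := by
  set ψ := schwartzOfTest φ hφ hc with hψ
  have e1 : h2.toLp _ = ψ.toLp 2 volume := by
    apply Lp.ext
    filter_upwards [h2.coeFn_toLp, ψ.coeFn_toLp 2 volume] with x h h'
    rw [h, h']; rfl
  have e2 : h2'.toLp _ = (∂_{(EuclideanSpace.single i (1 : ℝ))} ψ : SchwartzMap E ℂ).toLp 2 volume := by
    apply Lp.ext
    filter_upwards [h2'.coeFn_toLp, (∂_{(EuclideanSpace.single i (1 : ℝ))} ψ :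
      SchwartzMap E ℂ).coeFn_toLp 2 volume] with x h h'
    rw [h, h', SchwartzMap.lineDerivOp_apply, lineDeriv]
    have hs : ∀ t : ℝ, (t • EuclideanSpace.single i (1 : ℝ) : E) = EuclideanSpace.single i t := by
      intro t; ext j; by_cases hj : j = i <;> simp [hj]
    simp only [hs]
    have hd : DifferentiableAt ℝ (fun τ : ℝ => φ (x + EuclideanSpace.single i τ)) 0 := by
      have h3 : (fun τ : ℝ => φ (x + EuclideanSpace.single i τ))
          = fun τ : ℝ => φ (x + τ • EuclideanSpace.single i (1 : ℝ)) := by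
        funext τ; rw [hs]
      rw [h3]
      have := hφ.differentiable (by simp)
      fun_prop
    exact (hd.hasDerivAt.ofReal_comp).deriv.symm
  rw [e1, e2, SchwartzMap.toLp_fourier_eq, SchwartzMap.toLp_fourier_eq,
    SchwartzMap.fourier_lineDerivOp_eq]
  filter_upwards [SchwartzMap.coeFn_toLp (𝓕 ψ) 2 volume, SchwartzMap.coeFn_toLp
    ((2 * Real.pi * Complex.I) • SchwartzMap.smulLeftCLM ℂ
      (fun x : E => inner ℝ x (EuclideanSpace.single i (1 : ℝ))) (𝓕 ψ)) 2 volume] with ξ h h'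
  rw [h, h']
  have ht : (fun x : E => inner ℝ x (EuclideanSpace.single i (1 : ℝ))).HasTemperateGrowth :=
    ((innerSL ℝ).flip (EuclideanSpace.single i (1 : ℝ) : E)).hasTemperateGrowth
  rw [_root_.smul_apply, SchwartzMap.smulLeftCLM_apply_apply ht]
  simp [EuclideanSpace.inner_single_right]
  ring

end Line

/-! ### ℓ² as the L² space of the counting measure -/

section Count

theorem memlp_two_iff_summable {κ : Type*} (a : κ → ℂ) :
    Memℓp a 2 ↔ Summable fun i => ‖a i‖ ^ 2 := by
  rw [memℓp_gen_iff (by norm_num)]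
  simp

variable {ι : Type*} [MeasurableSpace ι] [Countable ι] [MeasurableSingletonClass ι]

theorem memLp_count_iff_summable (a : ι → ℂ) :
    MemLp a 2 (Measure.count : Measure ι) ↔ Summable fun i => ‖a i‖ ^ 2 := by
  rw [memLp_two_iff_integrable_sq_norm .of_discrete, integrable_count_iff]
  simp

theorem norm_sq_toLp_count {f : ι → ℂ} (hm : MemLp f 2 (Measure.count : Measure ι)) :
    ‖hm.toLp f‖ ^ 2 = ∑' i, ‖f i‖ ^ 2 := by
  have h3 : Integrable (fun i => ‖f i‖ ^ 2) (Measure.count : Measure ι) :=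
    hm.integrable_norm_pow (by norm_num)
  have h4 : (inner ℂ (hm.toLp f) (hm.toLp f) : ℂ) = ((∑' i, ‖f i‖ ^ 2 : ℝ) : ℂ) := by
    rw [L2.inner_def]
    have h5 : ∀ᵐ i ∂(Measure.count : Measure ι), (inner ℂ (hm.toLp f i) (hm.toLp f i) : ℂ)
        = ((‖f i‖ ^ 2 : ℝ) : ℂ) := by
      filter_upwards [hm.coeFn_toLp] with i hi
      rw [hi, inner_self_eq_norm_sq_to_K]; simp
    rw [integral_congr_ae h5, integral_complex_ofReal, integral_countable h3]
    simp
  rw [inner_self_eq_norm_sq_to_K] at h4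
  exact Complex.ofReal_injective (by simpa using h4)

theorem memLp_count_coe (a : lp (fun _ : ι => ℂ) 2) :
    MemLp (fun i => a i) 2 (Measure.count : Measure ι) :=
  (memLp_count_iff_summable _).2 ((memlp_two_iff_summable _).1 a.2)

/-- `ℓ²` as an `L²` space for the counting measure. -/
noncomputable def lpToCount :
    lp (fun _ : ι => ℂ) 2 ≃ₗᵢ[ℂ] Lp ℂ 2 (Measure.count : Measure ι) :=
  LinearIsometryEquiv.ofSurjective
    { toFun := fun a => (memLp_count_coe a).toLp _
      map_add' := fun a b => MemLp.toLp_add (memLp_count_coe a) (memLp_count_coe b)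
      map_smul' := fun c a => MemLp.toLp_const_smul c (memLp_count_coe a)
      norm_map' := fun a => by
        have h1 := lp.norm_rpow_eq_tsum (p := 2) (by norm_num) a
        simp only [ENNReal.toReal_ofNat, Real.rpow_ofNat] at h1
        exact (sq_eq_sq₀ (norm_nonneg _) (norm_nonneg _)).1
          ((norm_sq_toLp_count (memLp_count_coe a)).trans h1.symm) }
    (fun f => ⟨⟨fun i => f i, (memlp_two_iff_summable _).2
      ((memLp_count_iff_summable _).1 (Lp.memLp f))⟩, Lp.toLp_coeFn f (Lp.memLp f)⟩)

theorem lpToCount_apply (a : lp (fun _ : ι => ℂ) 2) (i : ι) : lpToCount a i = a i := by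
  have h : lpToCount a =ᵐ[Measure.count] fun i => a i := MemLp.coeFn_toLp (memLp_count_coe a)
  rw [Filter.EventuallyEq, Measure.ae_count_iff] at h
  exact h i

end Count

/-! ### Fourier series of L² functions on the torus -/

section Torus

/-- The Haar probability measure of the circle. -/
noncomputable local instance : MeasureSpace UnitAddCircle := ⟨AddCircle.haarAddCircle⟩

local instance : Measure.IsAddHaarMeasure (volume : Measure UnitAddCircle) :=
  inferInstanceAs (Measure.IsAddHaarMeasure AddCircle.haarAddCircle)

local instance : IsProbabilityMeasure (volume : Measure UnitAddCircle) :=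
  inferInstanceAs (IsProbabilityMeasure AddCircle.haarAddCircle)

open UnitAddTorus

variable {d : ℕ}

local notation "T" => UnitAddTorus (Fin d)

/-- The Fourier series of square-integrable functions on the torus. -/
noncomputable def torusFourier :
    Lp ℂ 2 (volume : Measure (UnitAddTorus (Fin d))) ≃ₗᵢ[ℂ]
      Lp ℂ 2 (Measure.count : Measure (Fin d → ℤ)) :=
  mFourierBasis.repr.trans lpToCount

theorem torusFourier_apply (f : Lp ℂ 2 (volume : Measure T)) (k : Fin d → ℤ) :
    torusFourier f k = mFourierCoeff f k := by
  simp [torusFourier, lpToCount_apply, mFourierBasis_repr]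

theorem mFourierCoeff_congr_ae {f g : T → ℂ} (h : f =ᵐ[volume] g) :
    mFourierCoeff f = mFourierCoeff g := by
  funext k
  refine integral_congr_ae ?_
  filter_upwards [h] with x hx
  rw [hx]

theorem torusFourier_toLp {f : T → ℂ} (hf : MemLp f 2 volume) (k : Fin d → ℤ) :
    torusFourier (hf.toLp f) k = mFourierCoeff f k := by
  rw [torusFourier_apply, mFourierCoeff_congr_ae hf.coeFn_toLp]

theorem memLp_torus_modulation {f : T → ℂ} (hf : MemLp f 2 volume) (k : Fin d → ℤ) :
    MemLp (fun x => mFourier k x * (starRingEnd ℂ) (f x)) 2 volume := by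
  refine hf.congr_norm ?_ ?_
  · exact ((mFourier k).continuous.aestronglyMeasurable).mul
      (Complex.continuous_conj.comp_aestronglyMeasurable hf.1)
  · filter_upwards with x
    rw [norm_mul, RCLike.norm_conj]
    simp only [mFourier, ContinuousMap.coe_mk, norm_prod, fourier_apply, Circle.norm_coe,
      Finset.prod_const_one, one_mul]

theorem mFourierCoeff_modulation (f : T → ℂ) (k l : Fin d → ℤ) :
    mFourierCoeff (fun x => mFourier k x * (starRingEnd ℂ) (f x)) l
      = (starRingEnd ℂ) (mFourierCoeff f (k - l)) := by
  rw [mFourierCoeff, mFourierCoeff, ← integral_conj]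
  refine integral_congr_ae (Eventually.of_forall fun x => ?_)
  simp only [smul_eq_mul, map_mul, ← mFourier_neg, neg_neg]
  rw [sub_eq_add_neg, mFourier_add]
  ring

theorem integral_torusFourier_mul {f g : T → ℂ} (hf : MemLp f 2 volume)
    (hg : MemLp g 2 volume) (k : Fin d → ℤ) :
    ∫ l, torusFourier (hf.toLp f) (k - l) * torusFourier (hg.toLp g) l ∂Measure.count
      = mFourierCoeff (fun x => f x * g x) k := by
  have h := torusFourier.inner_map_map ((memLp_torus_modulation hf k).toLp _) (hg.toLp g)
  rw [L2.inner_def, L2.inner_def] at h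
  refine Eq.trans (integral_congr_ae ?_) (h.trans (integral_congr_ae ?_))
  · filter_upwards with l
    simp only [torusFourier_toLp, mFourierCoeff_modulation]
    simp [mul_comm]
  · filter_upwards [(memLp_torus_modulation hf k).coeFn_toLp, hg.coeFn_toLp] with x hx hx'
    rw [hx, hx']
    simp only [RCLike.inner_apply, map_mul, smul_eq_mul, mFourier_neg, RCLike.conj_conj]
    ring

/-- The functional φ ↦ ∫ φ p is continuous for the sup norm and vanishes on trigonometric monomials,
whose span is dense in the continuous functions. -/
theorem integral_mul_eq_zero_of_mFourierCoeff {p : T → ℂ} (hp : Integrable p)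
    (h : ∀ k, mFourierCoeff p k = 0) (φ : C(T, ℂ)) : ∫ x, φ x * p x = 0 := by
  have hint : ∀ φ : C(T, ℂ), Integrable fun x => φ x * p x := fun φ =>
    hp.bdd_mul φ.continuous.aestronglyMeasurable (Eventually.of_forall φ.norm_coe_le_norm)
  let L : C(T, ℂ) →L[ℂ] ℂ := LinearMap.mkContinuous
    { toFun := fun φ => ∫ x, φ x * p x
      map_add' := fun a b => by
        simp only [ContinuousMap.add_apply, add_mul]
        exact integral_add (hint a) (hint b)
      map_smul' := fun c a => by
        simp only [ContinuousMap.smul_apply, smul_eq_mul, mul_assoc, integral_const_mul,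
          RingHom.id_apply] } (∫ x, ‖p x‖) (fun φ => by
        refine (norm_integral_le_integral_norm _).trans ?_
        rw [mul_comm, ← integral_const_mul]
        refine integral_mono (hint φ).norm (hp.norm.const_mul _) fun x => ?_
        simp only [norm_mul]
        gcongr
        exact φ.norm_coe_le_norm x)
  have hL : Submodule.span ℂ (Set.range (mFourier (d := Fin d))) ≤ LinearMap.ker (L : C(T, ℂ) →ₗ[ℂ] ℂ) := by
    rw [Submodule.span_le]
    rintro _ ⟨k, rfl⟩
    have := h (-k)
    simp only [mFourierCoeff, neg_neg, smul_eq_mul] at this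
    exact this
  have h2 : (⊤ : Submodule ℂ C(T, ℂ)) ≤ LinearMap.ker (L : C(T, ℂ) →ₗ[ℂ] ℂ) := by
    rw [← span_mFourier_closure_eq_top]
    exact Submodule.topologicalClosure_minimal _ hL L.isClosed_ker
  exact h2 (Submodule.mem_top (x := φ))

/-- Indicators of closed sets are bounded pointwise limits of continuous functions (thickened
indicators), so p has zero integral on every closed set. -/
theorem ae_eq_zero_of_mFourierCoeff {p : T → ℂ} (hp : Integrable p)
    (h : ∀ k, mFourierCoeff p k = 0) : p =ᵐ[volume] 0 := by
  refine ae_eq_zero_of_forall_setIntegral_isClosed_eq_zero hp fun s hs => ?_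
  have hδ : Tendsto (fun n : ℕ => 1 / ((n : ℝ) + 1)) atTop (𝓝 0) :=
    tendsto_one_div_add_atTop_nhds_zero_nat
  have hpos : ∀ n : ℕ, 0 < 1 / ((n : ℝ) + 1) := fun n => by positivity
  have lim := thickenedIndicator_tendsto_indicator_closure hpos hδ s
  rw [tendsto_pi_nhds] at lim
  have hz : ∀ n : ℕ, ∫ x, ((thickenedIndicator (hpos n) s x : ℝ) : ℂ) * p x = 0 := fun n =>
    integral_mul_eq_zero_of_mFourierCoeff hp h
      ⟨fun x => ((thickenedIndicator (hpos n) s x : ℝ) : ℂ), by fun_prop⟩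
  have T1 : Tendsto (fun n : ℕ => ∫ x, ((thickenedIndicator (hpos n) s x : ℝ) : ℂ) * p x) atTop
      (𝓝 (∫ x, s.indicator p x)) := by
    refine tendsto_integral_of_dominated_convergence (fun x => ‖p x‖) (fun n => ?_) hp.norm
      (fun n => ?_) ?_
    · exact (Continuous.aestronglyMeasurable (by fun_prop)).mul hp.1
    · filter_upwards with x
      rw [norm_mul]
      refine mul_le_of_le_one_left (norm_nonneg _) ?_
      rw [Complex.norm_real, Real.norm_of_nonneg (NNReal.coe_nonneg _)]
      exact_mod_cast thickenedIndicator_le_one (hpos n) s x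
    · filter_upwards with x
      have h1 : Tendsto (fun n : ℕ => ((thickenedIndicator (hpos n) s x : ℝ) : ℂ)) atTop
          (𝓝 (((s.indicator (fun _ => (1 : NNReal)) x : NNReal) : ℝ) : ℂ)) := by
        have := lim x
        rw [hs.closure_eq] at this
        exact (Complex.continuous_ofReal.tendsto _).comp ((NNReal.continuous_coe.tendsto _).comp this)
      have h2 := h1.mul_const (p x)
      convert h2 using 2
      by_cases hx : x ∈ s <;> simp [hx]
  simp only [hz] at T1
  rw [← integral_indicator hs.measurableSet]
  exact (tendsto_nhds_unique T1 tendsto_const_nhds)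

theorem torusFourier_symm_convolution {f g : T → ℂ} (hf : MemLp f 2 volume)
    (hg : MemLp g 2 volume) (K : Lp ℂ 2 (Measure.count : Measure (Fin d → ℤ)))
    (hK : K =ᵐ[Measure.count] fun k => ∫ l, torusFourier (hf.toLp f) (k - l) *
      torusFourier (hg.toLp g) l ∂Measure.count) :
    torusFourier.symm K =ᵐ[volume] fun x => f x * g x := by
  rw [Filter.EventuallyEq, Measure.ae_count_iff] at hK
  have h1 : Integrable (torusFourier.symm K : T → ℂ) :=
    (Lp.memLp (torusFourier.symm K)).integrable (by norm_num)
  have h2 : Integrable fun x => f x * g x := integrable_mul_of_memLp_two hf hg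
  have : (fun x => torusFourier.symm K x - f x * g x) =ᵐ[volume] 0 := by
    refine ae_eq_zero_of_mFourierCoeff (h1.sub h2) fun k => ?_
    have e : mFourierCoeff (fun x => torusFourier.symm K x - f x * g x) k
        = mFourierCoeff (torusFourier.symm K) k - mFourierCoeff (fun x => f x * g x) k := by
      simp only [mFourierCoeff, smul_sub]
      refine integral_sub ?_ ?_
      · exact h1.bdd_mul (mFourier (-k)).continuous.aestronglyMeasurable
          (Eventually.of_forall (mFourier (-k)).norm_coe_le_norm)
      · exact h2.bdd_mul (mFourier (-k)).continuous.aestronglyMeasurable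
          (Eventually.of_forall (mFourier (-k)).norm_coe_le_norm)
    rw [e, ← torusFourier_apply, LinearIsometryEquiv.apply_symm_apply, hK,
      integral_torusFourier_mul, sub_self]
  filter_upwards [this] with x hx
  exact sub_eq_zero.1 hx

/-! ### Structure common to the two geometries -/

instance (D : Geometry) (d : ℕ) : BorelSpace (Pt D d) :=
  match D with
  | .line => inferInstanceAs (BorelSpace (EuclideanSpace ℝ (Fin d)))
  | .torus => inferInstanceAs (BorelSpace (UnitAddTorus (Fin d)))

instance (D : Geometry) (d : ℕ) : T2Space (Pt D d) :=
  match D with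
  | .line => inferInstanceAs (T2Space (EuclideanSpace ℝ (Fin d)))
  | .torus => inferInstanceAs (T2Space (UnitAddTorus (Fin d)))

instance (D : Geometry) (d : ℕ) : LocallyCompactSpace (Pt D d) :=
  match D with
  | .line => inferInstanceAs (LocallyCompactSpace (EuclideanSpace ℝ (Fin d)))
  | .torus => inferInstanceAs (LocallyCompactSpace (UnitAddTorus (Fin d)))

instance (D : Geometry) (d : ℕ) : SecondCountableTopology (Pt D d) :=
  match D with
  | .line => inferInstanceAs (SecondCountableTopology (EuclideanSpace ℝ (Fin d)))
  | .torus => inferInstanceAs (SecondCountableTopology (UnitAddTorus (Fin d)))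

instance (D : Geometry) (d : ℕ) : IsLocallyFiniteMeasure (volume : Measure (Pt D d)) :=
  match D with
  | .line => inferInstanceAs
      (IsLocallyFiniteMeasure (volume : Measure (EuclideanSpace ℝ (Fin d))))
  | .torus => inferInstanceAs
      (IsLocallyFiniteMeasure (volume : Measure (UnitAddTorus (Fin d))))

instance (D : Geometry) (d : ℕ) : AddCommGroup (Freq D d) :=
  match D with
  | .line => inferInstanceAs (AddCommGroup (EuclideanSpace ℝ (Fin d)))
  | .torus => inferInstanceAs (AddCommGroup (Fin d → ℤ))

instance (D : Geometry) (d : ℕ) : MeasurableAdd₂ (Freq D d) :=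
  match D with
  | .line => inferInstanceAs (MeasurableAdd₂ (EuclideanSpace ℝ (Fin d)))
  | .torus => inferInstanceAs (MeasurableAdd₂ (Fin d → ℤ))

instance (D : Geometry) (d : ℕ) : MeasurableNeg (Freq D d) :=
  match D with
  | .line => inferInstanceAs (MeasurableNeg (EuclideanSpace ℝ (Fin d)))
  | .torus => inferInstanceAs (MeasurableNeg (Fin d → ℤ))

instance (D : Geometry) (d : ℕ) : SFinite (volume : Measure (Freq D d)) :=
  match D with
  | .line => inferInstanceAs (SFinite (volume : Measure (EuclideanSpace ℝ (Fin d))))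
  | .torus => inferInstanceAs (SFinite (Measure.count : Measure (Fin d → ℤ)))

instance (D : Geometry) (d : ℕ) :
    Measure.IsAddLeftInvariant (volume : Measure (Freq D d)) :=
  match D with
  | .line => inferInstanceAs
      (Measure.IsAddLeftInvariant (volume : Measure (EuclideanSpace ℝ (Fin d))))
  | .torus => inferInstanceAs
      (Measure.IsAddLeftInvariant (Measure.count : Measure (Fin d → ℤ)))

instance (D : Geometry) (d : ℕ) :
    Measure.IsNegInvariant (volume : Measure (Freq D d)) :=
  match D with
  | .line => inferInstanceAs
      (Measure.IsNegInvariant (volume : Measure (EuclideanSpace ℝ (Fin d))))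
  | .torus => ⟨by
      change Measure.map (Neg.neg : (Fin d → ℤ) → _) Measure.count = Measure.count
      ext s hs
      rw [Measure.map_apply measurable_neg hs, Measure.count_apply (measurable_neg hs),
        Measure.count_apply hs]
      exact congrArg _ (Set.encard_preimage_of_bijective (Equiv.neg (Fin d → ℤ)).bijective s)⟩

end Torus

/-! ### Frequencies and integrability of the Sobolev weight -/

/-- The coordinates of a frequency. -/
def freqCoord (D : Geometry) (d : ℕ) (i : Fin d) (ξ : Freq D d) : ℝ :=
  match D, ξ with
  | .line, (ξ : EuclideanSpace ℝ (Fin d)) => ξ i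
  | .torus, (k : Fin d → ℤ) => (k i : ℝ)

variable {D : Geometry} {d : ℕ}

theorem freqSq_eq_sum (ξ : Freq D d) : freqSq D d ξ = ∑ i, freqCoord D d i ξ ^ 2 := by
  cases D
  · exact EuclideanSpace.real_norm_sq_eq (n := Fin d) ξ
  · rfl

theorem freqCoord_add (i : Fin d) (ξ η : Freq D d) :
    freqCoord D d i (ξ + η) = freqCoord D d i ξ + freqCoord D d i η := by
  cases D
  · rfl
  · exact Int.cast_add _ _

theorem measurable_freqCoord (i : Fin d) : Measurable (freqCoord D d i) := by
  cases D
  · change Measurable fun ξ : EuclideanSpace ℝ (Fin d) => ξ i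
    fun_prop
  · change Measurable fun k : Fin d → ℤ => (k i : ℝ)
    fun_prop

theorem measurable_freqSq : Measurable (freqSq D d) := by
  have : freqSq D d = fun ξ => ∑ i, freqCoord D d i ξ ^ 2 := funext freqSq_eq_sum
  rw [this]
  exact Finset.measurable_fun_sum _ fun i _ => (measurable_freqCoord i).pow_const 2

theorem freqSq_nonneg (ξ : Freq D d) : 0 ≤ freqSq D d ξ := by
  rw [freqSq_eq_sum]; positivity

/-- The symbol of `1 - Δ`. -/
noncomputable def japSq (D : Geometry) (d : ℕ) (ξ : Freq D d) : ℝ :=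
  1 + (2 * Real.pi) ^ 2 * freqSq D d ξ

theorem one_le_japSq (ξ : Freq D d) : 1 ≤ japSq D d ξ := by
  have := freqSq_nonneg ξ
  unfold japSq
  nlinarith [mul_nonneg (sq_nonneg (2 * Real.pi)) this]

theorem japSq_pos (ξ : Freq D d) : 0 < japSq D d ξ := one_pos.trans_le (one_le_japSq ξ)

theorem measurable_japSq : Measurable (japSq D d) :=
  (measurable_freqSq.const_mul _).const_add _

/-- Comparison with the lattice sum of ‖k‖^(-2m) in the sup norm, convergent for 2m > d. The
frequency 0 is dominated separately, by an indicator. -/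
theorem summable_torus_weight {m : ℝ} (hm : (d : ℝ) / 2 < m) :
    Summable fun k : Fin d → ℤ => (1 + (2 * Real.pi) ^ 2 * ∑ i, (k i : ℝ) ^ 2) ^ (-m) := by
  let b := Pi.basisFun ℝ (Fin d)
  let Λ := Submodule.span ℤ (Set.range b)
  have hr : Module.finrank ℤ Λ = d := by
    rw [ZLattice.rank ℝ Λ]; simp
  have h1 : Summable fun z : Λ => ‖z‖ ^ (-(2 * m)) := by
    refine ZLattice.summable_norm_rpow Λ _ ?_
    rw [hr]; linarith
  have hmem : ∀ k : Fin d → ℤ, (fun i => (k i : ℝ)) ∈ Λ := fun k => by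
    have : (fun i => (k i : ℝ)) = ∑ i, k i • b i := by
      ext j
      simp [b, Finset.sum_apply, Pi.single_apply]
    rw [this]
    exact Submodule.sum_mem _ fun i _ => Submodule.smul_mem _ _ (Submodule.subset_span ⟨i, rfl⟩)
  have hinj : Function.Injective fun k : Fin d → ℤ => (⟨fun i => (k i : ℝ), hmem k⟩ : Λ) := by
    intro k l h
    funext i
    have : (k i : ℝ) = l i := congrFun (congrArg Subtype.val h) i
    exact_mod_cast this
  have h2 := h1.comp_injective hinj
  have h3 : Summable fun k : Fin d → ℤ => if k = 0 then (1 : ℝ) else 0 :=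
    summable_of_ne_finset_zero (s := {0}) fun k hk => by simp at hk; simp [hk]
  refine Summable.of_nonneg_of_le (fun k => by positivity) (fun k => ?_) (h3.add h2)
  by_cases hk : k = 0
  · simp only [hk, if_true, Function.comp]
    have : (0 : ℝ) ≤ ‖(⟨fun i => (((0 : Fin d → ℤ) i : ℤ) : ℝ), hmem 0⟩ : Λ)‖ ^ (-(2 * m)) := by
      positivity
    simpa using this
  · simp only [hk, if_false, Function.comp, zero_add]
    have hpos : 0 < ‖(⟨fun i => (k i : ℝ), hmem k⟩ : Λ)‖ := by
      rw [norm_pos_iff]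
      intro h
      apply hk
      funext i
      have : (k i : ℝ) = 0 := congrFun (congrArg Subtype.val h) i
      exact_mod_cast this
    have hm0 : 0 < m := lt_of_le_of_lt (by positivity) hm
    rw [show -(2 * m) = (2 : ℝ) * (-m) by ring, Real.rpow_mul hpos.le]
    refine Real.rpow_le_rpow_of_nonpos (by positivity) ?_ (by linarith)
    have h4 : ‖(⟨fun i => (k i : ℝ), hmem k⟩ : Λ)‖ ^ 2 ≤ ∑ i, (k i : ℝ) ^ 2 := by
      have h5 : ‖(⟨fun i => (k i : ℝ), hmem k⟩ : Λ)‖ ≤ √(∑ i, (k i : ℝ) ^ 2) := by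
        change ‖(fun i => (k i : ℝ))‖ ≤ _
        refine (pi_norm_le_iff_of_nonneg (by positivity)).2 fun i => ?_
        rw [Real.norm_eq_abs, ← Real.sqrt_sq_eq_abs]
        exact Real.sqrt_le_sqrt
          (Finset.single_le_sum (f := fun i => (k i : ℝ) ^ 2) (fun j _ => by positivity)
            (Finset.mem_univ i))
      calc _ ≤ √(∑ i, (k i : ℝ) ^ 2) ^ 2 := by gcongr
        _ = _ := Real.sq_sqrt (by positivity)
    have h6 : 1 ≤ (2 * Real.pi) ^ 2 := by nlinarith [Real.pi_gt_three]
    rw [Real.rpow_ofNat]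
    nlinarith [sq_nonneg ‖(⟨fun i => (k i : ℝ), hmem k⟩ : Λ)‖]

theorem lintegral_japSq_lt_top {m : ℝ} (hm : (d : ℝ) / 2 < m) :
    ∫⁻ ξ : Freq D d, ENNReal.ofReal (japSq D d ξ ^ (-m)) < ⊤ := by
  have hm0 : 0 < m := lt_of_le_of_lt (by positivity) hm
  cases D
  · have h := integrable_rpow_neg_one_add_norm_sq (E := EuclideanSpace ℝ (Fin d)) (μ := volume)
      (r := 2 * m) (by simp; linarith)
    have h6 : 1 ≤ (2 * Real.pi) ^ 2 := by nlinarith [Real.pi_gt_three]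
    have h7 : ∀ ξ : EuclideanSpace ℝ (Fin d), (1 + (2 * Real.pi) ^ 2 * ‖ξ‖ ^ 2) ^ (-m)
        ≤ (1 + ‖ξ‖ ^ 2) ^ (-(2 * m) / 2) := fun ξ => by
      rw [show -(2 * m) / 2 = -m by ring]
      refine Real.rpow_le_rpow_of_nonpos (by positivity) ?_ (by linarith)
      nlinarith [sq_nonneg ‖ξ‖]
    exact lt_of_le_of_lt (lintegral_mono fun ξ => ENNReal.ofReal_le_ofReal (h7 ξ))
      h.lintegral_lt_top
  · change ∫⁻ k : Fin d → ℤ, ENNReal.ofReal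
      ((1 + (2 * Real.pi) ^ 2 * ∑ i, (k i : ℝ) ^ 2) ^ (-m)) ∂Measure.count < ⊤
    rw [lintegral_count]
    exact (summable_torus_weight hm).tsum_ofReal_lt_top

/-! ### The common Fourier transform, and test functions -/

section Torus

noncomputable local instance : MeasureSpace UnitAddCircle := ⟨AddCircle.haarAddCircle⟩

local instance : Measure.IsAddHaarMeasure (volume : Measure UnitAddCircle) :=
  inferInstanceAs (Measure.IsAddHaarMeasure AddCircle.haarAddCircle)

local instance : IsProbabilityMeasure (volume : Measure UnitAddCircle) :=
  inferInstanceAs (IsProbabilityMeasure AddCircle.haarAddCircle)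

/-- The Fourier transform as an isometry of `L²(𝔻ᵈ)` onto the `L²` space of frequencies. -/
noncomputable def FT (D : Geometry) (d : ℕ) :
    Lp ℂ 2 (volume : Measure (Pt D d)) ≃ₗᵢ[ℂ] Lp ℂ 2 (volume : Measure (Freq D d)) :=
  match D with
  | .line => Lp.fourierTransformₗᵢ (EuclideanSpace ℝ (Fin d)) ℂ
  | .torus => torusFourier

variable {D : Geometry} {d : ℕ}

theorem fourierLine_of_memLp {f : EuclideanSpace ℝ (Fin d) → ℂ} (hf : MemLp f 2 volume) :
    fourierLine d f =
      (𝓕 (hf.toLp f) : Lp ℂ 2 (volume : Measure (EuclideanSpace ℝ (Fin d)))) := by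
  rw [fourierLine, dif_pos hf]

theorem fourierLine_congr_ae {f g : EuclideanSpace ℝ (Fin d) → ℂ} (h : f =ᵐ[volume] g) :
    fourierLine d f = fourierLine d g := by
  by_cases hf : MemLp f 2 volume
  · have hg := (memLp_congr_ae h).1 hf
    rw [fourierLine_of_memLp hf, fourierLine_of_memLp hg, MemLp.toLp_congr hf hg h]
  · have hg : ¬ MemLp g 2 volume := fun hg => hf ((memLp_congr_ae h).2 hg)
    rw [fourierLine, fourierLine, dif_neg hf, dif_neg hg]

theorem FT_toLp {f : Pt D d → ℝ} (hf : MemLp (fun x => (f x : ℂ)) 2 volume) :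
    FT D d (hf.toLp _) =ᵐ[volume] fourierT D d f := by
  cases D
  · exact EventuallyEq.of_eq (fourierLine_of_memLp (d := d) hf).symm
  · exact Eventually.of_forall fun k =>
      torusFourier_toLp (f := fun x : UnitAddTorus (Fin d) => (f x : ℂ)) hf k

theorem FT_symm_convolution {f g : Pt D d → ℂ} (hf : MemLp f 2 volume)
    (hg : MemLp g 2 volume) (K : Lp ℂ 2 (volume : Measure (Freq D d)))
    (hK : K =ᵐ[volume] fun ξ => ∫ η, FT D d (hf.toLp f) (ξ - η) * FT D d (hg.toLp g) η) :
    (FT D d).symm K =ᵐ[volume] fun x => f x * g x := by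
  cases D
  · exact lpFourier_symm_convolution (d := d) hf hg K hK
  · exact torusFourier_symm_convolution (d := d) hf hg K hK

theorem fourierT_congr_ae {f g : Pt D d → ℝ} (h : f =ᵐ[volume] g) :
    fourierT D d f = fourierT D d g := by
  have h' : (fun x => (f x : ℂ)) =ᵐ[volume] fun x => (g x : ℂ) := by
    filter_upwards [h] with x hx
    rw [hx]
  cases D
  · exact fourierLine_congr_ae (d := d) h'
  · exact mFourierCoeff_congr_ae (d := d) h'

theorem proj_add (x y : EuclideanSpace ℝ (Fin d)) :
    proj D d (x + y) = proj D d x + proj D d y := by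
  cases D <;> rfl

/-- Smoothness of a test function is defined by lifting to ℝᵈ; the quotient property brings
continuity back down to 𝔻ᵈ. -/
theorem isOpenQuotientMap_proj : IsOpenQuotientMap (proj D d) := by
  cases D
  · exact IsOpenQuotientMap.id
  · have h : IsOpenQuotientMap (Pi.map fun _ : Fin d => ((↑) : ℝ → UnitAddCircle)) :=
      IsOpenQuotientMap.piMap fun _ => QuotientAddGroup.isOpenQuotientMap_mk
    exact h.comp (EuclideanSpace.equiv (Fin d) ℝ).toHomeomorph.isOpenQuotientMap

theorem IsTest.continuous {φ : Pt D d → ℝ} (hφ : IsTest φ) : Continuous φ :=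
  isOpenQuotientMap_proj.isQuotientMap.continuous_iff.2 hφ.1.continuous

theorem IsTest.memLp {φ : Pt D d → ℝ} (hφ : IsTest φ) (p : ENNReal) : MemLp φ p volume :=
  hφ.continuous.memLp_of_hasCompactSupport hφ.2

theorem IsTest.exists_bound {φ : Pt D d → ℝ} (hφ : IsTest φ) : ∃ C, ∀ x, |φ x| ≤ C :=
  hφ.2.exists_bound_of_continuous hφ.continuous

theorem single_eq_smul (i : Fin d) (t : ℝ) :
    EuclideanSpace.single i t = t • (EuclideanSpace.single i (1 : ℝ)) := by
  ext j; by_cases hj : j = i <;> simp [hj]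

theorem IsTest.hasDerivAt {φ : Pt D d → ℝ} (hφ : IsTest φ) (i : Fin d)
    (x : EuclideanSpace ℝ (Fin d)) (t : ℝ) :
    HasDerivAt (fun τ : ℝ => φ (proj D d x + proj D d (EuclideanSpace.single i τ)))
      (fderiv ℝ (fun x => φ (proj D d x)) (x + EuclideanSpace.single i t)
        (EuclideanSpace.single i 1)) t := by
  have h1 : HasFDerivAt (fun x => φ (proj D d x))
      (fderiv ℝ (fun x => φ (proj D d x)) (x + EuclideanSpace.single i t))
      (x + EuclideanSpace.single i t) :=
    (hφ.1.differentiable (by simp) _).hasFDerivAt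
  have h2 : HasDerivAt (fun τ : ℝ => x + EuclideanSpace.single i τ)
      (EuclideanSpace.single i (1 : ℝ)) t := by
    have e : (fun τ : ℝ => x + EuclideanSpace.single i τ)
        = fun τ : ℝ => x + τ • EuclideanSpace.single i (1 : ℝ) := by
      funext τ; rw [single_eq_smul]
    rw [e]
    simpa using ((hasDerivAt_id t).smul_const (EuclideanSpace.single i (1 : ℝ))).const_add x
  have h3 := h1.comp_hasDerivAt t h2
  simpa [Function.comp_def, proj_add] using h3

theorem IsTest.partialD_proj {φ : Pt D d → ℝ} (hφ : IsTest φ) (i : Fin d)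
    (x : EuclideanSpace ℝ (Fin d)) :
    partialD i φ (proj D d x)
      = fderiv ℝ (fun x => φ (proj D d x)) x (EuclideanSpace.single i 1) := by
  have := (hφ.hasDerivAt i x 0).deriv
  have h0 : (EuclideanSpace.single i (0 : ℝ) : EuclideanSpace ℝ (Fin d)) = 0 := by simp
  rw [h0, add_zero] at this
  exact this

theorem IsTest.partialD {φ : Pt D d → ℝ} (hφ : IsTest φ) (i : Fin d) : IsTest (partialD i φ) := by
  constructor
  · simp_rw [hφ.partialD_proj i]
    exact (hφ.1.fderiv_right (m := ∞) (by simp)).clm_apply contDiff_const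
  · cases D
    · have h := HasCompactSupport.fderiv_apply (𝕜 := ℝ) (E := EuclideanSpace ℝ (Fin d)) hφ.2
        (EuclideanSpace.single i 1)
      have e : FavrieGavrilyuk.partialD (D := .line) i φ = fun x : EuclideanSpace ℝ (Fin d) =>
          fderiv ℝ (show EuclideanSpace ℝ (Fin d) → ℝ from φ) x (EuclideanSpace.single i 1) :=
        funext fun x => hφ.partialD_proj i x
      rw [e]
      exact h
    · have : CompactSpace (Pt .torus d) := inferInstanceAs (CompactSpace (UnitAddTorus (Fin d)))
      exact HasCompactSupport.of_compactSpace _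

theorem mFourier_single_coord (k : Fin d → ℤ) (i : Fin d) (τ : ℝ) :
    UnitAddTorus.mFourier k (proj .torus d (EuclideanSpace.single i τ))
      = fourier (k i) (τ : UnitAddCircle) := by
  change ∏ j, fourier (k j)
    (((EuclideanSpace.single i τ : EuclideanSpace ℝ (Fin d)) j : ℝ) : UnitAddCircle) = _
  rw [Finset.prod_eq_single i]
  · simp
  · intro j _ hj
    simp [hj]
  · simp

theorem hasDerivAt_mFourier_single (k : Fin d → ℤ) (i : Fin d) :
    HasDerivAt (fun τ : ℝ =>
      (UnitAddTorus.mFourier k (proj .torus d (EuclideanSpace.single i τ)) : ℂ))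
      (2 * Real.pi * Complex.I * (k i : ℂ)) 0 := by
  simp_rw [mFourier_single_coord]
  simpa using hasDerivAt_fourier (1 : ℝ) (k i) 0

theorem mFourier_add_arg (k : Fin d → ℤ) (x y : UnitAddTorus (Fin d)) :
    UnitAddTorus.mFourier k (x + y) = UnitAddTorus.mFourier k x * UnitAddTorus.mFourier k y := by
  simp [UnitAddTorus.mFourier, Finset.prod_mul_distrib, AddCircle.toCircle_add]

theorem mFourierCoeff_translate (f : UnitAddTorus (Fin d) → ℂ) (k : Fin d → ℤ)
    (y : UnitAddTorus (Fin d)) :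
    UnitAddTorus.mFourierCoeff (fun x => f (x + y)) k
      = UnitAddTorus.mFourier k y * UnitAddTorus.mFourierCoeff f k := by
  unfold UnitAddTorus.mFourierCoeff
  rw [← integral_const_mul, ← integral_add_right_eq_self
    (fun x => UnitAddTorus.mFourier k y * (UnitAddTorus.mFourier (-k) x • f x)) y]
  refine integral_congr_ae (Eventually.of_forall fun x => ?_)
  have h : UnitAddTorus.mFourier k y * UnitAddTorus.mFourier (-k) y = 1 := by
    rw [← UnitAddTorus.mFourier_add, add_neg_cancel, UnitAddTorus.mFourier_zero]; rfl
  simp only [smul_eq_mul, mFourier_add_arg]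
  linear_combination (-(UnitAddTorus.mFourier (-k) x * f (x + y))) * h

/-- Differentiate at τ = 0 the k-th coefficient of x ↦ φ(x + p τ) in two ways: under the integral
sign, and through translation invariance, which makes it a character at p τ times a constant. -/
theorem mFourierCoeff_of_hasDerivAt {φ ψ : UnitAddTorus (Fin d) → ℝ} (hφ : Continuous φ)
    (hψ : Continuous ψ) {p : ℝ → UnitAddTorus (Fin d)} (hp0 : p 0 = 0)
    (hd : ∀ x t, HasDerivAt (fun τ => φ (x + p τ)) (ψ (x + p t)) t) (k : Fin d → ℤ) {c : ℂ}
    (hc : HasDerivAt (fun τ => (UnitAddTorus.mFourier k (p τ) : ℂ)) c 0) :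
    UnitAddTorus.mFourierCoeff (fun x => (ψ x : ℂ)) k
      = c * UnitAddTorus.mFourierCoeff (fun x => (φ x : ℂ)) k := by
  obtain ⟨C, hC⟩ := (HasCompactSupport.of_compactSpace ψ).exists_bound_of_continuous hψ
  have key := (hasDerivAt_integral_of_dominated_loc_of_deriv_le
    (μ := (volume : Measure (UnitAddTorus (Fin d)))) (x₀ := (0 : ℝ)) (s := Set.univ)
    (F := fun (τ : ℝ) x => UnitAddTorus.mFourier (-k) x • ((φ (x + p τ) : ℝ) : ℂ))
    (F' := fun (τ : ℝ) x => UnitAddTorus.mFourier (-k) x • ((ψ (x + p τ) : ℝ) : ℂ))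
    (bound := fun _ => C) univ_mem ?_ ?_ ?_ ?_ ?_ ?_).2
  · simp_rw [show ∀ τ : ℝ, ∫ x, UnitAddTorus.mFourier (-k) x • ((φ (x + p τ) : ℝ) : ℂ)
        = UnitAddTorus.mFourier k (p τ) * UnitAddTorus.mFourierCoeff (fun x => ((φ x : ℝ) : ℂ)) k
      from fun τ => mFourierCoeff_translate (fun x => ((φ x : ℝ) : ℂ)) k _] at key
    have := key.unique (hc.mul_const _)
    rw [← this, hp0]
    simp only [add_zero]
    rfl
  · exact Eventually.of_forall fun τ => Continuous.aestronglyMeasurable (by fun_prop)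
  · exact (Continuous.integrable_of_hasCompactSupport (by fun_prop) (.of_compactSpace _))
  · exact Continuous.aestronglyMeasurable (by fun_prop)
  · refine Eventually.of_forall fun x τ _ => ?_
    rw [norm_smul, Complex.norm_real]
    refine (mul_le_of_le_one_left (norm_nonneg _) ?_).trans (hC _)
    exact ((UnitAddTorus.mFourier (-k)).norm_coe_le_norm x).trans UnitAddTorus.mFourier_norm.le
  · exact integrable_const _
  · exact Eventually.of_forall fun x τ _ => ((hd x τ).ofReal_comp).const_mul _

theorem IsTest.mFourierCoeff_partialD {φ : Pt .torus d → ℝ} (hφ : IsTest φ) (i : Fin d)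
    (k : Fin d → ℤ) :
    UnitAddTorus.mFourierCoeff
        (fun x : UnitAddTorus (Fin d) => ((FavrieGavrilyuk.partialD (D := .torus) i φ x : ℝ) : ℂ)) k
      = 2 * Real.pi * Complex.I * (k i : ℂ) *
        UnitAddTorus.mFourierCoeff (fun x : UnitAddTorus (Fin d) => ((φ x : ℝ) : ℂ)) k := by
  refine mFourierCoeff_of_hasDerivAt (p := fun τ => proj .torus d (EuclideanSpace.single i τ))
    hφ.continuous (hφ.partialD i).continuous ?_ ?_ k (hasDerivAt_mFourier_single k i)
  · have : (EuclideanSpace.single i (0 : ℝ) : EuclideanSpace ℝ (Fin d)) = 0 := by simp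
    rw [this]; rfl
  · intro x t
    obtain ⟨y, rfl⟩ := isOpenQuotientMap_proj.surjective (show Pt .torus d from x)
    have h := hφ.hasDerivAt i y t
    rw [← hφ.partialD_proj, proj_add] at h
    exact h

theorem IsTest.memLp_ofReal {φ : Pt D d → ℝ} (hφ : IsTest φ) :
    MemLp (fun x => (φ x : ℂ)) 2 volume := (hφ.memLp 2).ofReal

theorem IsTest.FT_partialD {φ : Pt D d → ℝ} (hφ : IsTest φ) (i : Fin d) :
    FT D d ((hφ.partialD i).memLp_ofReal.toLp _) =ᵐ[volume]
      fun ξ => (2 * Real.pi * Complex.I * (freqCoord D d i ξ : ℂ)) *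
        FT D d (hφ.memLp_ofReal.toLp _) ξ := by
  cases D
  · exact lpFourier_deriv (d := d) (φ := φ) hφ.1 hφ.2 i hφ.memLp_ofReal
      (hφ.partialD i).memLp_ofReal
  · refine Eventually.of_forall fun k => ?_
    have h1 := torusFourier_toLp (d := d) (hφ.partialD i).memLp_ofReal k
    have h2 := torusFourier_toLp (d := d) hφ.memLp_ofReal k
    refine h1.trans ((hφ.mFourierCoeff_partialD i k).trans ?_)
    refine (congrArg (fun z => 2 * Real.pi * Complex.I * (k i : ℂ) * z) h2.symm).trans ?_
    change _ = (2 * Real.pi * Complex.I * (((k i : ℝ)) : ℂ)) *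
      torusFourier (hφ.memLp_ofReal.toLp _) k
    push_cast
    rfl

/-- The real part of a trigonometric monomial, possibly with a phase. -/
theorem isTest_re_mFourier (k : Fin d → ℤ) (c : ℂ) :
    IsTest (D := .torus) (d := d)
      (fun x : UnitAddTorus (Fin d) => (c * UnitAddTorus.mFourier k x).re) := by
  constructor
  · have e : (fun x : EuclideanSpace ℝ (Fin d) =>
        (c * UnitAddTorus.mFourier k (proj .torus d x)).re) = fun x =>
        (c * ∏ j, Complex.exp (2 * Real.pi * Complex.I * (k j : ℂ) * ((x j : ℝ) : ℂ))).re := by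
      funext x
      change (c * ∏ j, fourier (k j) ((x j : ℝ) : UnitAddCircle)).re = _
      simp_rw [fourier_coe_apply]
      simp
    rw [e]
    refine Complex.reCLM.contDiff.comp (contDiff_const.mul ?_)
    refine contDiff_prod fun j _ => ?_
    refine Complex.contDiff_exp.comp (contDiff_const.mul ?_)
    exact Complex.ofRealCLM.contDiff.comp (EuclideanSpace.proj j : EuclideanSpace ℝ (Fin d) →L[ℝ] ℝ).contDiff
  · exact HasCompactSupport.of_compactSpace (α := UnitAddTorus (Fin d)) _

/-- On ℝᵈ this is the fundamental lemma of the calculus of variations. On the torus the real parts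
of c times a monomial are test functions; c = 1 and c = -i show that every Fourier coefficient
vanishes. -/
theorem ae_eq_zero_of_integral_test_mul {g : Pt D d → ℝ} (hg : LocallyIntegrable g volume)
    (h : ∀ φ : Pt D d → ℝ, IsTest φ → ∫ x, g x * φ x = 0) : g =ᵐ[volume] 0 := by
  cases D
  · refine ae_eq_zero_of_integral_contDiff_smul_eq_zero (E := EuclideanSpace ℝ (Fin d)) hg
      fun φ h1 h2 => ?_
    have := h φ ⟨h1, h2⟩
    refine Eq.trans (integral_congr_ae (Eventually.of_forall fun x => ?_)) this
    exact mul_comm _ _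
  · have hint : Integrable (fun x : UnitAddTorus (Fin d) => (g x : ℂ)) volume := by
      have h1 : IntegrableOn (α := UnitAddTorus (Fin d)) g Set.univ volume :=
        LocallyIntegrable.integrableOn_isCompact (X := UnitAddTorus (Fin d)) hg isCompact_univ
      exact Integrable.ofReal (integrableOn_univ.1 h1)
    have hz : ∀ (k : Fin d → ℤ) (c : ℂ),
        (c * UnitAddTorus.mFourierCoeff (fun x : UnitAddTorus (Fin d) => (g x : ℂ)) k).re = 0 := by
      intro k c
      have hi : Integrable (fun x : UnitAddTorus (Fin d) =>
          c * (UnitAddTorus.mFourier (-k) x • (g x : ℂ))) volume :=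
        (hint.bdd_mul (UnitAddTorus.mFourier (-k)).continuous.aestronglyMeasurable
          (Eventually.of_forall (UnitAddTorus.mFourier (-k)).norm_coe_le_norm)).const_mul c
      unfold UnitAddTorus.mFourierCoeff
      rw [← integral_const_mul, ← RCLike.re_eq_complex_re, ← integral_re hi]
      refine Eq.trans (integral_congr_ae (Eventually.of_forall fun x => ?_))
        (h _ (isTest_re_mFourier (-k) c))
      simp only [smul_eq_mul, RCLike.re_eq_complex_re, ← mul_assoc, Complex.re_mul_ofReal]
      exact mul_comm _ _
    have := ae_eq_zero_of_mFourierCoeff hint fun k => by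
      apply Complex.ext
      · simpa using hz k 1
      · simpa using hz k (-Complex.I)
    filter_upwards [this] with x hx
    exact Complex.ofReal_eq_zero.1 hx

end Torus

/-! ### Sobolev spaces as closed graphs -/

section MulLp

variable {α : Type*} [MeasurableSpace α] {μ : Measure α} {𝕜 : Type*} [RCLike 𝕜]

/-- Multiplication by an essentially bounded function on `L²`. -/
noncomputable def mulLp (m : α → 𝕜) (hm : MemLp m ⊤ μ) : Lp 𝕜 2 μ →L[𝕜] Lp 𝕜 2 μ :=
  (ContinuousLinearMap.mul 𝕜 𝕜).holderL μ ⊤ 2 2 (hm.toLp m)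

theorem mulLp_ae (m : α → 𝕜) (hm : MemLp m ⊤ μ) (f : Lp 𝕜 2 μ) :
    mulLp m hm f =ᵐ[μ] fun x => m x * f x := by
  have h : mulLp m hm f =ᵐ[μ] fun x => (ContinuousLinearMap.mul 𝕜 𝕜) (hm.toLp m x) (f x) :=
    ContinuousLinearMap.coeFn_holder _ _ _
  filter_upwards [h, hm.coeFn_toLp] with x hx hx'
  rw [hx, hx']
  rfl

theorem norm_mulLp_apply_le (m : α → 𝕜) (hm : MemLp m ⊤ μ) {C : ℝ} (hC : ∀ᵐ x ∂μ, ‖m x‖ ≤ C)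
    (f : Lp 𝕜 2 μ) : ‖mulLp m hm f‖ ≤ C * ‖f‖ := by
  refine Lp.norm_le_mul_norm_of_ae_le_mul ?_
  filter_upwards [mulLp_ae m hm f, hC] with x hx hx'
  rw [hx, norm_mul]
  gcongr

end MulLp

variable {D : Geometry} {d : ℕ}

/-- Real square-integrable functions on `𝔻ᵈ`. -/
abbrev XR (D : Geometry) (d : ℕ) : Type := Lp ℝ 2 (volume : Measure (Pt D d))

/-- Complex square-integrable functions of the frequency. -/
abbrev VC (D : Geometry) (d : ℕ) : Type := Lp ℂ 2 (volume : Measure (Freq D d))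

/-- Real functions as complex functions. -/
noncomputable def complexify (D : Geometry) (d : ℕ) :
    XR D d →L[ℝ] Lp ℂ 2 (volume : Measure (Pt D d)) :=
  Complex.ofRealCLM.compLpL 2 volume

theorem complexify_ae (f : XR D d) : complexify D d f =ᵐ[volume] fun x => (f x : ℂ) :=
  ContinuousLinearMap.coeFn_compLpL _ _

theorem norm_complexify (f : XR D d) : ‖complexify D d f‖ = ‖f‖ := by
  rw [Lp.norm_def, Lp.norm_def]
  congr 1
  refine eLpNorm_congr_norm_ae ?_
  filter_upwards [complexify_ae f] with x hx
  rw [hx, Complex.norm_real]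

/-- The Fourier transform of real square-integrable functions. -/
noncomputable def RT (D : Geometry) (d : ℕ) : XR D d →ₗᵢ[ℝ] VC D d where
  toLinearMap := ((FT D d).toLinearEquiv.toLinearMap.restrictScalars ℝ).comp
    (complexify D d : XR D d →ₗ[ℝ] Lp ℂ 2 (volume : Measure (Pt D d)))
  norm_map' f := by
    change ‖FT D d (complexify D d f)‖ = ‖f‖
    rw [LinearIsometryEquiv.norm_map, norm_complexify]

theorem RT_apply (f : XR D d) : RT D d f = FT D d (complexify D d f) := rfl

theorem RT_ae (f : XR D d) : RT D d f =ᵐ[volume] fourierT D d f := by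
  have h : complexify D d f = ((Lp.memLp f).ofReal (K := ℂ)).toLp _ := by
    apply Lp.ext
    filter_upwards [complexify_ae f, ((Lp.memLp f).ofReal (K := ℂ)).coeFn_toLp] with x h1 h2
    rw [h1, h2]; rfl
  rw [RT_apply, h]
  exact FT_toLp _

/-- The weight `(1 + |2πξ|²)^(σ/2)`. -/
noncomputable def wt (D : Geometry) (d : ℕ) (σ : ℝ) (ξ : Freq D d) : ℝ := japSq D d ξ ^ (σ / 2)

theorem wt_pos (σ : ℝ) (ξ : Freq D d) : 0 < wt D d σ ξ := Real.rpow_pos_of_pos (japSq_pos ξ) _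

theorem measurable_wt (σ : ℝ) : Measurable (wt D d σ) := measurable_japSq.pow_const _

theorem wt_add (σ τ : ℝ) (ξ : Freq D d) : wt D d (σ + τ) ξ = wt D d σ ξ * wt D d τ ξ := by
  rw [wt, add_div, Real.rpow_add (japSq_pos ξ)]; rfl

theorem wt_zero (ξ : Freq D d) : wt D d 0 ξ = 1 := by simp [wt]

theorem wt_le_one {σ : ℝ} (h : σ ≤ 0) (ξ : Freq D d) : wt D d σ ξ ≤ 1 :=
  Real.rpow_le_one_of_one_le_of_nonpos (one_le_japSq ξ) (by linarith)

theorem one_le_wt {σ : ℝ} (h : 0 ≤ σ) (ξ : Freq D d) : 1 ≤ wt D d σ ξ :=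
  Real.one_le_rpow (one_le_japSq ξ) (by linarith)

theorem wt_neg_mul (σ : ℝ) (ξ : Freq D d) : wt D d (-σ) ξ * wt D d σ ξ = 1 := by
  rw [← wt_add, neg_add_cancel, wt_zero]

theorem memLp_top_wt {σ : ℝ} (h : σ ≤ 0) :
    MemLp (fun ξ => (wt D d σ ξ : ℂ)) ⊤ (volume : Measure (Freq D d)) :=
  memLp_top_of_bound (Complex.measurable_ofReal.comp (measurable_wt σ)).aestronglyMeasurable 1 <|
    Eventually.of_forall fun ξ => by
      rw [Complex.norm_real, Real.norm_of_nonneg (wt_pos σ ξ).le]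
      exact wt_le_one h ξ

/-- Multiplication by `(1 + |2πξ|²)^(-σ/2)`, for `σ ≥ 0`. -/
noncomputable def lower (D : Geometry) (d : ℕ) (σ : ℝ) : VC D d →L[ℂ] VC D d :=
  -- The truncation `max σ 0` keeps the multiplier bounded for every real σ, so that the spaces are
  -- defined with no sign condition.
  mulLp (fun ξ => (wt D d (-(max σ 0)) ξ : ℂ)) (memLp_top_wt (by simp))

/-- The graph of `(1 - Δ)^(σ/2)` on the Fourier side: pairs of a square-integrable function `f`
and of the Fourier transform of `(1 - Δ)^(σ/2) f`. -/
noncomputable def sobGraph (D : Geometry) (d : ℕ) (σ : ℝ) : Submodule ℝ (XR D d × VC D d) :=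
  LinearMap.ker (((RT D d).toContinuousLinearMap.comp (ContinuousLinearMap.fst ℝ _ _) -
    ((lower D d σ).restrictScalars ℝ).comp (ContinuousLinearMap.snd ℝ _ _) :
      XR D d × VC D d →L[ℝ] VC D d) : XR D d × VC D d →ₗ[ℝ] VC D d)

theorem mem_sobGraph_iff {σ : ℝ} {p : XR D d × VC D d} :
    p ∈ sobGraph D d σ ↔ RT D d p.1 = lower D d σ p.2 := by
  rw [sobGraph, LinearMap.mem_ker]
  exact sub_eq_zero

theorem isClosed_sobGraph (σ : ℝ) : IsClosed (sobGraph D d σ : Set (XR D d × VC D d)) :=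
  ContinuousLinearMap.isClosed_ker _

/-- The space `H^σ(𝔻ᵈ)` of real functions, for `σ ≥ 0`. -/
def Sob (D : Geometry) (d : ℕ) (σ : ℝ) : Type := sobGraph D d σ

noncomputable instance (σ : ℝ) : NormedAddCommGroup (Sob D d σ) :=
  inferInstanceAs (NormedAddCommGroup (sobGraph D d σ))

noncomputable instance (σ : ℝ) : NormedSpace ℝ (Sob D d σ) :=
  inferInstanceAs (NormedSpace ℝ (sobGraph D d σ))

instance (σ : ℝ) : CompleteSpace (Sob D d σ) := (isClosed_sobGraph σ).completeSpace_coe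

/-- The function underlying an element of `H^σ`. -/
noncomputable def toL2 {σ : ℝ} : Sob D d σ →L[ℝ] XR D d :=
  (ContinuousLinearMap.fst ℝ _ _).comp (sobGraph D d σ).subtypeL

theorem RT_toL2 {σ : ℝ} (x : Sob D d σ) : RT D d (toL2 x) = lower D d σ x.1.2 :=
  mem_sobGraph_iff.1 x.2

theorem lower_ae {σ : ℝ} (hσ : 0 ≤ σ) (G : VC D d) :
    lower D d σ G =ᵐ[volume] fun ξ => (wt D d (-σ) ξ : ℂ) * G ξ := by
  filter_upwards [mulLp_ae _ (memLp_top_wt (D := D) (d := d) (σ := -(max σ 0)) (by simp)) G]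
    with ξ hξ
  have h : lower D d σ G ξ = (wt D d (-(max σ 0)) ξ : ℂ) * G ξ := hξ
  rw [h, max_eq_left hσ]

theorem norm_lower_le (σ : ℝ) (G : VC D d) : ‖lower D d σ G‖ ≤ ‖G‖ := by
  have := norm_mulLp_apply_le _ (memLp_top_wt (D := D) (d := d) (σ := -(max σ 0)) (by simp))
    (C := 1) (Eventually.of_forall fun ξ => by
      rw [Complex.norm_real, Real.norm_of_nonneg (wt_pos _ ξ).le]
      exact wt_le_one (by simp) ξ) G
  simpa [lower] using this

/-- Consequently the max norm of the graph is the norm of its second component, that is the H^σ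
norm, and `fou` is an isometry. -/
theorem norm_toL2_le_snd {σ : ℝ} (x : Sob D d σ) : ‖toL2 x‖ ≤ ‖x.1.2‖ := by
  rw [← (RT D d).norm_map, RT_toL2]
  exact norm_lower_le _ _

/-- The Fourier transform of `(1 - Δ)^(σ/2) f`. -/
noncomputable def fou {σ : ℝ} : Sob D d σ →ₗᵢ[ℝ] VC D d where
  toLinearMap := (LinearMap.snd ℝ _ _).comp (sobGraph D d σ).subtype
  norm_map' x := by
    change ‖x.1.2‖ = ‖x.1‖
    rw [Prod.norm_def, max_eq_right]
    exact norm_toL2_le_snd x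

theorem RT_toL2_ae {σ : ℝ} (hσ : 0 ≤ σ) (x : Sob D d σ) :
    RT D d (toL2 x) =ᵐ[volume] fun ξ => (wt D d (-σ) ξ : ℂ) * fou x ξ := by
  rw [RT_toL2]
  exact lower_ae hσ _

theorem fou_ae {σ : ℝ} (hσ : 0 ≤ σ) (x : Sob D d σ) :
    fou x =ᵐ[volume] fun ξ => (wt D d σ ξ : ℂ) * RT D d (toL2 x) ξ := by
  filter_upwards [RT_toL2_ae hσ x] with ξ hξ
  rw [hξ, ← mul_assoc, mul_comm (wt D d σ ξ : ℂ), ← Complex.ofReal_mul, wt_neg_mul]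
  simp

theorem fou_eq_sobolevFourier {σ : ℝ} (hσ : 0 ≤ σ) (x : Sob D d σ) {f : Pt D d → ℝ}
    (hf : f =ᵐ[volume] toL2 x) : fou x =ᵐ[volume] sobolevFourier σ f := by
  filter_upwards [fou_ae hσ x, RT_ae (toL2 x)] with ξ h1 h2
  rw [h1, h2, ← fourierT_congr_ae hf]
  rfl

/-- The underlying function determines the second component. Identities in H^σ can thus be checked
almost everywhere. -/
theorem toL2_injective {σ : ℝ} (hσ : 0 ≤ σ) :
    Function.Injective (toL2 : Sob D d σ → XR D d) := by
  intro x y h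
  apply fou.injective
  apply Lp.ext
  filter_upwards [fou_ae hσ x, fou_ae hσ y] with ξ h1 h2
  rw [h1, h2, h]

/-- Elements of `H^σ` from a function and a Fourier transform. -/
noncomputable def mkSob {σ : ℝ} (hσ : 0 ≤ σ) (f : XR D d) (G : VC D d)
    (h : G =ᵐ[volume] fun ξ => (wt D d σ ξ : ℂ) * RT D d f ξ) : Sob D d σ :=
  ⟨(f, G), mem_sobGraph_iff.2 (by
    apply Lp.ext
    filter_upwards [lower_ae hσ G, h] with ξ h1 h2
    rw [h1, h2, ← mul_assoc, ← Complex.ofReal_mul, wt_neg_mul]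
    simp)⟩

theorem exists_sob {σ : ℝ} (hσ : 0 ≤ σ) (f : XR D d) (G : VC D d)
    (h : G =ᵐ[volume] fun ξ => (wt D d σ ξ : ℂ) * RT D d f ξ) :
    ∃ y : Sob D d σ, toL2 y = f ∧ fou y = G :=
  ⟨mkSob hσ f G h, rfl, rfl⟩

theorem hNorm_eq {σ : ℝ} (hσ : 0 ≤ σ) (x : Sob D d σ) {f : Pt D d → ℝ}
    (hf : f =ᵐ[volume] toL2 x) : hNorm σ f = ‖x‖ := by
  rw [← fou.norm_map, Lp.norm_def, hNorm, eLpNorm_congr_ae (fou_eq_sobolevFourier hσ x hf)]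

theorem exists_sob_of_memLp {σ : ℝ} (hσ : 0 ≤ σ) {f : Pt D d → ℝ} (hf : MemLp f 2 volume)
    (G : VC D d) (hG : G =ᵐ[volume] sobolevFourier σ f) :
    ∃ x : Sob D d σ, f =ᵐ[volume] toL2 x ∧ fou x = G := by
  have h : G =ᵐ[volume] fun ξ => (wt D d σ ξ : ℂ) * RT D d (hf.toLp f) ξ := by
    filter_upwards [hG, RT_ae (hf.toLp f)] with ξ h1 h2
    rw [h1, h2, fourierT_congr_ae hf.coeFn_toLp]
    rfl
  obtain ⟨y, hy, hy'⟩ := exists_sob hσ (hf.toLp f) G h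
  exact ⟨y, by rw [hy]; exact hf.coeFn_toLp.symm, hy'⟩

theorem MemH.exists_sob {σ : ℝ} (hσ : 0 ≤ σ) {f : Pt D d → ℝ} (hf : MemH σ f) :
    ∃ x : Sob D d σ, f =ᵐ[volume] toL2 x := by
  obtain ⟨x, hx, -⟩ := exists_sob_of_memLp hσ hf.1 (hf.2.toLp _) hf.2.coeFn_toLp
  exact ⟨x, hx⟩

/-! ### Young's inequality for convolutions -/

section Young

theorem sq_lintegral_mul_le {α : Type*} [MeasurableSpace α] {μ : Measure α} {f g : α → ℝ≥0∞}
    (hf : AEMeasurable f μ) (hg : AEMeasurable g μ) :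
    (∫⁻ x, f x * g x ∂μ) ^ 2 ≤ (∫⁻ x, f x ^ 2 ∂μ) * ∫⁻ x, g x ^ 2 ∂μ := by
  have h := ENNReal.lintegral_mul_le_Lp_mul_Lq μ Real.HolderConjugate.two_two hf hg
  simp only [Pi.mul_apply, ENNReal.rpow_ofNat] at h
  calc (∫⁻ x, f x * g x ∂μ) ^ 2
      ≤ ((∫⁻ x, f x ^ 2 ∂μ) ^ (1 / 2 : ℝ) * (∫⁻ x, g x ^ 2 ∂μ) ^ (1 / 2 : ℝ)) ^ 2 := by gcongr
    _ = _ := by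
      rw [mul_pow, ← ENNReal.rpow_natCast, ← ENNReal.rpow_natCast, ← ENNReal.rpow_mul,
        ← ENNReal.rpow_mul]
      norm_num

variable {Q : Type*} [AddCommGroup Q] [MeasurableSpace Q] [MeasurableAdd₂ Q] [MeasurableNeg Q]
  {ν : Measure Q} [SFinite ν] [ν.IsAddLeftInvariant] [ν.IsNegInvariant]

/-- L¹ * L² ⊂ L²: Cauchy–Schwarz after writing f as the square of its square root, then Tonelli and
translation invariance. -/
theorem lintegral_sq_convolution_le {f g : Q → ℝ≥0∞} (hf : Measurable f) (hg : Measurable g) :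
    ∫⁻ ξ, (∫⁻ η, f (ξ - η) * g η ∂ν) ^ 2 ∂ν ≤ (∫⁻ ξ, f ξ ∂ν) ^ 2 * ∫⁻ ξ, g ξ ^ 2 ∂ν := by
  have hsq : Measurable fun x => f x ^ (1 / 2 : ℝ) := hf.pow_const _
  have hs : ∀ x : ℝ≥0∞, x ^ (1 / 2 : ℝ) * x ^ (1 / 2 : ℝ) = x := fun x => by
    rw [← ENNReal.rpow_add_of_nonneg _ _ (by norm_num) (by norm_num)]; norm_num
  have h1 : ∀ ξ, (∫⁻ η, f (ξ - η) * g η ∂ν) ^ 2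
      ≤ (∫⁻ η, f η ∂ν) * ∫⁻ η, f (ξ - η) * g η ^ 2 ∂ν := by
    intro ξ
    have hm : Measurable fun η => f (ξ - η) ^ (1 / 2 : ℝ) :=
      hsq.comp (measurable_const.sub measurable_id)
    have h := sq_lintegral_mul_le (μ := ν) hm.aemeasurable (hm.mul hg).aemeasurable
    simp only [Pi.mul_apply, mul_pow, ← mul_assoc, hs] at h
    simp only [sq (_ ^ (1 / 2 : ℝ) : ℝ≥0∞), hs] at h
    rwa [lintegral_sub_left_eq_self f ξ] at h
  have hm2 : Measurable fun p : Q × Q => f (p.1 - p.2) * g p.2 ^ 2 :=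
    (hf.comp (measurable_fst.sub measurable_snd)).mul ((hg.comp measurable_snd).pow_const 2)
  calc ∫⁻ ξ, (∫⁻ η, f (ξ - η) * g η ∂ν) ^ 2 ∂ν
      ≤ ∫⁻ ξ, (∫⁻ η, f η ∂ν) * ∫⁻ η, f (ξ - η) * g η ^ 2 ∂ν ∂ν := lintegral_mono h1
    _ = (∫⁻ η, f η ∂ν) * ∫⁻ ξ, ∫⁻ η, f (ξ - η) * g η ^ 2 ∂ν ∂ν :=
        lintegral_const_mul _ hm2.lintegral_prod_right'
    _ = (∫⁻ η, f η ∂ν) * ∫⁻ η, ∫⁻ ξ, f (ξ - η) * g η ^ 2 ∂ν ∂ν := by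
        rw [lintegral_lintegral_swap hm2.aemeasurable]
    _ = (∫⁻ η, f η ∂ν) * ∫⁻ η, (∫⁻ ξ, f ξ ∂ν) * g η ^ 2 ∂ν := by
        congr 1
        refine lintegral_congr fun η => ?_
        rw [lintegral_mul_const _ (show Measurable fun ξ => f (ξ - η) from
          hf.comp (measurable_id.sub_const η))]
        congr 1
        exact lintegral_sub_right_eq_self f η
    _ = _ := by
        rw [lintegral_const_mul _ (hg.pow_const 2), sq, mul_assoc]

/-- Each half of the kernel multiplies one of the two factors by c, which puts that factor in L¹ by
Cauchy–Schwarz; the inequality L¹ * L² ⊂ L² then applies to each half. -/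
theorem lintegral_sq_convolution_le' {c f g : Q → ℝ≥0∞} (hc : Measurable c) (hf : Measurable f)
    (hg : Measurable g) :
    ∫⁻ ξ, (∫⁻ η, (c (ξ - η) + c η) * (f (ξ - η) * g η) ∂ν) ^ 2 ∂ν
      ≤ 4 * (∫⁻ ξ, c ξ ^ 2 ∂ν) * ((∫⁻ ξ, f ξ ^ 2 ∂ν) * ∫⁻ ξ, g ξ ^ 2 ∂ν) := by
  have e : ∀ ξ, ∫⁻ η, (c (ξ - η) + c η) * (f (ξ - η) * g η) ∂ν
      = (∫⁻ η, (fun x => c x * f x) (ξ - η) * g η ∂ν)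
        + ∫⁻ η, (fun x => c x * g x) (ξ - η) * f η ∂ν := by
    intro ξ
    have h2 : ∫⁻ η, (fun x => c x * g x) (ξ - η) * f η ∂ν = ∫⁻ η, c η * (f (ξ - η) * g η) ∂ν := by
      rw [← lintegral_sub_left_eq_self _ ξ]
      refine lintegral_congr fun η => ?_
      simp only [sub_sub_cancel]
      ring
    rw [h2, ← lintegral_add_left]
    · refine lintegral_congr fun η => ?_
      ring
    · exact ((hc.mul hf).comp (measurable_const.sub measurable_id)).mul hg
  have sq_add : ∀ a b : ℝ≥0∞, (a + b) ^ 2 ≤ 2 * (a ^ 2 + b ^ 2) := fun a b => by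
    have := ENNReal.rpow_add_le_mul_rpow_add_rpow a b (p := 2) (by norm_num)
    norm_num at this
    exact_mod_cast this
  have A := lintegral_sq_convolution_le (ν := ν) (hc.mul hf) hg
  have B := lintegral_sq_convolution_le (ν := ν) (hc.mul hg) hf
  have A' := sq_lintegral_mul_le (μ := ν) hc.aemeasurable hf.aemeasurable
  have B' := sq_lintegral_mul_le (μ := ν) hc.aemeasurable hg.aemeasurable
  have hm2 : Measurable fun p : Q × Q => (c (p.1 - p.2) * f (p.1 - p.2)) * g p.2 :=
    ((hc.mul hf).comp (measurable_fst.sub measurable_snd)).mul (hg.comp measurable_snd)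
  simp only [Pi.mul_apply] at A B
  calc ∫⁻ ξ, (∫⁻ η, (c (ξ - η) + c η) * (f (ξ - η) * g η) ∂ν) ^ 2 ∂ν
      ≤ ∫⁻ ξ, 2 * ((∫⁻ η, (c (ξ - η) * f (ξ - η)) * g η ∂ν) ^ 2
          + (∫⁻ η, (c (ξ - η) * g (ξ - η)) * f η ∂ν) ^ 2) ∂ν :=
        lintegral_mono fun ξ => by rw [e ξ]; exact sq_add _ _
    _ = 2 * ((∫⁻ ξ, (∫⁻ η, (c (ξ - η) * f (ξ - η)) * g η ∂ν) ^ 2 ∂ν)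
          + ∫⁻ ξ, (∫⁻ η, (c (ξ - η) * g (ξ - η)) * f η ∂ν) ^ 2 ∂ν) := by
        rw [lintegral_const_mul' _ _ (by norm_num), lintegral_add_left]
        exact (hm2.lintegral_prod_right').pow_const 2
    _ ≤ 2 * (((∫⁻ ξ, c ξ ^ 2 ∂ν) * ∫⁻ ξ, f ξ ^ 2 ∂ν) * (∫⁻ ξ, g ξ ^ 2 ∂ν)
          + ((∫⁻ ξ, c ξ ^ 2 ∂ν) * ∫⁻ ξ, g ξ ^ 2 ∂ν) * (∫⁻ ξ, f ξ ^ 2 ∂ν)) := by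
        gcongr
        · exact A.trans (by gcongr)
        · exact B.trans (by gcongr)
    _ = _ := by ring

end Young

/-! ### The product law on the Fourier side -/

variable {D : Geometry} {d : ℕ}

theorem japSq_add_le (a b : Freq D d) : japSq D d (a + b) ≤ 2 * (japSq D d a + japSq D d b) := by
  have h : freqSq D d (a + b) ≤ 2 * (freqSq D d a + freqSq D d b) := by
    simp only [freqSq_eq_sum, freqCoord_add, ← Finset.sum_add_distrib, Finset.mul_sum]
    refine Finset.sum_le_sum fun i _ => ?_
    nlinarith [sq_nonneg (freqCoord D d i a - freqCoord D d i b)]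
  unfold japSq
  nlinarith [mul_le_mul_of_nonneg_left h (sq_nonneg (2 * Real.pi))]

/-- When b dominates, a + b has size at most a multiple of that of b, so the weight γ is absorbed by
b; the leftover exponent γ - β ≤ 0 of b may be transferred to the smaller frequency a. -/
theorem wt_kernel_le_aux {α β γ : ℝ} (hγ : 0 ≤ γ) (hβ : γ ≤ β) {a b : Freq D d}
    (h : japSq D d a ≤ japSq D d b) :
    wt D d γ (a + b) * (wt D d (-α) a * wt D d (-β) b)
      ≤ 4 ^ (γ / 2) * wt D d (-(α + β - γ)) a := by
  have h1 : wt D d γ (a + b) ≤ 4 ^ (γ / 2) * wt D d γ b := by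
    unfold wt
    rw [← Real.mul_rpow (by norm_num) (japSq_pos b).le]
    refine Real.rpow_le_rpow (japSq_pos _).le ?_ (by linarith)
    linarith [japSq_add_le a b]
  have h2 : wt D d (γ - β) b ≤ wt D d (γ - β) a :=
    Real.rpow_le_rpow_of_nonpos (japSq_pos a) h (by linarith)
  have e1 : wt D d (γ - β) b = wt D d γ b * wt D d (-β) b := by rw [← wt_add]; ring_nf
  have e2 : wt D d (-(α + β - γ)) a = wt D d (-α) a * wt D d (γ - β) a := by
    rw [← wt_add]; ring_nf
  calc _ ≤ 4 ^ (γ / 2) * wt D d γ b * (wt D d (-α) a * wt D d (-β) b) :=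
        mul_le_mul_of_nonneg_right h1 (mul_nonneg (wt_pos _ _).le (wt_pos _ _).le)
    _ = 4 ^ (γ / 2) * (wt D d (-α) a * wt D d (γ - β) b) := by rw [e1]; ring
    _ ≤ 4 ^ (γ / 2) * (wt D d (-α) a * wt D d (γ - β) a) := by
        have := (wt_pos (-α) a).le
        gcongr
    _ = _ := by rw [e2]

theorem wt_kernel_le {α β γ : ℝ} (hγ : 0 ≤ γ) (hα : γ ≤ α) (hβ : γ ≤ β) (a b : Freq D d) :
    wt D d γ (a + b) * (wt D d (-α) a * wt D d (-β) b)
      ≤ 4 ^ (γ / 2) * (wt D d (-(α + β - γ)) a + wt D d (-(α + β - γ)) b) := by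
  have h4 : (0 : ℝ) < 4 ^ (γ / 2) := by positivity
  have pa := wt_pos (-(α + β - γ)) a
  have pb := wt_pos (-(α + β - γ)) b
  rcases le_total (japSq D d a) (japSq D d b) with h | h
  · refine (wt_kernel_le_aux hγ hβ h).trans ?_
    gcongr; linarith
  · have := wt_kernel_le_aux (α := β) hγ hα h
    rw [add_comm b a, mul_comm (wt D d (-β) b), add_comm β α] at this
    refine this.trans ?_
    gcongr; linarith

/-- The conditions for the product of `H^α` and `H^β` to be contained in `H^γ`. -/
structure MulCond (d : ℕ) (α β γ : ℝ) : Prop where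
  nonneg : 0 ≤ γ
  le_left : γ ≤ α
  le_right : γ ≤ β
  lt : (d : ℝ) / 2 < α + β - γ

theorem eLpNorm_two_sq {α E : Type*} [MeasurableSpace α] [NormedAddCommGroup E] {μ : Measure α}
    (f : α → E) : eLpNorm f 2 μ ^ 2 = ∫⁻ x, ‖f x‖ₑ ^ 2 ∂μ := by
  rw [eLpNorm_eq_lintegral_rpow_enorm_toReal (by norm_num) (by norm_num), ← ENNReal.rpow_natCast,
    ← ENNReal.rpow_mul]
  simp

/-- A finite constant bounding products in Sobolev spaces. -/
noncomputable def mulConstSq (D : Geometry) (d : ℕ) (α β γ : ℝ) : ℝ≥0∞ :=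
  ENNReal.ofReal (4 ^ (γ / 2)) ^ 2 *
    (4 * ∫⁻ ξ : Freq D d, ENNReal.ofReal (wt D d (-(α + β - γ)) ξ) ^ 2)

/-- The squared weight is the symbol of 1 - Δ to the power -(α + β - γ); its integrability is where
the condition on d/2 enters. -/
theorem mulConstSq_lt_top {α β γ : ℝ} (h : MulCond d α β γ) : mulConstSq D d α β γ < ⊤ := by
  have h1 : ∫⁻ ξ : Freq D d, ENNReal.ofReal (wt D d (-(α + β - γ)) ξ) ^ 2 < ⊤ := by
    refine lt_of_eq_of_lt (lintegral_congr fun ξ => ?_) (lintegral_japSq_lt_top h.lt)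
    rw [← ENNReal.ofReal_pow (wt_pos _ _).le, wt, ← Real.rpow_natCast, ← Real.rpow_mul
      (japSq_pos ξ).le]
    congr 2
    push_cast; ring
  unfold mulConstSq
  exact ENNReal.mul_lt_top (ENNReal.pow_lt_top ENNReal.ofReal_lt_top)
    (ENNReal.mul_lt_top (by norm_num) h1)

theorem lintegral_wt_convolution_le {α β γ : ℝ} (h : MulCond d α β γ) {F G A B : Freq D d → ℂ}
    (hA : Measurable A) (hB : Measurable B)
    (hF : F =ᵐ[volume] fun ξ => (wt D d (-α) ξ : ℂ) * A ξ)
    (hG : G =ᵐ[volume] fun ξ => (wt D d (-β) ξ : ℂ) * B ξ) :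
    ∫⁻ ξ : Freq D d, ‖(wt D d γ ξ : ℂ) * ∫ η, F (ξ - η) * G η‖ₑ ^ 2
      ≤ mulConstSq D d α β γ * ((∫⁻ ξ, ‖A ξ‖ₑ ^ 2) * ∫⁻ ξ, ‖B ξ‖ₑ ^ 2) := by
  set c : Freq D d → ℝ≥0∞ := fun ξ => ENNReal.ofReal (wt D d (-(α + β - γ)) ξ) with hc
  have hcm : Measurable c := (measurable_wt _).ennreal_ofReal
  have hpt : ∀ ξ : Freq D d, ‖(wt D d γ ξ : ℂ) * ∫ η, F (ξ - η) * G η‖ₑ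
      ≤ ENNReal.ofReal (4 ^ (γ / 2)) *
        ∫⁻ η, (c (ξ - η) + c η) * (‖A (ξ - η)‖ₑ * ‖B η‖ₑ) := by
    intro ξ
    have hF' : ∀ᵐ η : Freq D d, F (ξ - η) = (wt D d (-α) (ξ - η) : ℂ) * A (ξ - η) :=
      (Measure.measurePreserving_sub_left volume ξ).quasiMeasurePreserving.ae hF
    rw [enorm_mul, ← lintegral_const_mul']
    · refine (mul_le_mul_right (enorm_integral_le_lintegral_enorm _) _).trans ?_
      rw [← lintegral_const_mul' _ _ (by simp)]
      refine lintegral_mono_ae ?_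
      filter_upwards [hF', hG] with η h1 h2
      rw [h1, h2]
      have h3 := wt_kernel_le h.nonneg h.le_left h.le_right (ξ - η) η
      rw [sub_add_cancel] at h3
      have p1 := (wt_pos (-α) (ξ - η)).le
      have p2 := (wt_pos (-β) η).le
      have p3 := (wt_pos γ ξ).le
      have hn : ∀ σ (ζ : Freq D d), ‖(wt D d σ ζ : ℂ)‖ₑ = ENNReal.ofReal (wt D d σ ζ) :=
        fun σ ζ => by
          rw [← ofReal_norm, Complex.norm_real, Real.norm_of_nonneg (wt_pos _ _).le]
      have h4 := ENNReal.ofReal_le_ofReal h3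
      rw [ENNReal.ofReal_mul p3, ENNReal.ofReal_mul p1, ENNReal.ofReal_mul (by positivity),
        ENNReal.ofReal_add (wt_pos _ _).le (wt_pos _ _).le] at h4
      simp only [enorm_mul, hn]
      calc _ = (ENNReal.ofReal (wt D d γ ξ) * (ENNReal.ofReal (wt D d (-α) (ξ - η))
            * ENNReal.ofReal (wt D d (-β) η))) * (‖A (ξ - η)‖ₑ * ‖B η‖ₑ) := by ring
        _ ≤ _ := (mul_le_mul_left h4 _).trans_eq (mul_assoc _ _ _)
    · simp
  have hY := lintegral_sq_convolution_le' (ν := (volume : Measure (Freq D d))) hcm hA.enorm hB.enorm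
  calc _ ≤ ∫⁻ ξ : Freq D d, ENNReal.ofReal (4 ^ (γ / 2)) ^ 2 *
        (∫⁻ η, (c (ξ - η) + c η) * (‖A (ξ - η)‖ₑ * ‖B η‖ₑ)) ^ 2 :=
        lintegral_mono fun ξ => by
          rw [← mul_pow]
          gcongr
          exact hpt ξ
    _ = ENNReal.ofReal (4 ^ (γ / 2)) ^ 2 *
        ∫⁻ ξ, (∫⁻ η, (c (ξ - η) + c η) * (‖A (ξ - η)‖ₑ * ‖B η‖ₑ)) ^ 2 :=
        lintegral_const_mul' _ _ (by simp)
    _ ≤ _ := by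
        refine (mul_le_mul_right hY _).trans_eq ?_
        rw [mulConstSq]
        ring

/-! ### Inclusions and derivatives between Sobolev spaces -/

variable {D : Geometry} {d : ℕ}

/-- Linearity of the lift is inherited from L because `toL2` is injective. -/
theorem exists_clm_of_toL2 {F : Type*} [NormedAddCommGroup F] [NormedSpace ℝ F] {σ : ℝ}
    (hσ : 0 ≤ σ) (L : F →ₗ[ℝ] XR D d) (C : ℝ)
    (h : ∀ x, ∃ y : Sob D d σ, toL2 y = L x ∧ ‖y‖ ≤ C * ‖x‖) :
    ∃ T : F →L[ℝ] Sob D d σ, ∀ x, toL2 (T x) = L x := by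
  choose T hT hC using h
  refine ⟨LinearMap.mkContinuous
    { toFun := T
      map_add' := fun x y => toL2_injective hσ (by simp [hT])
      map_smul' := fun c x => toL2_injective hσ (by simp [hT]) } C hC, hT⟩

theorem exists_incl {α β : ℝ} (hβ : 0 ≤ β) (h : β ≤ α) :
    ∃ T : Sob D d α →L[ℝ] Sob D d β, ∀ x, toL2 (T x) = toL2 x := by
  refine exists_clm_of_toL2 hβ toL2.toLinearMap 1 fun x => ?_
  have hm := memLp_top_wt (D := D) (d := d) (σ := β - α) (by linarith)
  have hG : mulLp _ hm (fou x) =ᵐ[volume] fun ξ => (wt D d β ξ : ℂ) * RT D d (toL2 x) ξ := by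
    filter_upwards [mulLp_ae _ hm (fou x), fou_ae (hβ.trans h) x] with ξ h1 h2
    rw [h1, h2, ← mul_assoc, ← Complex.ofReal_mul, ← wt_add]
    ring_nf
  obtain ⟨y, hy, hy'⟩ := exists_sob hβ _ _ hG
  refine ⟨y, hy, ?_⟩
  rw [← fou.norm_map, ← fou.norm_map, hy']
  refine norm_mulLp_apply_le _ hm (Eventually.of_forall fun ξ => ?_) _
  rw [Complex.norm_real, Real.norm_of_nonneg (wt_pos _ _).le]
  exact wt_le_one (by linarith) ξ

open Classical in
/-- The inclusion of `H^α` in `H^β`, for `0 ≤ β ≤ α`. -/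
noncomputable def incl (α β : ℝ) : Sob D d α →L[ℝ] Sob D d β :=
  if h : 0 ≤ β ∧ β ≤ α then (exists_incl h.1 h.2).choose else 0

theorem toL2_incl {α β : ℝ} (hβ : 0 ≤ β) (h : β ≤ α) (x : Sob D d α) :
    toL2 (incl α β x) = toL2 x := by
  rw [incl, dif_pos ⟨hβ, h⟩]
  exact (exists_incl hβ h).choose_spec x

theorem integral_complexify (f : XR D d) {φ : Pt D d → ℝ} :
    ∫ x, (complexify D d f x) * (φ x : ℂ) = ((∫ x, f x * φ x : ℝ) : ℂ) := by
  rw [← integral_complex_ofReal]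
  refine integral_congr_ae ?_
  filter_upwards [complexify_ae f] with x hx
  rw [hx]; push_cast; rfl

theorem inner_test (φ : Pt D d → ℝ) (hφ : MemLp (fun x => (φ x : ℂ)) 2 volume)
    (p : Lp ℂ 2 (volume : Measure (Pt D d))) :
    inner ℂ (hφ.toLp _) p = ∫ x, p x * (φ x : ℂ) := by
  rw [L2.inner_def]
  refine integral_congr_ae ?_
  filter_upwards [hφ.coeFn_toLp] with x hx
  rw [hx]
  simp

/-- The Fourier symbol of a first derivative. -/
noncomputable def derivSymbol (D : Geometry) (d : ℕ) (i : Fin d) (ξ : Freq D d) : ℂ :=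
  2 * Real.pi * Complex.I * (freqCoord D d i ξ : ℂ)

theorem conj_derivSymbol (i : Fin d) (ξ : Freq D d) :
    (starRingEnd ℂ) (derivSymbol D d i ξ) = - derivSymbol D d i ξ := by
  simp only [derivSymbol, map_mul, Complex.conj_ofReal, Complex.conj_I, Complex.conj_ofNat]
  ring

theorem measurable_derivSymbol (i : Fin d) : Measurable (derivSymbol D d i) :=
  (Complex.measurable_ofReal.comp (measurable_freqCoord i)).const_mul _

theorem norm_derivSymbol_le (i : Fin d) (ξ : Freq D d) :
    ‖derivSymbol D d i ξ‖ ≤ wt D d 1 ξ := by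
  have h1 : ‖derivSymbol D d i ξ‖ = 2 * Real.pi * |freqCoord D d i ξ| := by
    simp [derivSymbol, abs_of_pos Real.pi_pos]
  rw [h1, wt, ← Real.sqrt_eq_rpow]
  refine Real.le_sqrt_of_sq_le ?_
  rw [mul_pow, sq_abs, japSq, freqSq_eq_sum]
  have := Finset.single_le_sum (f := fun i => freqCoord D d i ξ ^ 2) (fun j _ => sq_nonneg _)
    (Finset.mem_univ i)
  nlinarith [mul_le_mul_of_nonneg_left this (sq_nonneg (2 * Real.pi))]

/-- Parseval against test functions, with a purely imaginary symbol. The inverse transform p of H is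
a priori complex; its imaginary part annihilates all real test functions, hence vanishes. -/
theorem exists_real_deriv (f : XR D d) (i : Fin d) (H : VC D d)
    (hH : H =ᵐ[volume] fun ξ => derivSymbol D d i ξ * RT D d f ξ) :
    ∃ g : XR D d, RT D d g = H ∧
      ∀ φ : Pt D d → ℝ, IsTest φ → ∫ x, f x * partialD i φ x = -∫ x, g x * φ x := by
  set p := (FT D d).symm H with hp
  have key : ∀ φ : Pt D d → ℝ, IsTest φ →
      ((∫ x, f x * partialD i φ x : ℝ) : ℂ) = -∫ x, p x * (φ x : ℂ) := by
    intro φ hφ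
    rw [← integral_complexify, ← inner_test _ (hφ.partialD i).memLp_ofReal,
      ← inner_test _ hφ.memLp_ofReal, ← (FT D d).inner_map_map, ← (FT D d).inner_map_map, hp,
      LinearIsometryEquiv.apply_symm_apply, L2.inner_def, L2.inner_def, ← integral_neg]
    refine integral_congr_ae ?_
    filter_upwards [hφ.FT_partialD i, hH] with ξ h1 h2
    rw [h1, h2]
    simp only [RCLike.inner_apply, map_mul]
    have := conj_derivSymbol (D := D) i ξ
    simp only [derivSymbol, map_mul] at this ⊢
    rw [this, RT_apply]
    ring
  have hint : ∀ φ : Pt D d → ℝ, IsTest φ → Integrable fun x => p x * (φ x : ℂ) := fun φ hφ =>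
    (Lp.memLp p).integrable_mul hφ.memLp_ofReal
  have hre : ∀ φ : Pt D d → ℝ, IsTest φ →
      ∫ x, f x * partialD i φ x = -∫ x, (p x).re * φ x := fun φ hφ => by
    have h := congrArg Complex.re (key φ hφ)
    rw [Complex.ofReal_re, Complex.neg_re, ← RCLike.re_eq_complex_re, ← integral_re (hint φ hφ)] at h
    rw [h]
    simp
  have him : ∀ φ : Pt D d → ℝ, IsTest φ → ∫ x, (p x).im * φ x = 0 := fun φ hφ => by
    have h := congrArg Complex.im (key φ hφ)
    rw [Complex.ofReal_im, Complex.neg_im, ← RCLike.im_eq_complex_im, ← integral_im (hint φ hφ)] at h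
    simpa [Complex.im_mul_ofReal] using h.symm
  have hpim : (fun x => (p x).im) =ᵐ[volume] 0 := by
    refine ae_eq_zero_of_integral_test_mul ?_ him
    exact (Lp.memLp p).im.locallyIntegrable (by norm_num)
  refine ⟨(Lp.memLp p).re.toLp _, ?_, fun φ hφ => ?_⟩
  · rw [RT_apply, ← LinearIsometryEquiv.eq_symm_apply, ← hp]
    apply Lp.ext
    filter_upwards [complexify_ae ((Lp.memLp p).re.toLp _), (Lp.memLp p).re.coeFn_toLp, hpim]
      with x h1 h2 h3
    rw [h1, h2]
    apply Complex.ext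
    · simp
    · simpa using h3.symm
  · rw [hre φ hφ]
    congr 1
    refine integral_congr_ae ?_
    filter_upwards [(Lp.memLp p).re.coeFn_toLp] with x hx
    rw [hx]; rfl

theorem memLp_top_derivSymbol {σ : ℝ} (h : σ ≤ -1) (i : Fin d) :
    MemLp (fun ξ => derivSymbol D d i ξ * (wt D d σ ξ : ℂ)) ⊤ volume ∧
      ∀ ξ, ‖derivSymbol D d i ξ * (wt D d σ ξ : ℂ)‖ ≤ 1 := by
  have hb : ∀ ξ, ‖derivSymbol D d i ξ * (wt D d σ ξ : ℂ)‖ ≤ 1 := fun ξ => by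
    rw [norm_mul, Complex.norm_real, Real.norm_of_nonneg (wt_pos _ _).le]
    calc _ ≤ wt D d 1 ξ * wt D d σ ξ :=
          mul_le_mul_of_nonneg_right (norm_derivSymbol_le i ξ) (wt_pos _ _).le
      _ = wt D d (1 + σ) ξ := (wt_add _ _ _).symm
      _ ≤ 1 := wt_le_one (by linarith) ξ
  refine ⟨memLp_top_of_bound ?_ 1 (Eventually.of_forall hb), hb⟩
  exact ((measurable_derivSymbol i).mul
    (Complex.measurable_ofReal.comp (measurable_wt σ))).aestronglyMeasurable

theorem exists_pd_aux {α β : ℝ} (hβ : 0 ≤ β) (h : β + 1 ≤ α) (i : Fin d) (x : Sob D d α) :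
    ∃ y : Sob D d β, (∀ φ : Pt D d → ℝ, IsTest φ →
      ∫ z, toL2 x z * partialD i φ z = -∫ z, toL2 y z * φ z) ∧ ‖y‖ ≤ ‖x‖ ∧
      RT D d (toL2 y) =ᵐ[volume] fun ξ => derivSymbol D d i ξ * RT D d (toL2 x) ξ := by
  have h1 := memLp_top_derivSymbol (D := D) (σ := -α) (by linarith) i
  have h2 := memLp_top_derivSymbol (D := D) (σ := β - α) (by linarith) i
  have hα : 0 ≤ α := by linarith
  have e : mulLp _ h1.1 (fou x) =ᵐ[volume] fun ξ => derivSymbol D d i ξ * RT D d (toL2 x) ξ := by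
    filter_upwards [mulLp_ae _ h1.1 (fou x), RT_toL2_ae hα x] with ξ h3 h4
    rw [h3, h4]; ring
  obtain ⟨g, hg, hg'⟩ := exists_real_deriv (toL2 x) i _ e
  have hG : mulLp _ h2.1 (fou x) =ᵐ[volume] fun ξ => (wt D d β ξ : ℂ) * RT D d g ξ := by
    filter_upwards [mulLp_ae _ h1.1 (fou x), mulLp_ae _ h2.1 (fou x)] with ξ h3 h4
    rw [h4, hg, h3, sub_eq_add_neg, wt_add]
    push_cast; ring
  obtain ⟨y, hy, hy'⟩ := exists_sob hβ _ _ hG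
  refine ⟨y, by rwa [hy], ?_, by rwa [hy, hg]⟩
  rw [← fou.norm_map, ← fou.norm_map, hy']
  simpa using norm_mulLp_apply_le _ h2.1 (Eventually.of_forall h2.2) (fou x)

theorem eq_of_RT_ae {f g : XR D d} (h : RT D d f =ᵐ[volume] RT D d g) : f = g :=
  (RT D d).injective (Lp.ext h)

theorem exists_pd {α β : ℝ} (hβ : 0 ≤ β) (h : β + 1 ≤ α) (i : Fin d) :
    ∃ T : Sob D d α →L[ℝ] Sob D d β, ∀ x,
      RT D d (toL2 (T x)) =ᵐ[volume] fun ξ => derivSymbol D d i ξ * RT D d (toL2 x) ξ := by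
  choose T h1 h2 h3 using exists_pd_aux (D := D) hβ h i
  refine ⟨LinearMap.mkContinuous
    { toFun := T
      map_add' := fun x y => toL2_injective hβ (eq_of_RT_ae ?_)
      map_smul' := fun c x => toL2_injective hβ (eq_of_RT_ae ?_) } 1 (by simpa using h2), h3⟩
  · rw [map_add, map_add]
    filter_upwards [h3 (x + y), h3 x, h3 y, Lp.coeFn_add (RT D d (toL2 (T x)))
      (RT D d (toL2 (T y))), Lp.coeFn_add (RT D d (toL2 x)) (RT D d (toL2 y))] with ξ e1 e2 e3 e4 e5
    rw [e1, e4, Pi.add_apply, e2, e3, map_add, map_add, e5, Pi.add_apply]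
    ring
  · rw [RingHom.id_apply, map_smul, map_smul]
    filter_upwards [h3 (c • x), h3 x, Lp.coeFn_smul c (RT D d (toL2 (T x))),
      Lp.coeFn_smul c (RT D d (toL2 x))] with ξ e1 e2 e3 e4
    rw [e1, e3, Pi.smul_apply, e2, map_smul, map_smul, e4, Pi.smul_apply, Complex.real_smul,
      Complex.real_smul]
    ring

open Classical in
/-- The partial derivative `∂ᵢ : H^α → H^β`, for `0 ≤ β ≤ α - 1`. -/
noncomputable def pd (α β : ℝ) (i : Fin d) : Sob D d α →L[ℝ] Sob D d β :=
  if h : 0 ≤ β ∧ β + 1 ≤ α then (exists_pd h.1 h.2 i).choose else 0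

theorem RT_pd {α β : ℝ} (hβ : 0 ≤ β) (h : β + 1 ≤ α) (i : Fin d) (x : Sob D d α) :
    RT D d (toL2 (pd α β i x)) =ᵐ[volume] fun ξ => derivSymbol D d i ξ * RT D d (toL2 x) ξ := by
  rw [pd, dif_pos ⟨hβ, h⟩]
  exact (exists_pd hβ h i).choose_spec x

theorem integral_pd_test {α β : ℝ} (hβ : 0 ≤ β) (h : β + 1 ≤ α) (i : Fin d) (x : Sob D d α)
    {φ : Pt D d → ℝ} (hφ : IsTest φ) :
    ∫ z, toL2 x z * partialD i φ z = -∫ z, toL2 (pd α β i x) z * φ z := by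
  obtain ⟨y, h1, -, h2⟩ := exists_pd_aux (D := D) hβ h i x
  have : toL2 (pd α β i x) = toL2 y := eq_of_RT_ae ((RT_pd hβ h i x).trans h2.symm)
  rw [this]
  exact h1 φ hφ

/-- The transform of a derivative involves only the function, so the exponents chosen for source and
target are immaterial. -/
theorem toL2_pd_congr {α β α' β' : ℝ} (hβ : 0 ≤ β) (h : β + 1 ≤ α) (hβ' : 0 ≤ β')
    (h' : β' + 1 ≤ α') (i : Fin d) {x : Sob D d α} {y : Sob D d α'} (hxy : toL2 x = toL2 y) :
    toL2 (pd α β i x) = toL2 (pd α' β' i y) :=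
  eq_of_RT_ae ((RT_pd hβ h i x).trans (by rw [hxy]; exact (RT_pd hβ' h' i y).symm))

theorem integral_mul_eq_inner (f g : XR D d) : ∫ x, f x * g x = inner ℝ g f := by
  rw [L2.inner_def]
  rfl

/-- Plancherel and antisymmetry of the symbol. Neither factor needs to be a test function, only in
H¹. -/
theorem integral_pd_mul {α β : ℝ} (hα : 1 ≤ α) (hβ : 1 ≤ β) (i : Fin d) (x : Sob D d α)
    (y : Sob D d β) :
    ∫ z, toL2 (pd α 0 i x) z * toL2 y z = -∫ z, toL2 x z * toL2 (pd β 0 i y) z := by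
  have h : ∀ f g : XR D d, ((∫ z, f z * g z : ℝ) : ℂ) = ∫ ξ, inner ℂ (RT D d g ξ) (RT D d f ξ) := by
    intro f g
    rw [← L2.inner_def, RT_apply, RT_apply, (FT D d).inner_map_map, L2.inner_def,
      ← integral_complex_ofReal]
    refine integral_congr_ae ?_
    filter_upwards [complexify_ae f, complexify_ae g] with z h1 h2
    rw [h1, h2]; simp
  apply Complex.ofReal_injective
  rw [Complex.ofReal_neg, h, h, ← integral_neg]
  refine integral_congr_ae ?_
  filter_upwards [RT_pd le_rfl (by linarith) i x, RT_pd le_rfl (by linarith) i y] with ξ h1 h2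
  rw [h1, h2]
  simp only [RCLike.inner_apply, map_mul, conj_derivSymbol]
  ring

/-! ### Products, the Leibniz rule and the embedding in L^∞ -/

variable {D : Geometry} {d : ℕ}

/-- The convolution of the transforms is square-integrable with the weight γ, hence also without it
since the weight is at least 1. The convolution theorem then identifies its inverse transform with
the pointwise product. -/
theorem exists_mul_aux {α β γ : ℝ} (h : MulCond d α β γ) (x : Sob D d α) (y : Sob D d β) :
    ∃ z : Sob D d γ, (toL2 z =ᵐ[volume] fun p => toL2 x p * toL2 y p) ∧
      ‖z‖ ≤ √(mulConstSq D d α β γ).toReal * ‖x‖ * ‖y‖ ∧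
      RT D d (toL2 z) =ᵐ[volume]
        fun ξ => ∫ η, RT D d (toL2 x) (ξ - η) * RT D d (toL2 y) η := by
  have hα : 0 ≤ α := h.nonneg.trans h.le_left
  have hβ : 0 ≤ β := h.nonneg.trans h.le_right
  set F := RT D d (toL2 x) with hF
  set G := RT D d (toL2 y) with hG
  set K : Freq D d → ℂ := fun ξ => ∫ η, F (ξ - η) * G η with hK
  have hKm : AEStronglyMeasurable K volume := by
    have h1 : StronglyMeasurable fun p : Freq D d × Freq D d => F (p.1 - p.2) * G p.2 :=
      ((Lp.stronglyMeasurable F).comp_measurable (measurable_fst.sub measurable_snd)).mul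
        ((Lp.stronglyMeasurable G).comp_measurable measurable_snd)
    exact (h1.integral_prod_right').aestronglyMeasurable
  have hHm : AEStronglyMeasurable (fun ξ => (wt D d γ ξ : ℂ) * K ξ) volume :=
    (Complex.measurable_ofReal.comp (measurable_wt γ)).aestronglyMeasurable.mul hKm
  have hb := lintegral_wt_convolution_le h (Lp.stronglyMeasurable (fou x)).measurable
    (Lp.stronglyMeasurable (fou y)).measurable (RT_toL2_ae hα x) (RT_toL2_ae hβ y)
  rw [← eLpNorm_two_sq, ← eLpNorm_two_sq, ← eLpNorm_two_sq] at hb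
  have hA := Lp.eLpNorm_ne_top (fou x)
  have hB := Lp.eLpNorm_ne_top (fou y)
  have hC := (mulConstSq_lt_top (D := D) h).ne
  have hfin : mulConstSq D d α β γ * (eLpNorm (fou x) 2 volume ^ 2 * eLpNorm (fou y) 2 volume ^ 2)
      ≠ ⊤ := ENNReal.mul_ne_top hC (ENNReal.mul_ne_top (ENNReal.pow_ne_top hA)
        (ENNReal.pow_ne_top hB))
  have hH : MemLp (fun ξ => (wt D d γ ξ : ℂ) * K ξ) 2 volume := by
    refine ⟨hHm, ?_⟩
    have := lt_of_le_of_lt hb hfin.lt_top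
    exact (ENNReal.pow_lt_top_iff.1 this).resolve_right (by norm_num)
  have hKL : MemLp K 2 volume := hH.mono hKm (Eventually.of_forall fun ξ => by
    rw [norm_mul, Complex.norm_real, Real.norm_of_nonneg (wt_pos _ _).le]
    exact le_mul_of_one_le_left (norm_nonneg _) (one_le_wt h.nonneg ξ))
  have hp := FT_symm_convolution (Lp.memLp (complexify D d (toL2 x)))
    (Lp.memLp (complexify D d (toL2 y))) (hKL.toLp K) (by
      rw [Lp.toLp_coeFn, Lp.toLp_coeFn]
      exact hKL.coeFn_toLp)
  have hpr : (FT D d).symm (hKL.toLp K) =ᵐ[volume]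
      fun p => ((toL2 x p * toL2 y p : ℝ) : ℂ) := by
    filter_upwards [hp, complexify_ae (toL2 x), complexify_ae (toL2 y)] with p h1 h2 h3
    rw [h1, h2, h3]; push_cast; rfl
  have hr : MemLp (fun p => toL2 x p * toL2 y p) 2 volume := by
    have := ((memLp_congr_ae hpr).1 (Lp.memLp _)).re
    simpa using this
  have hRT : RT D d (hr.toLp _) = hKL.toLp K := by
    rw [RT_apply, ← LinearIsometryEquiv.eq_symm_apply]
    apply Lp.ext
    filter_upwards [hpr, complexify_ae (hr.toLp _), hr.coeFn_toLp] with p h1 h2 h3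
    rw [h1, h2, h3]
  have hfin2 : hH.toLp _ =ᵐ[volume] fun ξ => (wt D d γ ξ : ℂ) * RT D d (hr.toLp _) ξ := by
    rw [hRT]
    filter_upwards [hH.coeFn_toLp, hKL.coeFn_toLp] with ξ h1 h2
    rw [h1, h2]
  obtain ⟨z, hz, hz'⟩ := exists_sob h.nonneg _ _ hfin2
  refine ⟨z, by rw [hz]; exact hr.coeFn_toLp, ?_, by rw [hz, hRT]; exact hKL.coeFn_toLp⟩
  have hn := ENNReal.toReal_mono hfin hb
  rw [ENNReal.toReal_mul, ENNReal.toReal_mul, ENNReal.toReal_pow, ENNReal.toReal_pow,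
    ENNReal.toReal_pow] at hn
  rw [← fou.norm_map z, ← fou.norm_map x, ← fou.norm_map y, hz', Lp.norm_toLp, Lp.norm_def,
    Lp.norm_def]
  refine le_of_sq_le_sq ?_ (by positivity)
  refine hn.trans_eq ?_
  rw [mul_pow, mul_pow, Real.sq_sqrt ENNReal.toReal_nonneg]
  ring

theorem exists_mul {α β γ : ℝ} (h : MulCond d α β γ) :
    ∃ T : Sob D d α →L[ℝ] Sob D d β →L[ℝ] Sob D d γ, ∀ x y,
      toL2 (T x y) =ᵐ[volume] fun p => toL2 x p * toL2 y p := by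
  choose T hT hC hR using exists_mul_aux (D := D) h
  have key : ∀ {z z' : Sob D d γ}, (toL2 z =ᵐ[volume] toL2 z') → z = z' := fun hz =>
    toL2_injective h.nonneg (Lp.ext hz)
  refine ⟨LinearMap.mkContinuous₂ (LinearMap.mk₂ ℝ T ?_ ?_ ?_ ?_) _ hC, hT⟩
  · intro x x' y
    apply key
    rw [map_add]
    filter_upwards [hT (x + x') y, hT x y, hT x' y, Lp.coeFn_add (toL2 (T x y)) (toL2 (T x' y)),
      Lp.coeFn_add (toL2 x) (toL2 x')] with p e1 e2 e3 e4 e5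
    rw [e1, e4, Pi.add_apply, e2, e3, map_add, e5, Pi.add_apply]
    ring
  · intro c x y
    apply key
    rw [map_smul]
    filter_upwards [hT (c • x) y, hT x y, Lp.coeFn_smul c (toL2 (T x y)),
      Lp.coeFn_smul c (toL2 x)] with p e1 e2 e4 e5
    rw [e1, e4, Pi.smul_apply, e2, map_smul, e5, Pi.smul_apply]
    simp only [smul_eq_mul]; ring
  · intro x y y'
    apply key
    rw [map_add]
    filter_upwards [hT x (y + y'), hT x y, hT x y', Lp.coeFn_add (toL2 (T x y)) (toL2 (T x y')),
      Lp.coeFn_add (toL2 y) (toL2 y')] with p e1 e2 e3 e4 e5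
    rw [e1, e4, Pi.add_apply, e2, e3, map_add, e5, Pi.add_apply]
    ring
  · intro c x y
    apply key
    rw [map_smul]
    filter_upwards [hT x (c • y), hT x y, Lp.coeFn_smul c (toL2 (T x y)),
      Lp.coeFn_smul c (toL2 y)] with p e1 e2 e4 e5
    rw [e1, e4, Pi.smul_apply, e2, map_smul, e5, Pi.smul_apply]
    simp only [smul_eq_mul]; ring

open Classical in
/-- The product of `H^α` and `H^β` with values in `H^γ`. -/
noncomputable def mul (α β γ : ℝ) : Sob D d α →L[ℝ] Sob D d β →L[ℝ] Sob D d γ :=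
  if h : MulCond d α β γ then (exists_mul h).choose else 0

theorem toL2_mul {α β γ : ℝ} (h : MulCond d α β γ) (x : Sob D d α) (y : Sob D d β) :
    toL2 (mul α β γ x y) =ᵐ[volume] fun p => toL2 x p * toL2 y p := by
  rw [mul, dif_pos h]
  exact (exists_mul h).choose_spec x y

theorem RT_mul {α β γ : ℝ} (h : MulCond d α β γ) (x : Sob D d α) (y : Sob D d β) :
    RT D d (toL2 (mul α β γ x y)) =ᵐ[volume]
      fun ξ => ∫ η, RT D d (toL2 x) (ξ - η) * RT D d (toL2 y) η := by
  obtain ⟨z, hz, -, hR⟩ := exists_mul_aux h x y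
  have : toL2 (mul α β γ x y) = toL2 z := Lp.ext ((toL2_mul h x y).trans hz.symm)
  rwa [this]

theorem derivSymbol_add (i : Fin d) (ξ η : Freq D d) :
    derivSymbol D d i (ξ + η) = derivSymbol D d i ξ + derivSymbol D d i η := by
  simp only [derivSymbol, freqCoord_add]
  push_cast
  ring

theorem integrable_convolution (F G : VC D d) (ξ : Freq D d) :
    Integrable fun η => F (ξ - η) * G η := by
  have hmp := Measure.measurePreserving_sub_left (volume : Measure (Freq D d)) ξ
  exact ((Lp.memLp F).comp_measurePreserving hmp).integrable_mul (Lp.memLp G)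

/-- The product rule in Sobolev spaces. -/
theorem pd_mul {α β γ : ℝ} (h : MulCond d α β γ) (hγ : 1 ≤ γ) (i : Fin d) (x : Sob D d α)
    (y : Sob D d β) :
    toL2 (pd γ 0 i (mul α β γ x y)) =ᵐ[volume] fun p =>
      toL2 (pd α 0 i x) p * toL2 y p + toL2 x p * toL2 (pd β 0 i y) p := by
  have hα : 1 ≤ α := hγ.trans h.le_left
  have hβ : 1 ≤ β := hγ.trans h.le_right
  -- One derivative is lost on a factor, but the target drops from γ ≥ 1 to 0, so the exponent
  -- condition survives.
  have hc1 : MulCond d (α - 1) β 0 := ⟨le_rfl, by linarith, by linarith, by linarith [h.lt]⟩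
  have hc2 : MulCond d α (β - 1) 0 := ⟨le_rfl, by linarith, by linarith, by linarith [h.lt]⟩
  have e1 : toL2 (pd α (α - 1) i x) = toL2 (pd α 0 i x) :=
    toL2_pd_congr (by linarith) (by linarith) le_rfl (by linarith) i rfl
  have e2 : toL2 (pd β (β - 1) i y) = toL2 (pd β 0 i y) :=
    toL2_pd_congr (by linarith) (by linarith) le_rfl (by linarith) i rfl
  have key : toL2 (pd γ 0 i (mul α β γ x y)) =
      toL2 (mul (α - 1) β 0 (pd α (α - 1) i x) y) + toL2 (mul α (β - 1) 0 x (pd β (β - 1) i y)) := by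
    refine eq_of_RT_ae ?_
    rw [map_add]
    have q1 := RT_pd le_rfl (by linarith) i x
    have q2 := RT_pd le_rfl (by linarith) i y
    filter_upwards [RT_pd le_rfl (by linarith) i (mul α β γ x y), RT_mul h x y,
      RT_mul hc1 (pd α (α - 1) i x) y, RT_mul hc2 x (pd β (β - 1) i y),
      Lp.coeFn_add (RT D d (toL2 (mul (α - 1) β 0 (pd α (α - 1) i x) y)))
        (RT D d (toL2 (mul α (β - 1) 0 x (pd β (β - 1) i y))))] with ξ h1 h2 h3 h4 h5
    rw [h1, h2, h5, Pi.add_apply, h3, h4, e1, e2, ← integral_const_mul,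
      ← integral_add (integrable_convolution _ _ _) (integrable_convolution _ _ _)]
    have hmp := (Measure.measurePreserving_sub_left (volume : Measure (Freq D d)) ξ).quasiMeasurePreserving
    refine integral_congr_ae ?_
    filter_upwards [q2, hmp.ae q1] with η h6 h7
    rw [h6, h7]
    -- Under the convolution integral the Leibniz rule is additivity of the symbol.
    have : derivSymbol D d i ξ = derivSymbol D d i (ξ - η) + derivSymbol D d i η := by
      rw [← derivSymbol_add, sub_add_cancel]
    rw [this]
    ring
  rw [key]
  filter_upwards [Lp.coeFn_add (toL2 (mul (α - 1) β 0 (pd α (α - 1) i x) y))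
    (toL2 (mul α (β - 1) 0 x (pd β (β - 1) i y))), toL2_mul hc1 (pd α (α - 1) i x) y,
    toL2_mul hc2 x (pd β (β - 1) i y)] with p h1 h2 h3
  rw [h1, Pi.add_apply, h2, h3, e1, e2]

/-- The Sobolev embedding of `H^σ` in `L^∞`, for `σ > d/2`. -/
theorem exists_sup_bound {σ : ℝ} (hσ : 0 ≤ σ) (h : (d : ℝ) / 2 < σ) :
    ∃ C : ℝ, 0 ≤ C ∧ ∀ x : Sob D d σ, ∀ᵐ p, |toL2 x p| ≤ C * ‖x‖ := by
  have hc : MulCond d σ 0 0 := ⟨le_rfl, hσ, le_rfl, by simpa using h⟩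
  refine ⟨‖(mul σ 0 0 : Sob D d σ →L[ℝ] Sob D d 0 →L[ℝ] Sob D d 0)‖,
    ContinuousLinearMap.opNorm_nonneg _, fun x => ?_⟩
  set M := ‖(mul σ 0 0 : Sob D d σ →L[ℝ] Sob D d 0 →L[ℝ] Sob D d 0)‖ * ‖x‖ with hM
  have hM0 : 0 ≤ M := by positivity
  have hL2 : ∀ y : Sob D d 0, ‖toL2 y‖ = ‖y‖ := fun y => by
    rw [← (RT D d).norm_map, ← fou.norm_map]
    congr 1
    apply Lp.ext
    filter_upwards [RT_toL2_ae le_rfl y] with ξ h1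
    rw [h1]; simp [wt_zero]
  -- Multiplication by x is bounded by M on L². If |x| > M on a set S of positive measure, applying
  -- it to the restriction of x to S, which is nonzero throughout S, contradicts this bound.
  by_contra hne
  set S : Set (Pt D d) := {p | M < |toL2 x p|} with hS
  have hSm : MeasurableSet S :=
    measurableSet_lt measurable_const (Lp.stronglyMeasurable (toL2 x)).measurable.abs
  have hSpos : volume S ≠ 0 := by
    intro h0
    apply hne
    rw [ae_iff]
    simpa [hS] using h0
  set g := (((Lp.memLp (toL2 x)).indicator hSm).toLp (S.indicator (toL2 x)) : XR D d) with hg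
  have hgae : g =ᵐ[volume] S.indicator (toL2 x) := MemLp.coeFn_toLp _
  obtain ⟨y, hy, -⟩ := exists_sob (D := D) le_rfl g (RT D d g) (by
    filter_upwards with ξ; simp [wt_zero])
  have h1 : ‖toL2 (mul σ 0 0 x y)‖ ≤ M * ‖g‖ := by
    rw [hL2, ← hy, hL2]
    exact (mul σ 0 0).le_opNorm₂ x y
  clear_value M
  have e1 := toL2_mul hc x y
  have sq : ∀ f : XR D d, ‖f‖ ^ 2 = ∫ p, f p ^ 2 := fun f => by
    rw [← real_inner_self_eq_norm_sq, ← integral_mul_eq_inner]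
    simp [_root_.sq]
  have h2 : ‖toL2 (mul σ 0 0 x y)‖ ^ 2 ≤ (M * ‖g‖) ^ 2 := by gcongr
  rw [mul_pow, sq, sq, ← integral_const_mul] at h2
  have hint : ∀ f : XR D d, Integrable (fun p => f p ^ 2) := fun f => (Lp.memLp f).integrable_sq
  have hle : (fun p => M ^ 2 * g p ^ 2) ≤ᵐ[volume] fun p => toL2 (mul σ 0 0 x y) p ^ 2 := by
    filter_upwards [e1, hgae] with p h3 h4
    rw [h3, hy, h4]
    by_cases hp : p ∈ S
    · have hp' : M < |toL2 x p| := hp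
      have h5 : M ^ 2 ≤ toL2 x p ^ 2 := by
        rw [← sq_abs (toL2 x p)]
        gcongr
      rw [Set.indicator_of_mem hp, mul_pow]
      exact mul_le_mul_of_nonneg_right h5 (sq_nonneg _)
    · simp [hp]
  have heq := (integral_eq_iff_of_ae_le ((hint g).const_mul _) (hint _) hle).1
    (le_antisymm (integral_mono_ae ((hint g).const_mul _) (hint _) hle) h2)
  apply hSpos
  rw [← nonpos_iff_eq_zero]
  have : ∀ᵐ p, p ∉ S := by
    filter_upwards [heq, e1, hgae] with p h3 h4 h5 hp
    have hp' : M < |toL2 x p| := hp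
    rw [h4, hy, h5, Set.indicator_of_mem hp, mul_pow, ← sq_abs (toL2 x p)] at h3
    have hpos : 0 < |toL2 x p| := hM0.trans_lt hp'
    have : M ^ 2 < |toL2 x p| ^ 2 := by gcongr
    nlinarith [mul_lt_mul_of_pos_right this (pow_pos hpos 2)]
  rw [ae_iff] at this
  simpa using this.le

theorem coeFn_lp_sum {α E ι : Type*} [MeasurableSpace α] {μ : Measure α} [NormedAddCommGroup E]
    {p : ℝ≥0∞} (s : Finset ι) (f : ι → Lp E p μ) :
    ((∑ i ∈ s, f i : Lp E p μ) : α → E) =ᵐ[μ] fun x => ∑ i ∈ s, f i x := by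
  classical
  induction s using Finset.induction_on with
  | empty => exact Lp.coeFn_zero E p μ
  | insert a s ha ih =>
    rw [Finset.sum_insert ha]
    filter_upwards [Lp.coeFn_add (f a) (∑ i ∈ s, f i), ih] with x h1 h2
    rw [h1, Pi.add_apply, h2, Finset.sum_insert ha]

/-! ### Test functions belong to every Sobolev space -/

theorem IsTest.RT_partialD {φ : Pt D d → ℝ} (hφ : IsTest φ) (i : Fin d) :
    RT D d (((hφ.partialD i).memLp 2).toLp _) =ᵐ[volume]
      fun ξ => derivSymbol D d i ξ * RT D d ((hφ.memLp 2).toLp _) ξ := by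
  have e : ∀ {ψ : Pt D d → ℝ} (hψ : IsTest ψ),
      complexify D d ((hψ.memLp 2).toLp _) = hψ.memLp_ofReal.toLp _ := fun {ψ} hψ => by
    apply Lp.ext
    filter_upwards [complexify_ae ((hψ.memLp 2).toLp _), (hψ.memLp 2).coeFn_toLp,
      hψ.memLp_ofReal.coeFn_toLp] with x h1 h2 h3
    rw [h1, h2, h3]
  rw [RT_apply, RT_apply, e (hφ.partialD i), e hφ]
  exact hφ.FT_partialD i

theorem derivSymbol_sq (i : Fin d) (ξ : Freq D d) :
    derivSymbol D d i ξ * derivSymbol D d i ξ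
      = -(((2 * Real.pi) ^ 2 * freqCoord D d i ξ ^ 2 : ℝ) : ℂ) := by
  unfold derivSymbol
  push_cast
  linear_combination (2 * Real.pi * (freqCoord D d i ξ : ℂ)) ^ 2 * Complex.I_sq

/-- Induction: φ and its second derivatives are test functions, and two more orders multiply the
weight by 1 - ∑ᵢ (symbol of ∂ᵢ)². -/
theorem IsTest.exists_sob_nat (n : ℕ) {φ : Pt D d → ℝ} (hφ : IsTest φ) :
    ∃ x : Sob D d (2 * n), φ =ᵐ[volume] toL2 x := by
  suffices h : ∀ φ : Pt D d → ℝ, (hφ : IsTest φ) →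
      ∃ G : VC D d, G =ᵐ[volume] fun ξ =>
        (wt D d (2 * n) ξ : ℂ) * RT D d ((hφ.memLp 2).toLp _) ξ by
    obtain ⟨G, hG⟩ := h φ hφ
    obtain ⟨x, hx, -⟩ := exists_sob (by positivity) _ _ hG
    exact ⟨x, by rw [hx]; exact (hφ.memLp 2).coeFn_toLp.symm⟩
  clear hφ φ
  induction n with
  | zero => exact fun φ hφ => ⟨RT D d ((hφ.memLp 2).toLp _), by filter_upwards with ξ; simp [wt_zero]⟩
  | succ n ih =>
    intro φ hφ
    obtain ⟨G, hG⟩ := ih φ hφ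
    choose G' hG' using fun i => ih _ ((hφ.partialD i).partialD i)
    refine ⟨G - ∑ i, G' i, ?_⟩
    filter_upwards [hG, ae_all_iff.2 hG', Lp.coeFn_sub G (∑ i, G' i), coeFn_lp_sum Finset.univ G',
      ae_all_iff.2 fun i => hφ.RT_partialD i, ae_all_iff.2 fun i => (hφ.partialD i).RT_partialD i]
      with ξ h1 h2 h3 h4 h5 h6
    rw [h3, Pi.sub_apply, h1, h4, Finset.sum_congr rfl fun i _ => h2 i]
    simp only [h6, h5]
    have h7 : (wt D d (2 * ((n + 1 : ℕ) : ℝ)) ξ : ℂ)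
        = (wt D d (2 * n) ξ : ℂ) * (japSq D d ξ : ℂ) := by
      have : wt D d 2 ξ = japSq D d ξ := by simp [wt]
      rw [← this, ← Complex.ofReal_mul, ← wt_add]
      push_cast; ring_nf
    have h8 : (japSq D d ξ : ℂ) = 1 - ∑ i, derivSymbol D d i ξ * derivSymbol D d i ξ := by
      simp only [derivSymbol_sq]
      rw [japSq, freqSq_eq_sum, Finset.mul_sum]
      push_cast
      rw [Finset.sum_neg_distrib]; ring
    rw [h7, h8, mul_assoc, sub_mul, one_mul, mul_sub, Finset.sum_mul, Finset.mul_sum]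
    simp only [mul_assoc]

theorem IsTest.exists_sob {φ : Pt D d → ℝ} (hφ : IsTest φ) {σ : ℝ} (hσ : 0 ≤ σ) :
    ∃ x : Sob D d σ, φ =ᵐ[volume] toL2 x := by
  obtain ⟨n, hn⟩ := exists_nat_ge σ
  obtain ⟨x, hx⟩ := hφ.exists_sob_nat n
  refine ⟨incl _ _ x, ?_⟩
  rw [toL2_incl hσ (by linarith)]
  exact hx

theorem IsTest.toL2_pd {φ : Pt D d → ℝ} (hφ : IsTest φ) {α β : ℝ} (hβ : 0 ≤ β)
    (h : β + 1 ≤ α) (i : Fin d) {x : Sob D d α} (hx : φ =ᵐ[volume] toL2 x) :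
    toL2 (pd α β i x) =ᵐ[volume] FavrieGavrilyuk.partialD i φ := by
  have e : toL2 x = (hφ.memLp 2).toLp _ := by
    apply Lp.ext
    exact hx.symm.trans (hφ.memLp 2).coeFn_toLp.symm
  have : toL2 (pd α β i x) = ((hφ.partialD i).memLp 2).toLp _ := by
    refine eq_of_RT_ae ((RT_pd hβ h i x).trans ?_)
    rw [e]
    exact (hφ.RT_partialD i).symm
  rw [this]
  exact MemLp.coeFn_toLp _

/-! ### Division by the depth in H¹ -/

variable {D : Geometry} {d : ℕ}

/-- With ⟨ξ⟩ the weight of order 1, ⟨ξ⟩ = ⟨ξ⟩⁻¹(1 - ∑ᵢ (symbol of ∂ᵢ)²), and the multipliers ⟨ξ⟩⁻¹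
and ⟨ξ⟩⁻¹ times a symbol are bounded by 1. This reduces H¹ bounds to pointwise bounds on a function
and its gradient. -/
theorem norm_le_norm_toL2_add (x : Sob D d 1) :
    ‖x‖ ≤ ‖toL2 x‖ + ∑ i, ‖toL2 (pd 1 0 i x)‖ := by
  have h0 := memLp_top_wt (D := D) (d := d) (σ := -1) (by norm_num)
  have h1 := fun i => memLp_top_derivSymbol (D := D) (d := d) (σ := -1) le_rfl i
  have e : fou x = mulLp _ h0 (RT D d (toL2 x)) -
      ∑ i, mulLp _ (h1 i).1 (RT D d (toL2 (pd 1 0 i x))) := by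
    apply Lp.ext
    filter_upwards [fou_ae zero_le_one x, mulLp_ae _ h0 (RT D d (toL2 x)),
      ae_all_iff.2 fun i => mulLp_ae _ (h1 i).1 (RT D d (toL2 (pd 1 0 i x))),
      ae_all_iff.2 fun i => RT_pd le_rfl (zero_add 1).le i x,
      Lp.coeFn_sub (mulLp _ h0 (RT D d (toL2 x)))
        (∑ i, mulLp _ (h1 i).1 (RT D d (toL2 (pd 1 0 i x)))),
      coeFn_lp_sum Finset.univ fun i => mulLp _ (h1 i).1 (RT D d (toL2 (pd 1 0 i x)))]
      with ξ a1 a2 a3 a4 a5 a6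
    rw [a5, Pi.sub_apply, a6, a1, a2]
    simp only [a3, a4]
    have h7 : (wt D d 1 ξ : ℂ) = (wt D d (-1) ξ : ℂ) * (japSq D d ξ : ℂ) := by
      have : wt D d 2 ξ = japSq D d ξ := by simp [wt]
      rw [← this, ← Complex.ofReal_mul, ← wt_add]
      norm_num
    have h8 : (japSq D d ξ : ℂ) = 1 - ∑ i, derivSymbol D d i ξ * derivSymbol D d i ξ := by
      simp only [derivSymbol_sq]
      rw [japSq, freqSq_eq_sum, Finset.mul_sum]
      push_cast
      rw [Finset.sum_neg_distrib]; ring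
    rw [h7, h8, mul_sub, sub_mul, mul_one, Finset.mul_sum, Finset.sum_mul]
    congr 1
    exact Finset.sum_congr rfl fun i _ => by ring
  rw [← fou.norm_map, e]
  refine (norm_sub_le _ _).trans (add_le_add ?_ ((norm_sum_le _ _).trans
    (Finset.sum_le_sum fun i _ => ?_)))
  · have := norm_mulLp_apply_le _ h0 (C := 1) (Eventually.of_forall fun ξ => by
      rw [Complex.norm_real, Real.norm_of_nonneg (wt_pos _ ξ).le]
      exact wt_le_one (by simp) ξ) (RT D d (toL2 x))
    rwa [one_mul, (RT D d).norm_map] at this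
  · have := norm_mulLp_apply_le _ (h1 i).1 (Eventually.of_forall (h1 i).2)
      (RT D d (toL2 (pd 1 0 i x)))
    rwa [one_mul, (RT D d).norm_map] at this

theorem norm_le_of_ae_le_add (f g h : XR D d) {a b : ℝ} (ha : 0 ≤ a) (hb : 0 ≤ b)
    (H : ∀ᵐ p, |f p| ≤ a * |g p| + b * |h p|) : ‖f‖ ≤ a * ‖g‖ + b * ‖h‖ := by
  have h1 : ‖f‖ ≤ ‖a • |g| + b • |h|‖ := by
    refine Lp.norm_le_norm_of_ae_le ?_
    filter_upwards [H, Lp.coeFn_add (a • |g|) (b • |h|), Lp.coeFn_smul a |g|, Lp.coeFn_smul b |h|,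
      Lp.coeFn_abs g, Lp.coeFn_abs h] with p e1 e2 e3 e4 e5 e6
    rw [e2, Pi.add_apply, e3, e4, Pi.smul_apply, Pi.smul_apply, e5, e6]
    exact e1.trans (le_abs_self _)
  refine h1.trans ((norm_add_le _ _).trans_eq ?_)
  rw [norm_smul, norm_smul, norm_abs_eq_norm, norm_abs_eq_norm, Real.norm_of_nonneg ha,
    Real.norm_of_nonneg hb]

/-- Quotients by a depth bounded below. -/
theorem exists_div {s : ℝ} (hsd : (d : ℝ) / 2 < s) (hs : 1 ≤ s) (ζ : Sob D d s) {hstar : ℝ}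
    (h0 : 0 < hstar) (hζ : ∀ᵐ p, hstar ≤ 1 + toL2 ζ p) (g : Sob D d 1) :
    ∃ Y : Sob D d 1, (toL2 Y =ᵐ[volume] fun p => toL2 g p / (1 + toL2 ζ p)) ∧
      ∀ i, toL2 (pd 1 0 i Y) =ᵐ[volume] fun p => toL2 (pd 1 0 i g) p / (1 + toL2 ζ p) -
        toL2 g p * toL2 (pd s 0 i ζ) p / (1 + toL2 ζ p) ^ 2 := by
  have hc : MulCond d s 1 1 := ⟨zero_le_one, hs, le_rfl, by linarith⟩
  have hc' : MulCond d (s - 1) 1 0 := ⟨le_rfl, by linarith, zero_le_one, by linarith⟩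
  obtain ⟨C, hC0, hC⟩ := exists_sup_bound (D := D) (by linarith : 0 ≤ s) hsd
  -- M is an upper bound of the depth; taking it at least twice the lower bound makes κ = 1 - h⋆/M
  -- positive as well as less than 1.
  set M := max (1 + C * ‖ζ‖) (2 * hstar) with hM
  have hM0 : 0 < M := lt_of_lt_of_le (by positivity) (le_max_right _ _)
  have hζM : ∀ᵐ p, 1 + toL2 ζ p ≤ M := by
    filter_upwards [hC ζ] with p hp
    exact le_max_of_le_left (by linarith [le_abs_self (toL2 ζ p)])
  set κ := 1 - hstar / M with hκ
  have hκ1 : κ < 1 := by have := div_pos h0 hM0; linarith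
  have hκ0 : 0 < κ := by
    have : hstar / M < 1 := by
      rw [div_lt_one hM0]
      exact lt_of_lt_of_le (by linarith) (le_max_right _ _)
    linarith
  -- Neumann series for the inverse: Θ multiplies by θ = 1 - (1 + ζ)/M, with |θ| ≤ κ. Its operator
  -- norm on H¹ need not be less than 1, so summability comes from pointwise bounds on the iterates
  -- and their gradients.
  set Θ : Sob D d 1 →L[ℝ] Sob D d 1 :=
    ContinuousLinearMap.id ℝ _ - M⁻¹ • (ContinuousLinearMap.id ℝ _ + mul s 1 1 ζ) with hΘ
  have hΘa : ∀ y, Θ y = y - M⁻¹ • (y + mul s 1 1 ζ y) := fun y => rfl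
  have hΘ1 : ∀ y, toL2 (Θ y) =ᵐ[volume] fun p => (1 - M⁻¹ * (1 + toL2 ζ p)) * toL2 y p := by
    intro y
    rw [hΘa, map_sub, map_smul, map_add]
    filter_upwards [Lp.coeFn_sub (toL2 y) (M⁻¹ • (toL2 y + toL2 (mul s 1 1 ζ y))),
      Lp.coeFn_smul M⁻¹ (toL2 y + toL2 (mul s 1 1 ζ y)),
      Lp.coeFn_add (toL2 y) (toL2 (mul s 1 1 ζ y)), toL2_mul hc ζ y] with p e1 e2 e3 e4
    rw [e1, Pi.sub_apply, e2, Pi.smul_apply, e3, Pi.add_apply, e4, smul_eq_mul]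
    ring
  have hΘ2 : ∀ i y, toL2 (pd 1 0 i (Θ y)) =ᵐ[volume] fun p =>
      (1 - M⁻¹ * (1 + toL2 ζ p)) * toL2 (pd 1 0 i y) p
        - M⁻¹ * (toL2 (pd s 0 i ζ) p * toL2 y p) := by
    intro i y
    rw [hΘa, map_sub, map_smul, map_add, map_sub, map_smul, map_add]
    filter_upwards [Lp.coeFn_sub (toL2 (pd 1 0 i y))
        (M⁻¹ • (toL2 (pd 1 0 i y) + toL2 (pd 1 0 i (mul s 1 1 ζ y)))),
      Lp.coeFn_smul M⁻¹ (toL2 (pd 1 0 i y) + toL2 (pd 1 0 i (mul s 1 1 ζ y))),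
      Lp.coeFn_add (toL2 (pd 1 0 i y)) (toL2 (pd 1 0 i (mul s 1 1 ζ y))),
      pd_mul hc le_rfl i ζ y] with p e1 e2 e3 e4
    rw [e1, Pi.sub_apply, e2, Pi.smul_apply, e3, Pi.add_apply, e4, smul_eq_mul]
    ring
  have hθ : ∀ᵐ p, |1 - M⁻¹ * (1 + toL2 ζ p)| ≤ κ := by
    filter_upwards [hζ, hζM] with p h1 h2
    rw [abs_of_nonneg, hκ, div_eq_inv_mul]
    · gcongr
    · have : M⁻¹ * (1 + toL2 ζ p) ≤ M⁻¹ * M := by gcongr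
      rw [inv_mul_cancel₀ hM0.ne'] at this
      linarith
  set z : ℕ → Sob D d 1 := fun n => Θ^[n] g with hz
  have hzs : ∀ n, z (n + 1) = Θ (z n) := fun n => Function.iterate_succ_apply' _ _ _
  have hz1 : ∀ n, ∀ᵐ p, |toL2 (z n) p| ≤ κ ^ n * |toL2 g p| := by
    intro n
    induction n with
    | zero => exact Eventually.of_forall fun p => by simp [hz]
    | succ n ih =>
      rw [hzs]
      filter_upwards [ih, hΘ1 (z n), hθ] with p h1 h2 h3
      rw [h2, abs_mul, pow_succ', mul_assoc]
      exact mul_le_mul h3 h1 (abs_nonneg _) hκ0.le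
  -- Heuristically ∂ᵢ(θⁿg) = θⁿ∂ᵢg - nθⁿ⁻¹M⁻¹ g ∂ᵢζ; the power κⁿ⁻¹ is written κⁿκ⁻¹ to avoid
  -- natural subtraction.
  have hz2 : ∀ i n, ∀ᵐ p, |toL2 (pd 1 0 i (z n)) p| ≤ κ ^ n * |toL2 (pd 1 0 i g) p| +
      (n * κ ^ n * (κ * M)⁻¹) * |toL2 (pd s 0 i ζ) p * toL2 g p| := by
    intro i n
    induction n with
    | zero => exact Eventually.of_forall fun p => by simp [hz]
    | succ n ih =>
      rw [hzs]
      filter_upwards [ih, hΘ2 i (z n), hθ, hz1 n] with p h1 h2 h3 h4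
      rw [h2]
      refine (abs_sub _ _).trans ?_
      rw [abs_mul, abs_mul M⁻¹, abs_mul (toL2 (pd s 0 i ζ) p), abs_of_pos (inv_pos.2 hM0)]
      have e1 := mul_le_mul h3 h1 (abs_nonneg _) hκ0.le
      have e2 : M⁻¹ * (|toL2 (pd s 0 i ζ) p| * |toL2 (z n) p|) ≤
          M⁻¹ * (|toL2 (pd s 0 i ζ) p| * (κ ^ n * |toL2 g p|)) := by gcongr
      refine (add_le_add e1 e2).trans_eq ?_
      rw [abs_mul]
      push_cast
      field_simp
      ring
  have hv : ∀ i, toL2 (mul (s - 1) 1 0 (pd s (s - 1) i ζ) g) =ᵐ[volume]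
      fun p => toL2 (pd s 0 i ζ) p * toL2 g p := by
    intro i
    rw [← toL2_pd_congr (α := s) (β := s - 1) (by linarith) (by linarith) le_rfl (by linarith) i
      (rfl : toL2 ζ = toL2 ζ)]
    exact toL2_mul hc' _ _
  have hn1 : ∀ n, ‖toL2 (z n)‖ ≤ κ ^ n * ‖toL2 g‖ := by
    intro n
    have := norm_le_of_ae_le_add (toL2 (z n)) (toL2 g) 0 (a := κ ^ n) (b := 0) (by positivity)
      le_rfl (by filter_upwards [hz1 n] with p hp; simpa using hp)
    simpa using this
  have hn2 : ∀ i n, ‖toL2 (pd 1 0 i (z n))‖ ≤ κ ^ n * ‖toL2 (pd 1 0 i g)‖ +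
      (n * κ ^ n * (κ * M)⁻¹) * ‖toL2 (mul (s - 1) 1 0 (pd s (s - 1) i ζ) g)‖ := by
    intro i n
    refine norm_le_of_ae_le_add _ _ _ (by positivity) (by positivity) ?_
    filter_upwards [hz2 i n, hv i] with p h1 h2
    rwa [h2]
  have hs1 : Summable fun n : ℕ => κ ^ n := summable_geometric_of_lt_one hκ0.le hκ1
  have hs2 : Summable fun n : ℕ => (n : ℝ) * κ ^ n := by
    simpa using summable_pow_mul_geometric_of_norm_lt_one 1
      (show ‖κ‖ < 1 by rwa [Real.norm_of_nonneg hκ0.le])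
  have hsum : Summable z := by
    refine Summable.of_norm_bounded (g := fun n => κ ^ n * ‖toL2 g‖ + ∑ i,
      (κ ^ n * ‖toL2 (pd 1 0 i g)‖ +
        (n * κ ^ n * (κ * M)⁻¹) * ‖toL2 (mul (s - 1) 1 0 (pd s (s - 1) i ζ) g)‖)) ?_ fun n =>
      (norm_le_norm_toL2_add _).trans
        (add_le_add (hn1 n) (Finset.sum_le_sum fun i _ => hn2 i n))
    exact (hs1.mul_right _).add (summable_sum fun i _ => (hs1.mul_right _).add
      ((hs2.mul_right _).mul_right _))
  set S := ∑' n, z n with hS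
  have hS1 : S = g + Θ S := by
    have e : Θ S = ∑' n, z (n + 1) := by
      rw [hS, Θ.map_tsum hsum]
      simp only [hzs]
    rw [e, hS, hsum.tsum_eq_zero_add]
    rfl
  -- S = g + ΘS says that M⁻¹(1 + ζ)S = g.
  set Y := M⁻¹ • S with hY
  have hY1 : Y + mul s 1 1 ζ Y = g := by
    have : S = g + (S - M⁻¹ • (S + mul s 1 1 ζ S)) := hS1
    rw [hY, map_smul, ← smul_add]
    rw [add_sub_assoc', eq_sub_iff_add_eq, add_comm, add_right_cancel_iff] at this
    exact this
  have hpos : ∀ᵐ p, 0 < 1 + toL2 ζ p := hζ.mono fun p hp => h0.trans_le hp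
  have hY2 : toL2 Y =ᵐ[volume] fun p => toL2 g p / (1 + toL2 ζ p) := by
    rw [← hY1, map_add]
    filter_upwards [Lp.coeFn_add (toL2 Y) (toL2 (mul s 1 1 ζ Y)), toL2_mul hc ζ Y, hpos]
      with p h1 h2 h3
    rw [h1, Pi.add_apply, h2]
    field_simp
  refine ⟨Y, hY2, fun i => ?_⟩
  have hd : toL2 (pd 1 0 i g) =ᵐ[volume] fun p => (1 + toL2 ζ p) * toL2 (pd 1 0 i Y) p +
      toL2 (pd s 0 i ζ) p * toL2 Y p := by
    rw [← hY1, map_add, map_add]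
    filter_upwards [Lp.coeFn_add (toL2 (pd 1 0 i Y)) (toL2 (pd 1 0 i (mul s 1 1 ζ Y))),
      pd_mul hc le_rfl i ζ Y] with p h1 h2
    rw [h1, Pi.add_apply, h2]
    ring
  filter_upwards [hd, hY2, hpos] with p h1 h2 h3
  rw [h1, h2]
  field_simp
  ring

theorem integral_eq_zero_of_hasLineDerivAt {φ ψ : EuclideanSpace ℝ (Fin d) → ℝ}
    {v : EuclideanSpace ℝ (Fin d)} (hφ : Integrable φ) (hψ : Integrable ψ)
    (h : ∀ x, HasLineDerivAt ℝ φ (ψ x) x v) : ∫ x, ψ x = 0 := by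
  have h := integral_bilinear_hasLineDerivAt_right_eq_neg_left_of_integrable
    (μ := (volume : Measure (EuclideanSpace ℝ (Fin d)))) (B := ContinuousLinearMap.mul ℝ ℝ)
    (f := fun _ => (1 : ℝ)) (f' := fun _ => 0) (g := φ) (g' := ψ) (v := v) (by simp)
    (by simpa using hψ) (by simpa using hφ)
    (fun x _ => by simp [HasLineDerivAt, hasDerivAt_const]) (fun x _ => h x)
  simpa using h

/-- Needed because h and η are a constant plus an L² function: the constant must drop out of weak
derivatives. On the torus, integrate by parts against the test function 1. -/
theorem integral_partialD_eq_zero {φ : Pt D d → ℝ} (hφ : IsTest φ) (i : Fin d) :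
    ∫ x, partialD i φ x = 0 := by
  cases D with
  | torus =>
    have : CompactSpace (Pt .torus d) := inferInstanceAs (CompactSpace (UnitAddTorus (Fin d)))
    have h1 : IsTest (fun _ : Pt .torus d => (1 : ℝ)) :=
      ⟨contDiff_const, HasCompactSupport.of_compactSpace _⟩
    obtain ⟨x, hx⟩ := hφ.exists_sob (σ := 1) zero_le_one
    obtain ⟨y, hy⟩ := h1.exists_sob (σ := 1) zero_le_one
    have e := integral_pd_mul le_rfl le_rfl i x y
    have hx' := hφ.toL2_pd le_rfl (by norm_num) i hx
    have hy' := h1.toL2_pd le_rfl (by norm_num) i hy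
    have e1 : ∫ z, toL2 (pd 1 0 i x) z * toL2 y z = ∫ z, partialD i φ z := by
      refine integral_congr_ae ?_
      filter_upwards [hx', hy] with z a b
      rw [a, ← b, mul_one]
    have e2 : ∫ z, toL2 x z * toL2 (pd 1 0 i y) z = 0 := by
      refine integral_eq_zero_of_ae ?_
      filter_upwards [hy'] with z a
      rw [a]
      simp [partialD]
    rw [← e1, e, e2, neg_zero]
  | line =>
    refine integral_eq_zero_of_hasLineDerivAt (v := EuclideanSpace.single i 1)
      (memLp_one_iff_integrable.1 (hφ.memLp 1))
      (memLp_one_iff_integrable.1 ((hφ.partialD i).memLp 1)) fun x => ?_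
    have h := hφ.hasDerivAt i x 0
    rw [show EuclideanSpace.single i (0 : ℝ) = (0 : EuclideanSpace ℝ (Fin d)) by simp, add_zero,
      ← hφ.partialD_proj i x] at h
    have e : (fun τ : ℝ => x + EuclideanSpace.single i τ)
        = fun τ : ℝ => x + τ • EuclideanSpace.single i (1 : ℝ) := by
      funext τ; rw [single_eq_smul]
    have h' : HasDerivAt (fun τ : ℝ => (show EuclideanSpace ℝ (Fin d) → ℝ from φ)
      ((fun τ : ℝ => x + EuclideanSpace.single i τ) τ)) (partialD i φ (proj .line d x)) 0 := h
    rw [e] at h'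
    exact h'

/-! ### Curves in Sobolev spaces -/

variable {D : Geometry} {d : ℕ}

/-- The interval is convex with nonempty interior, so time derivatives are unique even at the
endpoint 0. -/
theorem uniqueDiffOn_timeInterval {T : EReal} (hT : 0 < T) : UniqueDiffOn ℝ (timeInterval T) := by
  have hc : Convex ℝ (timeInterval T) := by
    refine Set.OrdConnected.convex ⟨fun x hx y hy z hz => ⟨hx.1.trans hz.1, ?_⟩⟩
    exact lt_of_le_of_lt (EReal.coe_le_coe_iff.2 hz.2) hy.2
  obtain ⟨r, hr0, hrT⟩ := EReal.lt_iff_exists_real_btwn.1 hT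
  have hr : 0 < r := by exact_mod_cast hr0
  refine uniqueDiffOn_convex hc ⟨r / 2, mem_interior.2 ⟨Set.Ioo 0 r, fun x hx => ⟨hx.1.le, ?_⟩,
    isOpen_Ioo, by constructor <;> linarith⟩⟩
  exact (EReal.coe_lt_coe_iff.2 hx.2).trans hrT

section Abstract

variable {E F : Type*} [NormedAddCommGroup E] [NormedSpace ℝ E] [NormedAddCommGroup F]
  [NormedSpace ℝ F]

/-- Difference quotients of the image lie in the range of L, which is closed by completeness; their
limit therefore comes from E. -/
theorem LinearIsometry.exists_hasDerivWithinAt [CompleteSpace E] (L : E →ₗᵢ[ℝ] F) {a : ℝ → E}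
    {g : F} {I : Set ℝ} {t : ℝ} (hU : UniqueDiffWithinAt ℝ I t)
    (h : HasDerivWithinAt (fun τ => L (a τ)) g I t) :
    ∃ y, L y = g ∧ HasDerivWithinAt a y I t := by
  have hs : slope (fun τ => L (a τ)) t = fun τ => L (slope a t τ) := by
    funext τ
    simp [slope_def_module]
  rw [hasDerivWithinAt_iff_tendsto_slope, hs] at h
  have : (𝓝[I \ {t}] t).NeBot := by
    rw [← accPt_principal_iff_nhdsWithin]
    exact hU.accPt
  have hcl : IsClosed (Set.range L) := L.isometry.isClosedEmbedding.isClosed_range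
  obtain ⟨y, hy⟩ := hcl.mem_of_tendsto h (Eventually.of_forall fun τ => ⟨_, rfl⟩)
  refine ⟨y, hy, ?_⟩
  rw [hasDerivWithinAt_iff_tendsto_slope]
  rw [← hy] at h
  exact L.isometry.isEmbedding.tendsto_nhds_iff.2 h

theorem LinearIsometry.exists_deriv_curve [CompleteSpace E] (L : E →ₗᵢ[ℝ] F) {a : ℝ → E}
    {I : Set ℝ} (hI : UniqueDiffOn ℝ I) {n : ℕ}
    (h : ContDiffOn ℝ (n + 1 : ℕ) (fun t => L (a t)) I) :
    ∃ b : ℝ → E, (∀ t ∈ I, HasDerivWithinAt a (b t) I t) ∧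
      ContDiffOn ℝ n (fun t => L (b t)) I := by
  classical
  push_cast at h
  rw [contDiffOn_succ_iff_derivWithin hI] at h
  have key : ∀ t, ∃ y, t ∈ I → L y = derivWithin (fun t => L (a t)) I t ∧
      HasDerivWithinAt a y I t := fun t => by
    by_cases ht : t ∈ I
    · obtain ⟨y, hy⟩ := LinearIsometry.exists_hasDerivWithinAt L (hI t ht)
        (h.1 t ht).hasDerivWithinAt
      exact ⟨y, fun _ => hy⟩
    · exact ⟨0, fun h => absurd h ht⟩
  choose b hb using key
  exact ⟨b, fun t ht => (hb t ht).2, h.2.2.congr fun t ht => (hb t ht).1⟩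

variable {E' F' G : Type*} [NormedAddCommGroup E'] [NormedSpace ℝ E'] [NormedAddCommGroup F']
  [NormedSpace ℝ F'] [NormedAddCommGroup G] [NormedSpace ℝ G]

/-- The product rule for a bilinear map that is continuous in two different pairs of norms. -/
theorem hasDerivWithinAt_bilinear_mixed (B₁ : E' →L[ℝ] F →L[ℝ] G) (B₂ : E →L[ℝ] F' →L[ℝ] G)
    {j : E → E'} {k : F → F'} {x : ℝ → E} {y : ℝ → F}
    (hB : ∀ x y, B₁ (j x) y = B₂ x (k y)) {I : Set ℝ} {t : ℝ} {x' : E'} {y' : F'}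
    (hx : HasDerivWithinAt (fun τ => j (x τ)) x' I t)
    (hy : HasDerivWithinAt (fun τ => k (y τ)) y' I t) (hyc : ContinuousWithinAt y I t) :
    HasDerivWithinAt (fun τ => B₁ (j (x τ)) (y τ)) (B₁ x' (y t) + B₂ (x t) y') I t := by
  rw [hasDerivWithinAt_iff_tendsto_slope] at *
  -- Increment of x against the current y, plus x at time t against the increment of y.
  -- Compatibility of the two bilinear maps lets each increment be measured in its weak norm; of y
  -- in the strong norm only continuity is used.
  have hs : slope (fun τ => B₁ (j (x τ)) (y τ)) t = fun τ =>
      B₁ (slope (fun τ => j (x τ)) t τ) (y τ) + B₂ (x t) (slope (fun τ => k (y τ)) t τ) := by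
    funext τ
    simp only [slope_def_module, map_smul, map_sub, smul_apply,
      sub_apply, ← smul_add]
    rw [← hB, ← hB]
    abel_nf
  rw [hs]
  have hyc' : Tendsto y (𝓝[I \ {t}] t) (𝓝 (y t)) := hyc.mono Set.sdiff_subset
  refine Tendsto.add ?_ (((B₂ (x t)).continuous.tendsto y').comp hy)
  exact (B₁.continuous₂.tendsto (x', y t)).comp (hx.prodMk_nhds hyc')

end Abstract

theorem CnH.exists_curve {n : ℕ} {σ : ℝ} (hσ : 0 ≤ σ) {I : Set ℝ} {f : ℝ → Pt D d → ℝ}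
    (h : CnH n σ I f) : ∃ a : ℝ → Sob D d σ, (∀ t ∈ I, f t =ᵐ[volume] toL2 (a t)) ∧
      ContDiffOn ℝ n (fun t => fou (a t)) I := by
  classical
  obtain ⟨G, hG, hf⟩ := h
  have key : ∀ t, ∃ x : Sob D d σ, t ∈ I → f t =ᵐ[volume] toL2 x ∧ fou x = G t := fun t => by
    by_cases ht : t ∈ I
    · obtain ⟨x, hx⟩ := exists_sob_of_memLp hσ (hf t ht).1 (G t) (hf t ht).2
      exact ⟨x, fun _ => hx⟩
    · exact ⟨0, fun h => absurd h ht⟩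
  choose a ha using key
  exact ⟨a, fun t ht => (ha t ht).1, hG.congr fun t ht => (ha t ht).2⟩

theorem CnH_zero_of_continuousOn {σ : ℝ} (hσ : 0 ≤ σ) {I : Set ℝ} {f : ℝ → Pt D d → ℝ}
    {a : ℝ → Sob D d σ} (ha : ContinuousOn a I) (hf : ∀ t ∈ I, f t =ᵐ[volume] toL2 (a t)) :
    CnH 0 σ I f := by
  refine ⟨fun t => fou (a t), ?_, fun t ht => ⟨?_, ?_⟩⟩
  · rw [Nat.cast_zero, contDiffOn_zero]
    exact fou.continuous.comp_continuousOn ha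
  · exact (memLp_congr_ae (hf t ht)).2 (Lp.memLp _)
  · exact fou_eq_sobolevFourier hσ _ (hf t ht)

theorem continuousOn_of_fou {σ : ℝ} {I : Set ℝ} {a : ℝ → Sob D d σ}
    (h : ContinuousOn (fun t => fou (a t)) I) : ContinuousOn a I :=
  fou.isometry.isEmbedding.isInducing.continuousOn_iff.2 h

/-- A curve of class `C⁰(H^σ) ∩ C¹(H^ρ)` and its derivative. -/
structure IsC1Curve (σ ρ : ℝ) (I : Set ℝ) (p : ℝ → Sob D d σ) (q : ℝ → Sob D d ρ) : Prop where
  cont₀ : ContinuousOn p I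
  cont₁ : ContinuousOn q I
  deriv : ∀ t ∈ I, HasDerivWithinAt (fun τ => incl σ ρ (p τ)) (q t) I t

/-- A curve of class `C⁰(H^s) ∩ C¹(H^{s-1}) ∩ C²(H^{s-2})` and its two derivatives. -/
structure IsC2Curve (s : ℝ) (I : Set ℝ) (a : ℝ → Sob D d s) (b : ℝ → Sob D d (s - 1))
    (c : ℝ → Sob D d (s - 2)) : Prop where
  fst : IsC1Curve s (s - 1) I a b
  snd : IsC1Curve (s - 1) (s - 2) I b c

/-- The three regularity hypotheses provide three unrelated curves. Injectivity of `toL2` matches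
the curves, and uniqueness of derivatives matches their first derivatives. -/
theorem Regular.exists_curve {s : ℝ} (hs : 2 ≤ s) {I : Set ℝ} (hI : UniqueDiffOn ℝ I)
    {f : ℝ → Pt D d → ℝ} (h : Regular s I f) :
    ∃ a b c, IsC2Curve s I a b c ∧ ∀ t ∈ I, f t =ᵐ[volume] toL2 (a t) := by
  obtain ⟨h2, h1, h0⟩ := h
  obtain ⟨a2, e2, c2⟩ := h2.exists_curve (by linarith)
  obtain ⟨a1, e1, c1⟩ := h1.exists_curve (by linarith)
  obtain ⟨a, e0, c0⟩ := h0.exists_curve (by linarith)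
  have i1 : ∀ t ∈ I, incl s (s - 1) (a t) = a1 t := fun t ht =>
    toL2_injective (by linarith) (by
      rw [toL2_incl (by linarith) (by linarith)]
      exact Lp.ext ((e0 t ht).symm.trans (e1 t ht)))
  have i2 : ∀ t ∈ I, incl (s - 1) (s - 2) (a1 t) = a2 t := fun t ht =>
    toL2_injective (by linarith) (by
      rw [toL2_incl (by linarith) (by linarith)]
      exact Lp.ext ((e1 t ht).symm.trans (e2 t ht)))
  obtain ⟨b, hb, cb⟩ := LinearIsometry.exists_deriv_curve fou hI (n := 0) c1
  obtain ⟨b2, hb2, cb2⟩ := LinearIsometry.exists_deriv_curve fou hI (n := 1) c2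
  obtain ⟨c, hc, cc⟩ := LinearIsometry.exists_deriv_curve fou hI (n := 0) cb2
  have i3 : ∀ t ∈ I, incl (s - 1) (s - 2) (b t) = b2 t := fun t ht => by
    have h3 := (incl (s - 1) (s - 2)).hasFDerivAt.comp_hasDerivWithinAt t (hb t ht)
    exact (hI t ht).eq_deriv _ h3 ((hb2 t ht).congr i2 (i2 t ht))
  refine ⟨a, b, c, ⟨⟨continuousOn_of_fou c0.continuousOn, continuousOn_of_fou cb.continuousOn,
    fun t ht => (hb t ht).congr i1 (i1 t ht)⟩, continuousOn_of_fou cb.continuousOn,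
    continuousOn_of_fou cc.continuousOn, fun t ht => (hc t ht).congr i3 (i3 t ht)⟩, e0⟩

/-! ### Weak derivatives identified with derivatives of curves -/

section Identification

variable {I : Set ℝ} {t : ℝ}

theorem integral_toLp_mul {φ : Pt D d → ℝ} (hφ : IsTest φ) (y : XR D d) :
    ∫ x, y x * φ x = inner ℝ ((hφ.memLp 2).toLp φ) y := by
  rw [← integral_mul_eq_inner]
  refine integral_congr_ae ?_
  filter_upwards [(hφ.memLp 2).coeFn_toLp] with x hx
  rw [hx]

theorem integral_const_add_mul {f : Pt D d → ℝ} {κ : ℝ} {y : XR D d}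
    (hf : f =ᵐ[volume] fun x => κ + y x) {φ : Pt D d → ℝ} (hφ : IsTest φ) :
    ∫ x, f x * φ x = κ * (∫ x, φ x) + ∫ x, y x * φ x := by
  have i1 : Integrable φ := memLp_one_iff_integrable.1 (hφ.memLp 1)
  have i2 : Integrable fun x => y x * φ x := (Lp.memLp y).integrable_mul (hφ.memLp 2)
  rw [← integral_const_mul, ← integral_add (i1.const_mul κ) i2]
  refine integral_congr_ae ?_
  filter_upwards [hf] with x hx
  rw [hx]; ring

theorem locallyIntegrable_const_add {f : Pt D d → ℝ} {κ : ℝ} {y : XR D d}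
    (hf : f =ᵐ[volume] fun x => κ + y x) : LocallyIntegrable f volume :=
  ((locallyIntegrable_const κ).add ((Lp.memLp y).locallyIntegrable (by norm_num))).congr hf.symm

theorem locallyIntegrable_lp (y : XR D d) : LocallyIntegrable y volume :=
  (Lp.memLp y).locallyIntegrable (by norm_num)

/-- The constant κ, equal to 1 for h and η, contributes a time-independent term to every tested
integral. -/
theorem hasTimeDerivAt_of_curve {f : ℝ → Pt D d → ℝ} {κ : ℝ} {y : ℝ → XR D d}
    (hf : ∀ τ ∈ I, f τ =ᵐ[volume] fun x => κ + y τ x) {g : XR D d} (ht : t ∈ I)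
    (h : HasDerivWithinAt y g I t) : HasTimeDerivAt I f t g := by
  refine ⟨fun τ hτ => locallyIntegrable_const_add (hf τ hτ), locallyIntegrable_lp g,
    fun φ hφ => ?_⟩
  have h1 : HasDerivWithinAt (fun τ => κ * (∫ x, φ x) + inner ℝ ((hφ.memLp 2).toLp φ) (y τ))
      (inner ℝ ((hφ.memLp 2).toLp φ) g) I t :=
    (((innerSL ℝ ((hφ.memLp 2).toLp φ)).hasFDerivAt.comp_hasDerivWithinAt t h)).const_add _
  rw [integral_toLp_mul hφ]
  have e : ∀ τ ∈ I, ∫ x, f τ x * φ x = κ * (∫ x, φ x) + inner ℝ ((hφ.memLp 2).toLp φ) (y τ) :=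
    fun τ hτ => by rw [integral_const_add_mul (hf τ hτ) hφ, integral_toLp_mul hφ]
  exact h1.congr e (e t ht)

theorem ae_eq_of_integral_test {f g : Pt D d → ℝ} (hf : LocallyIntegrable f volume)
    (hg : LocallyIntegrable g volume)
    (h : ∀ φ, IsTest φ → ∫ x, f x * φ x = ∫ x, g x * φ x) : f =ᵐ[volume] g := by
  have hz : (fun x => f x - g x) =ᵐ[volume] 0 := by
    refine ae_eq_zero_of_integral_test_mul (hf.sub hg) fun φ hφ => ?_
    have key : ∀ {k : Pt D d → ℝ}, LocallyIntegrable k volume → Integrable fun x => k x * φ x :=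
      fun hk => by
        have := hk.integrable_smul_left_of_hasCompactSupport hφ.continuous hφ.2
        refine this.congr (Eventually.of_forall fun x => ?_)
        simp [mul_comm]
    simp only [sub_mul]
    rw [integral_sub (key hf) (key hg), h φ hφ, sub_self]
  filter_upwards [hz] with x hx
  exact sub_eq_zero.1 hx

theorem HasTimeDerivAt.ae_eq {f : ℝ → Pt D d → ℝ} {g g' : Pt D d → ℝ}
    (hU : UniqueDiffWithinAt ℝ I t) (h : HasTimeDerivAt I f t g) (h' : HasTimeDerivAt I f t g') :
    g =ᵐ[volume] g' :=
  ae_eq_of_integral_test h.2.1 h'.2.1 fun φ hφ => hU.eq_deriv _ (h.2.2 φ hφ) (h'.2.2 φ hφ)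

theorem HasTimeDerivAt.dt_ae {f : ℝ → Pt D d → ℝ} {g : Pt D d → ℝ}
    (hU : UniqueDiffWithinAt ℝ I t) (h : HasTimeDerivAt I f t g) : dt I f t =ᵐ[volume] g := by
  have hex : ∃ g, HasTimeDerivAt I f t g := ⟨g, h⟩
  rw [dt, dif_pos hex]
  exact hex.choose_spec.ae_eq hU h

theorem HasWeakDeriv.wd_ae {i : Fin d} {f g : Pt D d → ℝ} (h : HasWeakDeriv i f g) :
    wd i f =ᵐ[volume] g := by
  have hex : ∃ g, HasWeakDeriv i f g := ⟨g, h⟩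
  rw [wd, dif_pos hex]
  refine ae_eq_of_integral_test hex.choose_spec.2.1 h.2.1 fun φ hφ => ?_
  have h1 := hex.choose_spec.2.2 φ hφ
  rw [h.2.2 φ hφ] at h1
  linarith

theorem hasWeakDeriv_of_sob {f : Pt D d → ℝ} {κ α β : ℝ} {x : Sob D d α} (hβ : 0 ≤ β)
    (h : β + 1 ≤ α) (hf : f =ᵐ[volume] fun p => κ + toL2 x p) (i : Fin d) :
    HasWeakDeriv i f (toL2 (pd α β i x)) := by
  refine ⟨locallyIntegrable_const_add hf, locallyIntegrable_lp _, fun φ hφ => ?_⟩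
  rw [integral_const_add_mul hf (hφ.partialD i), integral_partialD_eq_zero hφ, mul_zero, zero_add,
    integral_pd_test hβ h i x hφ]

end Identification

/-! ### Calculus of differentiable curves -/

variable {D : Geometry} {d : ℕ}

theorem IsC1Curve.hasDerivWithinAt_toL2 {σ ρ : ℝ} (hρ : 0 ≤ ρ) (h : ρ ≤ σ) {I : Set ℝ}
    {p : ℝ → Sob D d σ} {q : ℝ → Sob D d ρ} (hp : IsC1Curve σ ρ I p q) {t : ℝ} (ht : t ∈ I) :
    HasDerivWithinAt (fun τ => toL2 (p τ)) (toL2 (q t)) I t := by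
  have h1 := (toL2 (D := D) (d := d) (σ := ρ)).hasFDerivAt.comp_hasDerivWithinAt t (hp.deriv t ht)
  simpa only [Function.comp_def, toL2_incl hρ h] using h1

theorem IsC1Curve.hasTimeDerivAt {σ ρ : ℝ} (hρ : 0 ≤ ρ) (h : ρ ≤ σ) {I : Set ℝ}
    {p : ℝ → Sob D d σ} {q : ℝ → Sob D d ρ} (hp : IsC1Curve σ ρ I p q) {f : ℝ → Pt D d → ℝ}
    {κ : ℝ} (hf : ∀ τ ∈ I, f τ =ᵐ[volume] fun x => κ + toL2 (p τ) x) {t : ℝ} (ht : t ∈ I) :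
    HasTimeDerivAt I f t (toL2 (q t)) :=
  hasTimeDerivAt_of_curve hf ht (hp.hasDerivWithinAt_toL2 hρ h ht)

theorem IsC1Curve.dt_ae {σ ρ : ℝ} (hρ : 0 ≤ ρ) (h : ρ ≤ σ) {I : Set ℝ} (hI : UniqueDiffOn ℝ I)
    {p : ℝ → Sob D d σ} {q : ℝ → Sob D d ρ} (hp : IsC1Curve σ ρ I p q) {f : ℝ → Pt D d → ℝ}
    {κ : ℝ} (hf : ∀ τ ∈ I, f τ =ᵐ[volume] fun x => κ + toL2 (p τ) x) {t : ℝ} (ht : t ∈ I) :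
    dt I f t =ᵐ[volume] toL2 (q t) :=
  (hp.hasTimeDerivAt hρ h hf ht).dt_ae (hI t ht)

theorem IsC1Curve.matDifferentiable {σ ρ : ℝ} (hσ : 1 ≤ σ) (hρ : 0 ≤ ρ) (h : ρ ≤ σ) {I : Set ℝ}
    {p : ℝ → Sob D d σ} {q : ℝ → Sob D d ρ} (hp : IsC1Curve σ ρ I p q) {f : ℝ → Pt D d → ℝ}
    {κ : ℝ} (hf : ∀ τ ∈ I, f τ =ᵐ[volume] fun x => κ + toL2 (p τ) x) : MatDifferentiable I f :=
  fun t ht => ⟨⟨_, hp.hasTimeDerivAt hρ h hf ht⟩, fun i =>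
    ⟨_, hasWeakDeriv_of_sob le_rfl (by linarith) (hf t ht) i⟩⟩

theorem IsC1Curve.matD_ae {σ ρ : ℝ} (hσ : 1 ≤ σ) (hρ : 0 ≤ ρ) (h : ρ ≤ σ) {I : Set ℝ}
    (hI : UniqueDiffOn ℝ I) {p : ℝ → Sob D d σ} {q : ℝ → Sob D d ρ} (hp : IsC1Curve σ ρ I p q)
    {f : ℝ → Pt D d → ℝ} {κ : ℝ} (hf : ∀ τ ∈ I, f τ =ᵐ[volume] fun x => κ + toL2 (p τ) x)
    (u : Fin d → ℝ → Pt D d → ℝ) {t : ℝ} (ht : t ∈ I) :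
    matD I u f t =ᵐ[volume] fun x => toL2 (q t) x + ∑ i, u i t x * toL2 (pd σ 0 i (p t)) x := by
  have hw := fun i => (hasWeakDeriv_of_sob le_rfl (by linarith) (hf t ht) i).wd_ae
  filter_upwards [hp.dt_ae hρ h hI hf ht, ae_all_iff.2 hw] with x h1 h2
  rw [matD, h1]
  simp only [h2]

theorem toL2_mul_congr {α β γ α' β' γ' : ℝ} (h : MulCond d α β γ) (h' : MulCond d α' β' γ')
    {x : Sob D d α} {x' : Sob D d α'} {y : Sob D d β} {y' : Sob D d β'} (hx : toL2 x = toL2 x')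
    (hy : toL2 y = toL2 y') : toL2 (mul α β γ x y) = toL2 (mul α' β' γ' x' y') := by
  apply Lp.ext
  filter_upwards [toL2_mul h x y, toL2_mul h' x' y'] with p h1 h2
  rw [h1, h2, hx, hy]

theorem IsC1Curve.add {σ ρ : ℝ} {I : Set ℝ} {p p' : ℝ → Sob D d σ} {q q' : ℝ → Sob D d ρ}
    (h : IsC1Curve σ ρ I p q) (h' : IsC1Curve σ ρ I p' q') :
    IsC1Curve σ ρ I (fun t => p t + p' t) (fun t => q t + q' t) :=
  ⟨h.cont₀.add h'.cont₀, h.cont₁.add h'.cont₁, fun t ht => by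
    simpa only [map_add] using (h.deriv t ht).fun_add (h'.deriv t ht)⟩

theorem IsC1Curve.sub {σ ρ : ℝ} {I : Set ℝ} {p p' : ℝ → Sob D d σ} {q q' : ℝ → Sob D d ρ}
    (h : IsC1Curve σ ρ I p q) (h' : IsC1Curve σ ρ I p' q') :
    IsC1Curve σ ρ I (fun t => p t - p' t) (fun t => q t - q' t) :=
  ⟨h.cont₀.sub h'.cont₀, h.cont₁.sub h'.cont₁, fun t ht => by
    simpa only [map_sub] using (h.deriv t ht).fun_sub (h'.deriv t ht)⟩

theorem IsC1Curve.sum {σ ρ : ℝ} {I : Set ℝ} {ι : Type*} {S : Finset ι} {p : ι → ℝ → Sob D d σ}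
    {q : ι → ℝ → Sob D d ρ} (h : ∀ i ∈ S, IsC1Curve σ ρ I (p i) (q i)) :
    IsC1Curve σ ρ I (fun t => ∑ i ∈ S, p i t) (fun t => ∑ i ∈ S, q i t) :=
  ⟨continuousOn_finsetSum _ fun i hi => (h i hi).cont₀,
    continuousOn_finsetSum _ fun i hi => (h i hi).cont₁, fun t ht => by
    simpa only [map_sum] using HasDerivWithinAt.fun_sum fun i hi => (h i hi).deriv t ht⟩

theorem IsC1Curve.pd {σ ρ : ℝ} {I : Set ℝ} {p : ℝ → Sob D d σ} {q : ℝ → Sob D d ρ} (hρ : 1 ≤ ρ)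
    (hσ : ρ ≤ σ) (h : IsC1Curve σ ρ I p q) (i : Fin d) :
    IsC1Curve (σ - 1) (ρ - 1) I (fun t => pd σ (σ - 1) i (p t))
      (fun t => FavrieGavrilyuk.pd ρ (ρ - 1) i (q t)) := by
  refine ⟨(FavrieGavrilyuk.pd _ _ i).continuous.comp_continuousOn h.cont₀,
    (FavrieGavrilyuk.pd _ _ i).continuous.comp_continuousOn h.cont₁, fun t ht => ?_⟩
  have h1 := (FavrieGavrilyuk.pd ρ (ρ - 1) i).hasFDerivAt.comp_hasDerivWithinAt t (h.deriv t ht)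
  refine h1.congr (fun τ _ => ?_) ?_ <;>
  · refine toL2_injective (by linarith) ?_
    rw [toL2_incl (by linarith) (by linarith)]
    exact toL2_pd_congr (by linarith) (by linarith) (by linarith) (by linarith) i
      (toL2_incl (by linarith) hσ _).symm

/-- The product rule for curves of functions. -/
theorem IsC1Curve.mul {α α' β β' γ γ' : ℝ} {I : Set ℝ} {p : ℝ → Sob D d α} {p' : ℝ → Sob D d α'}
    {q : ℝ → Sob D d β} {q' : ℝ → Sob D d β'} (hp : IsC1Curve α α' I p p')
    (hq : IsC1Curve β β' I q q') (h : MulCond d α β γ) (h₁ : MulCond d α' β γ')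
    (h₂ : MulCond d α β' γ') (hα : α' ≤ α) (hβ : β' ≤ β) (hγ : γ' ≤ γ) :
    IsC1Curve γ γ' I (fun t => mul α β γ (p t) (q t))
      (fun t => FavrieGavrilyuk.mul α' β γ' (p' t) (q t) +
        FavrieGavrilyuk.mul α β' γ' (p t) (q' t)) := by
  refine ⟨?_, ?_, fun t ht => ?_⟩
  · exact (FavrieGavrilyuk.mul α β γ).continuous₂.comp_continuousOn (hp.cont₀.prodMk hq.cont₀)
  · exact ((FavrieGavrilyuk.mul α' β γ').continuous₂.comp_continuousOn
      (hp.cont₁.prodMk hq.cont₀)).add ((FavrieGavrilyuk.mul α β' γ').continuous₂.comp_continuousOn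
      (hp.cont₀.prodMk hq.cont₁))
  · have e1 := hasDerivWithinAt_bilinear_mixed (FavrieGavrilyuk.mul α' β γ')
      (FavrieGavrilyuk.mul α β' γ') (j := incl α α') (k := incl β β') (x := p) (y := q)
      (fun x y => toL2_injective h₁.nonneg (toL2_mul_congr h₁ h₂
        (toL2_incl (h₁.nonneg.trans h₁.le_left) hα x)
        (toL2_incl (h₂.nonneg.trans h₂.le_right) hβ y).symm))
      (hp.deriv t ht) (hq.deriv t ht) (hq.cont₀ t ht)
    refine e1.congr (fun τ _ => ?_) ?_ <;>
    · refine toL2_injective h₁.nonneg ?_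
      rw [toL2_incl h₁.nonneg hγ]
      exact toL2_mul_congr h h₁ (toL2_incl (h₁.nonneg.trans h₁.le_left) hα _).symm rfl

/-! ### Material derivatives of order one and two -/

section Material

variable {s : ℝ}

theorem mulCond_zero_one (hsd : (d : ℝ) / 2 < s) (hs : 2 ≤ s) : MulCond d s (s - 1) (s - 1) :=
  ⟨by linarith, by linarith, le_rfl, by linarith⟩

theorem mulCond_one_one (hsd : (d : ℝ) / 2 < s) (hs : 2 ≤ s) :
    MulCond d (s - 1) (s - 1) (s - 2) :=
  ⟨by linarith, by linarith, by linarith, by linarith⟩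

theorem mulCond_zero_two (hsd : (d : ℝ) / 2 < s) (hs : 2 ≤ s) : MulCond d s (s - 2) (s - 2) :=
  ⟨by linarith, by linarith, le_rfl, by linarith⟩

/-- The first material derivative of a function, in terms of its derivative `b` in time. -/
noncomputable def matOne (u : Fin d → Sob D d s) (a : Sob D d s) (b : Sob D d (s - 1)) :
    Sob D d (s - 1) :=
  b + ∑ i, mul s (s - 1) (s - 1) (u i) (pd s (s - 1) i a)

/-- The derivative in time of the first material derivative. -/
noncomputable def matOneDeriv (u : Fin d → Sob D d s) (u' : Fin d → Sob D d (s - 1))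
    (a : Sob D d s) (b : Sob D d (s - 1)) (c : Sob D d (s - 2)) : Sob D d (s - 2) :=
  c + ∑ i, (mul (s - 1) (s - 1) (s - 2) (u' i) (pd s (s - 1) i a) +
    mul s (s - 2) (s - 2) (u i) (pd (s - 1) (s - 2) i b))

/-- The second material derivative. -/
noncomputable def matTwo (u : Fin d → Sob D d s) (u' : Fin d → Sob D d (s - 1))
    (a : Sob D d s) (b : Sob D d (s - 1)) (c : Sob D d (s - 2)) : Sob D d (s - 2) :=
  matOneDeriv u u' a b c +
    ∑ i, mul s (s - 2) (s - 2) (u i) (pd (s - 1) (s - 2) i (matOne u a b))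

/-- Linearity is what makes η̈ - ḧ a quantity controlled by η - h and its time derivatives. -/
theorem matTwo_sub (u : Fin d → Sob D d s) (u' : Fin d → Sob D d (s - 1)) (a a' : Sob D d s)
    (b b' : Sob D d (s - 1)) (c c' : Sob D d (s - 2)) :
    matTwo u u' (a - a') (b - b') (c - c') = matTwo u u' a b c - matTwo u u' a' b' c' := by
  simp only [matTwo, matOneDeriv, matOne, map_sub, map_add, Finset.sum_add_distrib,
    Finset.sum_sub_distrib, map_sum]
  abel

variable {I : Set ℝ} {u : Fin d → ℝ → Sob D d s} {u' : Fin d → ℝ → Sob D d (s - 1)}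
  {u'' : Fin d → ℝ → Sob D d (s - 2)} {a : ℝ → Sob D d s} {b : ℝ → Sob D d (s - 1)}
  {c : ℝ → Sob D d (s - 2)}

theorem isC1Curve_matOne (hsd : (d : ℝ) / 2 < s) (hs : 2 ≤ s)
    (hu : ∀ i, IsC2Curve s I (u i) (u' i) (u'' i)) (h : IsC2Curve s I a b c) :
    IsC1Curve (s - 1) (s - 2) I (fun t => matOne (fun i => u i t) (a t) (b t))
      (fun t => matOneDeriv (fun i => u i t) (fun i => u' i t) (a t) (b t) (c t)) := by
  have hpd : ∀ i, IsC1Curve (s - 1) (s - 2) I (fun t => pd s (s - 1) i (a t))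
      (fun t => pd (s - 1) (s - 2) i (b t)) := fun i => by
    have := h.fst.pd (by linarith) (by linarith) i
    rwa [show s - 1 - 1 = s - 2 by ring] at this
  exact h.snd.add (IsC1Curve.sum fun i _ => (hu i).fst.mul (hpd i) (mulCond_zero_one hsd hs)
    (mulCond_one_one hsd hs) (mulCond_zero_two hsd hs) (by linarith) (by linarith) (by linarith))

theorem continuousOn_matTwo (hsd : (d : ℝ) / 2 < s) (hs : 2 ≤ s)
    (hu : ∀ i, IsC2Curve s I (u i) (u' i) (u'' i)) (h : IsC2Curve s I a b c) :
    ContinuousOn (fun t => matTwo (fun i => u i t) (fun i => u' i t) (a t) (b t) (c t)) I := by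
  have h1 := isC1Curve_matOne hsd hs hu h
  refine h1.cont₁.add (continuousOn_finsetSum _ fun i _ => ?_)
  exact (mul s (s - 2) (s - 2)).continuous₂.comp_continuousOn ((hu i).fst.cont₀.prodMk
    ((pd _ _ i).continuous.comp_continuousOn h1.cont₀))

variable {v : Fin d → ℝ → Pt D d → ℝ} {f : ℝ → Pt D d → ℝ} {κ : ℝ}

theorem toL2_matOne (hsd : (d : ℝ) / 2 < s) (hs : 2 ≤ s) (u : Fin d → Sob D d s) (a : Sob D d s)
    (b : Sob D d (s - 1)) : toL2 (matOne u a b) =ᵐ[volume] fun x =>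
      toL2 b x + ∑ i, toL2 (u i) x * toL2 (pd s 0 i a) x := by
  rw [matOne, map_add, map_sum]
  have e := fun i => toL2_pd_congr (β := s - 1) (by linarith) (by linarith) le_rfl
    (by linarith : 0 + 1 ≤ s) i (rfl : toL2 a = toL2 a)
  filter_upwards [Lp.coeFn_add (toL2 b)
      (∑ i, toL2 (mul s (s - 1) (s - 1) (u i) (pd s (s - 1) i a))),
    coeFn_lp_sum Finset.univ fun i => toL2 (mul s (s - 1) (s - 1) (u i) (pd s (s - 1) i a)),
    ae_all_iff.2 fun i => toL2_mul (mulCond_zero_one hsd hs) (u i) (pd s (s - 1) i a)]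
    with x h1 h2 h3
  rw [h1, Pi.add_apply, h2]
  simp only [h3, e]

theorem toL2_matTwo (hsd : (d : ℝ) / 2 < s) (hs : 2 ≤ s) (u : Fin d → Sob D d s)
    (u' : Fin d → Sob D d (s - 1)) (a : Sob D d s) (b : Sob D d (s - 1)) (c : Sob D d (s - 2)) :
    toL2 (matTwo u u' a b c) =ᵐ[volume] fun x => toL2 (matOneDeriv u u' a b c) x +
      ∑ i, toL2 (u i) x * toL2 (pd (s - 1) 0 i (matOne u a b)) x := by
  rw [matTwo, map_add, map_sum]
  have e := fun i => toL2_pd_congr (β := s - 2) (by linarith) (by linarith) le_rfl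
    (by linarith : 0 + 1 ≤ s - 1) i (rfl : toL2 (matOne u a b) = toL2 (matOne u a b))
  filter_upwards [Lp.coeFn_add (toL2 (matOneDeriv u u' a b c))
      (∑ i, toL2 (mul s (s - 2) (s - 2) (u i) (pd (s - 1) (s - 2) i (matOne u a b)))),
    coeFn_lp_sum Finset.univ fun i =>
      toL2 (mul s (s - 2) (s - 2) (u i) (pd (s - 1) (s - 2) i (matOne u a b))),
    ae_all_iff.2 fun i =>
      toL2_mul (mulCond_zero_two hsd hs) (u i) (pd (s - 1) (s - 2) i (matOne u a b))]
    with x h1 h2 h3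
  rw [h1, Pi.add_apply, h2]
  simp only [h3, e]

theorem matD_ae_matOne (hsd : (d : ℝ) / 2 < s) (hs : 2 ≤ s) (hI : UniqueDiffOn ℝ I)
    (hv : ∀ i, ∀ t ∈ I, v i t =ᵐ[volume] toL2 (u i t)) (h : IsC2Curve s I a b c)
    (hf : ∀ τ ∈ I, f τ =ᵐ[volume] fun x => κ + toL2 (a τ) x) {t : ℝ} (ht : t ∈ I) :
    matD I v f t =ᵐ[volume] toL2 (matOne (fun i => u i t) (a t) (b t)) := by
  filter_upwards [h.fst.matD_ae (by linarith) (by linarith) (by linarith) hI hf v ht,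
    toL2_matOne hsd hs (fun i => u i t) (a t) (b t), ae_all_iff.2 fun i => hv i t ht] with x h1 h2 h3
  rw [h1, h2]
  simp only [h3]

/-- Here f is any representative of the first material derivative, so that f = w is allowed when the
curve is that of η - 1. -/
theorem matD_ae_matTwo (hsd : (d : ℝ) / 2 < s) (hs : 2 ≤ s) (hI : UniqueDiffOn ℝ I)
    (hv : ∀ i, ∀ t ∈ I, v i t =ᵐ[volume] toL2 (u i t))
    (hu : ∀ i, IsC2Curve s I (u i) (u' i) (u'' i)) (h : IsC2Curve s I a b c)
    (hf : ∀ τ ∈ I, f τ =ᵐ[volume] toL2 (matOne (fun i => u i τ) (a τ) (b τ))) {t : ℝ}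
    (ht : t ∈ I) : matD I v f t =ᵐ[volume]
      toL2 (matTwo (fun i => u i t) (fun i => u' i t) (a t) (b t) (c t)) := by
  have h1 := isC1Curve_matOne hsd hs hu h
  have hf' : ∀ τ ∈ I, f τ =ᵐ[volume]
      fun x => 0 + toL2 (matOne (fun i => u i τ) (a τ) (b τ)) x := fun τ hτ => by
    simpa only [zero_add] using hf τ hτ
  filter_upwards [h1.matD_ae (by linarith) (by linarith) (by linarith) hI hf' v ht,
    toL2_matTwo hsd hs (fun i => u i t) (fun i => u' i t) (a t) (b t) (c t),
    ae_all_iff.2 fun i => hv i t ht] with x h1 h2 h3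
  rw [h1, h2]
  simp only [h3]

end Material

/-! ### The remainder and its first estimate -/

variable {D : Geometry} {d : ℕ} {s : ℝ}

theorem norm_pd_le {α β : ℝ} (hβ : 0 ≤ β) (h : β + 1 ≤ α) (i : Fin d) (x : Sob D d α) :
    ‖pd α β i x‖ ≤ ‖x‖ := by
  obtain ⟨y, -, h1, h2⟩ := exists_pd_aux (D := D) hβ h i x
  rwa [show pd α β i x = y from
    toL2_injective hβ (eq_of_RT_ae ((RT_pd hβ h i x).trans h2.symm))]

/-- Multiplication by the depth `1 + ζ`. -/
noncomputable def depthMul (ζ : Sob D d s) : Sob D d (s - 2) →L[ℝ] Sob D d (s - 2) :=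
  ContinuousLinearMap.id ℝ _ + mul s (s - 2) (s - 2) ζ

theorem toL2_depthMul (hsd : (d : ℝ) / 2 < s) (hs : 2 ≤ s) (ζ : Sob D d s) (x : Sob D d (s - 2)) :
    toL2 (depthMul ζ x) =ᵐ[volume] fun p => (1 + toL2 ζ p) * toL2 x p := by
  have e : depthMul ζ x = x + mul s (s - 2) (s - 2) ζ x := rfl
  rw [e, map_add]
  filter_upwards [Lp.coeFn_add (toL2 x) (toL2 (mul s (s - 2) (s - 2) ζ x)),
    toL2_mul (mulCond_zero_two hsd hs) ζ x] with p h1 h2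
  rw [h1, Pi.add_apply, h2]
  ring

/-- The remainder as an element of `H^{s-2}`, in terms of `ζ`, `η - 1`, `ḧ`, `η̈`. -/
noncomputable def remSob (ζ e : Sob D d s) (H E : Sob D d (s - 2)) : Sob D d (s - 2) :=
  -depthMul ζ (mul s (s - 2) (s - 2) (e - ζ) E) - depthMul ζ (depthMul ζ (E - H))

theorem toL2_remSob (hsd : (d : ℝ) / 2 < s) (hs : 2 ≤ s) (ζ e : Sob D d s)
    (H E : Sob D d (s - 2)) : toL2 (remSob ζ e H E) =ᵐ[volume] fun p =>
      -((1 + toL2 ζ p) * (toL2 e p - toL2 ζ p) * toL2 E p) -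
        (1 + toL2 ζ p) ^ 2 * (toL2 E p - toL2 H p) := by
  rw [remSob, map_sub, map_neg]
  set X := depthMul ζ (mul s (s - 2) (s - 2) (e - ζ) E)
  set Y := depthMul ζ (depthMul ζ (E - H))
  filter_upwards [Lp.coeFn_sub (-toL2 X) (toL2 Y), Lp.coeFn_neg (toL2 X),
    toL2_depthMul hsd hs ζ (mul s (s - 2) (s - 2) (e - ζ) E),
    toL2_mul (mulCond_zero_two hsd hs) (e - ζ) E, toL2_depthMul hsd hs ζ (depthMul ζ (E - H)),
    toL2_depthMul hsd hs ζ (E - H), Lp.coeFn_sub (toL2 e) (toL2 ζ), Lp.coeFn_sub (toL2 E) (toL2 H)]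
    with p h1 h2 h3 h4 h5 h6 h7 h8
  rw [h1, Pi.sub_apply, h2, Pi.neg_apply, h3, h4, h5, h6, map_sub, map_sub, h7, h8, Pi.sub_apply,
    Pi.sub_apply]
  ring

section Estimate

/-- A bound for the products that occur in the material derivatives. -/
noncomputable def mulBound (D : Geometry) (d : ℕ) (s : ℝ) : ℝ :=
  1 + ‖(mul s s s : Sob D d s →L[ℝ] _ →L[ℝ] _)‖ +
    ‖(mul s (s - 1) (s - 1) : Sob D d s →L[ℝ] _ →L[ℝ] _)‖ +
    ‖(mul (s - 1) (s - 1) (s - 2) : Sob D d (s - 1) →L[ℝ] _ →L[ℝ] _)‖ +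
    ‖(mul s (s - 2) (s - 2) : Sob D d s →L[ℝ] _ →L[ℝ] _)‖

theorem le_mulBound : 1 ≤ mulBound D d s ∧
    ‖(mul s s s : Sob D d s →L[ℝ] _ →L[ℝ] _)‖ ≤ mulBound D d s ∧
    ‖(mul s (s - 1) (s - 1) : Sob D d s →L[ℝ] _ →L[ℝ] _)‖ ≤ mulBound D d s ∧
    ‖(mul (s - 1) (s - 1) (s - 2) : Sob D d (s - 1) →L[ℝ] _ →L[ℝ] _)‖ ≤ mulBound D d s ∧
    ‖(mul s (s - 2) (s - 2) : Sob D d s →L[ℝ] _ →L[ℝ] _)‖ ≤ mulBound D d s := by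
  unfold mulBound
  have h0 := ContinuousLinearMap.opNorm_nonneg (mul s s s : Sob D d s →L[ℝ] _ →L[ℝ] _)
  have h1 := ContinuousLinearMap.opNorm_nonneg (mul s (s - 1) (s - 1) : Sob D d s →L[ℝ] _ →L[ℝ] _)
  have h2 := ContinuousLinearMap.opNorm_nonneg
    (mul (s - 1) (s - 1) (s - 2) : Sob D d (s - 1) →L[ℝ] _ →L[ℝ] _)
  have h3 := ContinuousLinearMap.opNorm_nonneg (mul s (s - 2) (s - 2) : Sob D d s →L[ℝ] _ →L[ℝ] _)
  refine ⟨?_, ?_, ?_, ?_, ?_⟩ <;> linarith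

theorem one_le_mulBound : 1 ≤ mulBound D d s := le_mulBound.1

theorem norm_mul_zero_zero_le (x y : Sob D d s) :
    ‖mul s s s x y‖ ≤ mulBound D d s * ‖x‖ * ‖y‖ := by
  refine ((mul s s s).le_opNorm₂ x y).trans ?_
  gcongr
  exact le_mulBound.2.1

theorem norm_mul_zero_one_le (x : Sob D d s) (y : Sob D d (s - 1)) :
    ‖mul s (s - 1) (s - 1) x y‖ ≤ mulBound D d s * ‖x‖ * ‖y‖ := by
  refine ((mul s (s - 1) (s - 1)).le_opNorm₂ x y).trans ?_
  gcongr
  exact le_mulBound.2.2.1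

theorem norm_mul_one_one_le (x y : Sob D d (s - 1)) :
    ‖mul (s - 1) (s - 1) (s - 2) x y‖ ≤ mulBound D d s * ‖x‖ * ‖y‖ := by
  refine ((mul (s - 1) (s - 1) (s - 2)).le_opNorm₂ x y).trans ?_
  gcongr
  exact le_mulBound.2.2.2.1

theorem norm_mul_zero_two_le (x : Sob D d s) (y : Sob D d (s - 2)) :
    ‖mul s (s - 2) (s - 2) x y‖ ≤ mulBound D d s * ‖x‖ * ‖y‖ := by
  refine ((mul s (s - 2) (s - 2)).le_opNorm₂ x y).trans ?_
  gcongr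
  exact le_mulBound.2.2.2.2

theorem norm_sum_mul_le {ι E : Type*} [Fintype ι] [SeminormedAddCommGroup E] {f : ι → E}
    {K M x : ℝ} {n : ι → ℝ} (hK : 0 ≤ K) (hx : 0 ≤ x) (hf : ∀ i, ‖f i‖ ≤ K * n i * x)
    (hn : ∑ i, n i ≤ M) : ‖∑ i, f i‖ ≤ K * M * x := by
  refine (norm_sum_le _ _).trans ((Finset.sum_le_sum fun i _ => hf i).trans ?_)
  rw [← Finset.sum_mul, ← Finset.mul_sum]
  gcongr

variable {u : Fin d → Sob D d s} {u' : Fin d → Sob D d (s - 1)} {M : ℝ}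

theorem norm_matOne_le (hs : 2 ≤ s) (hM : ∑ i, ‖u i‖ ≤ M) (a : Sob D d s) (b : Sob D d (s - 1)) :
    ‖matOne u a b‖ ≤ mulBound D d s * (1 + M) * (‖a‖ + ‖b‖) := by
  have hK := one_le_mulBound (D := D) (d := d) (s := s)
  have hM0 : 0 ≤ M := (Finset.sum_nonneg fun i _ => norm_nonneg _).trans hM
  have h1 : ‖∑ i, mul s (s - 1) (s - 1) (u i) (pd s (s - 1) i a)‖ ≤ mulBound D d s * M * ‖a‖ :=
    norm_sum_mul_le (by linarith) (norm_nonneg _) (fun i =>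
      (norm_mul_zero_one_le _ _).trans (by
        gcongr
        exact norm_pd_le (by linarith) (by linarith) i a)) hM
  refine (norm_add_le _ _).trans ((add_le_add le_rfl h1).trans ?_)
  have : ‖b‖ ≤ mulBound D d s * ‖b‖ := le_mul_of_one_le_left (norm_nonneg _) hK
  nlinarith [mul_nonneg (zero_le_one.trans hK) (norm_nonneg a),
    mul_nonneg (mul_nonneg (zero_le_one.trans hK) hM0) (norm_nonneg b)]

theorem norm_matOneDeriv_le (hs : 2 ≤ s) (hM : ∑ i, ‖u i‖ ≤ M) (hM' : ∑ i, ‖u' i‖ ≤ M)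
    (a : Sob D d s) (b : Sob D d (s - 1)) (c : Sob D d (s - 2)) :
    ‖matOneDeriv u u' a b c‖ ≤ mulBound D d s * (1 + M) * (‖a‖ + ‖b‖ + ‖c‖) := by
  have hK := one_le_mulBound (D := D) (d := d) (s := s)
  have hM0 : 0 ≤ M := (Finset.sum_nonneg fun i _ => norm_nonneg _).trans hM
  have h1 : ‖∑ i, mul (s - 1) (s - 1) (s - 2) (u' i) (pd s (s - 1) i a)‖ ≤
      mulBound D d s * M * ‖a‖ :=
    norm_sum_mul_le (by linarith) (norm_nonneg _) (fun i =>
      (norm_mul_one_one_le _ _).trans (by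
        gcongr
        exact norm_pd_le (by linarith) (by linarith) i a)) hM'
  have h2 : ‖∑ i, mul s (s - 2) (s - 2) (u i) (pd (s - 1) (s - 2) i b)‖ ≤
      mulBound D d s * M * ‖b‖ :=
    norm_sum_mul_le (by linarith) (norm_nonneg _) (fun i =>
      (norm_mul_zero_two_le _ _).trans (by
        gcongr
        exact norm_pd_le (by linarith) (by linarith) i b)) hM
  rw [matOneDeriv, Finset.sum_add_distrib]
  refine (norm_add_le _ _).trans ((add_le_add le_rfl ((norm_add_le _ _).trans
    (add_le_add h1 h2))).trans ?_)
  have : ‖c‖ ≤ mulBound D d s * ‖c‖ := le_mul_of_one_le_left (norm_nonneg _) hK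
  nlinarith [mul_nonneg (zero_le_one.trans hK) (norm_nonneg a),
    mul_nonneg (zero_le_one.trans hK) (norm_nonneg b),
    mul_nonneg (mul_nonneg (zero_le_one.trans hK) hM0) (norm_nonneg c)]

theorem norm_matTwo_le (hs : 2 ≤ s) (hM : ∑ i, ‖u i‖ ≤ M) (hM' : ∑ i, ‖u' i‖ ≤ M)
    (a : Sob D d s) (b : Sob D d (s - 1)) (c : Sob D d (s - 2)) :
    ‖matTwo u u' a b c‖ ≤ 2 * (mulBound D d s * (1 + M)) ^ 2 * (‖a‖ + ‖b‖ + ‖c‖) := by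
  have hK := one_le_mulBound (D := D) (d := d) (s := s)
  have hM0 : 0 ≤ M := (Finset.sum_nonneg fun i _ => norm_nonneg _).trans hM
  set L := mulBound D d s * (1 + M) with hL
  have hL1 : 1 ≤ L := by nlinarith
  have hLM : mulBound D d s * M ≤ L := by rw [hL]; nlinarith
  have h1 : ‖∑ i, mul s (s - 2) (s - 2) (u i) (pd (s - 1) (s - 2) i (matOne u a b))‖ ≤
      mulBound D d s * M * ‖matOne u a b‖ :=
    norm_sum_mul_le (by linarith) (norm_nonneg _) (fun i =>
      (norm_mul_zero_two_le _ _).trans (by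
        gcongr
        exact norm_pd_le (by linarith) (by linarith) i _)) hM
  have h2 : mulBound D d s * M * ‖matOne u a b‖ ≤ L * (L * (‖a‖ + ‖b‖)) := by
    gcongr
    exact norm_matOne_le hs hM a b
  have h3 := norm_matOneDeriv_le hs hM hM' a b c
  rw [← hL] at h3
  refine (norm_add_le _ _).trans ((add_le_add h3 (h1.trans h2)).trans ?_)
  have h4 : L ≤ L ^ 2 := by nlinarith
  have h5 := mul_le_mul_of_nonneg_right h4 (by positivity : 0 ≤ ‖a‖ + ‖b‖ + ‖c‖)
  nlinarith [mul_nonneg (sq_nonneg L) (norm_nonneg c)]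

theorem norm_depthMul_le {ζ : Sob D d s} (hζ : ‖ζ‖ ≤ M) (x : Sob D d (s - 2)) :
    ‖depthMul ζ x‖ ≤ mulBound D d s * (1 + M) * ‖x‖ := by
  have hK := one_le_mulBound (D := D) (d := d) (s := s)
  refine (norm_add_le x (mul s (s - 2) (s - 2) ζ x)).trans ?_
  have h1 := (norm_mul_zero_two_le ζ x).trans (mul_le_mul_of_nonneg_right
    (mul_le_mul_of_nonneg_left hζ (zero_le_one.trans hK)) (norm_nonneg x))
  nlinarith [le_mul_of_one_le_left (norm_nonneg x) hK]

/-- Let K = `mulBound D d s`, L = K(1 + M), and S be the sum on the right. Multiplication by the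
depth costs L, a second material derivative 2L². The term h(η - h)η̈ costs L · 2L³ because KM ≤ L,
the term h²(η̈ - ḧ) costs L² · 2L², each times S; together 4L⁴S. -/
theorem norm_remSob_le (hs : 2 ≤ s) (hM : ∑ i, ‖u i‖ ≤ M) (hM' : ∑ i, ‖u' i‖ ≤ M)
    {a e : Sob D d s} {b e' : Sob D d (s - 1)} {c e'' : Sob D d (s - 2)} (ha : ‖a‖ ≤ M)
    (he : ‖e‖ + ‖e'‖ + ‖e''‖ ≤ M) :
    ‖remSob a e (matTwo u u' a b c) (matTwo u u' e e' e'')‖ ≤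
      4 * (mulBound D d s * (1 + M)) ^ 4 * (‖e - a‖ + ‖e' - b‖ + ‖e'' - c‖) := by
  have hK := one_le_mulBound (D := D) (d := d) (s := s)
  have hM0 : 0 ≤ M := (norm_nonneg a).trans ha
  rw [remSob, ← matTwo_sub]
  have h1 := norm_matTwo_le hs hM hM' (e - a) (e' - b) (e'' - c)
  have h2 := norm_matTwo_le hs hM hM' e e' e''
  set S := ‖e - a‖ + ‖e' - b‖ + ‖e'' - c‖ with hS
  set L := mulBound D d s * (1 + M) with hL
  have hL1 : 1 ≤ L := by nlinarith
  have hLM : mulBound D d s * M ≤ L := by rw [hL]; nlinarith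
  have hS0 : 0 ≤ S := by positivity
  have hAS : ‖e - a‖ ≤ S := by
    have := norm_nonneg (e' - b); have := norm_nonneg (e'' - c); linarith
  have h3 : ‖matTwo u u' e e' e''‖ ≤ 2 * L ^ 2 * M := h2.trans (by gcongr)
  have h4 : ‖mul s (s - 2) (s - 2) (e - a) (matTwo u u' e e' e'')‖ ≤ 2 * L ^ 3 * S := by
    refine (norm_mul_zero_two_le _ _).trans ?_
    calc mulBound D d s * ‖e - a‖ * ‖matTwo u u' e e' e''‖
        ≤ mulBound D d s * S * (2 * L ^ 2 * M) := by gcongr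
      _ = 2 * L ^ 2 * S * (mulBound D d s * M) := by ring
      _ ≤ 2 * L ^ 2 * S * L := by gcongr
      _ = 2 * L ^ 3 * S := by ring
  have h5 := (norm_depthMul_le ha (mul s (s - 2) (s - 2) (e - a) (matTwo u u' e e' e''))).trans
    (mul_le_mul_of_nonneg_left h4 (zero_le_one.trans hL1))
  have h6 := (norm_depthMul_le ha (matTwo u u' (e - a) (e' - b) (e'' - c))).trans
    (mul_le_mul_of_nonneg_left h1 (zero_le_one.trans hL1))
  have h7 := (norm_depthMul_le ha (depthMul a (matTwo u u' (e - a) (e' - b) (e'' - c)))).trans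
    (mul_le_mul_of_nonneg_left h6 (zero_le_one.trans hL1))
  refine (norm_sub_le _ _).trans ?_
  rw [norm_neg]
  refine (add_le_add h5 h7).trans_eq ?_
  ring

end Estimate

/-! ### The Green–Naghdi system with remainder -/

variable {D : Geometry} {d : ℕ} {s : ℝ}

/-- Curves in Sobolev spaces that represent the depth, the velocity and `η`. -/
structure IsFlow (s : ℝ) (I : Set ℝ) (ζ : ℝ → Pt D d → ℝ) (v : Fin d → ℝ → Pt D d → ℝ)
    (η : ℝ → Pt D d → ℝ) (z : ℝ → Sob D d s) (z' : ℝ → Sob D d (s - 1))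
    (z'' : ℝ → Sob D d (s - 2)) (u : Fin d → ℝ → Sob D d s) (u' : Fin d → ℝ → Sob D d (s - 1))
    (u'' : Fin d → ℝ → Sob D d (s - 2)) (e : ℝ → Sob D d s) (e' : ℝ → Sob D d (s - 1))
    (e'' : ℝ → Sob D d (s - 2)) : Prop where
  zeta : IsC2Curve s I z z' z''
  vel : ∀ i, IsC2Curve s I (u i) (u' i) (u'' i)
  eta : IsC2Curve s I e e' e''
  zeta_ae : ∀ t ∈ I, ζ t =ᵐ[volume] toL2 (z t)
  vel_ae : ∀ i, ∀ t ∈ I, v i t =ᵐ[volume] toL2 (u i t)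
  eta_ae : ∀ t ∈ I, (fun x => η t x - 1) =ᵐ[volume] toL2 (e t)

namespace IsFlow

variable {I : Set ℝ} {ζ : ℝ → Pt D d → ℝ} {v : Fin d → ℝ → Pt D d → ℝ} {η w : ℝ → Pt D d → ℝ}
  {z : ℝ → Sob D d s} {z' : ℝ → Sob D d (s - 1)} {z'' : ℝ → Sob D d (s - 2)}
  {u : Fin d → ℝ → Sob D d s} {u' : Fin d → ℝ → Sob D d (s - 1)}
  {u'' : Fin d → ℝ → Sob D d (s - 2)} {e : ℝ → Sob D d s} {e' : ℝ → Sob D d (s - 1)}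
  {e'' : ℝ → Sob D d (s - 2)} {t : ℝ}

theorem depth_ae (R : IsFlow s I ζ v η z z' z'' u u' u'' e e' e'') (ht : t ∈ I) :
    depth ζ t =ᵐ[volume] fun x => 1 + toL2 (z t) x := by
  filter_upwards [R.zeta_ae t ht] with x hx
  rw [depth, hx]

theorem eta_ae' (R : IsFlow s I ζ v η z z' z'' u u' u'' e e' e'') (ht : t ∈ I) :
    η t =ᵐ[volume] fun x => 1 + toL2 (e t) x := by
  filter_upwards [R.eta_ae t ht] with x hx
  rw [← hx]; ring

theorem matDifferentiable (R : IsFlow s I ζ v η z z' z'' u u' u'' e e' e'')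
    (hsd : (d : ℝ) / 2 < s) (hs : 2 ≤ s) (hI : UniqueDiffOn ℝ I) :
    MatDifferentiable I (depth ζ) ∧ MatDifferentiable I (matD I v (depth ζ)) ∧
      MatDifferentiable I η ∧ MatDifferentiable I (matD I v η) := by
  refine ⟨R.zeta.fst.matDifferentiable (by linarith) (by linarith) (by linarith)
      fun τ hτ => R.depth_ae hτ,
    (isC1Curve_matOne hsd hs R.vel R.zeta).matDifferentiable (κ := 0) (by linarith) (by linarith)
      (by linarith) fun τ hτ => ?_,
    R.eta.fst.matDifferentiable (by linarith) (by linarith) (by linarith)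
      fun τ hτ => R.eta_ae' hτ,
    (isC1Curve_matOne hsd hs R.vel R.eta).matDifferentiable (κ := 0) (by linarith) (by linarith)
      (by linarith) fun τ hτ => ?_⟩
  · simpa only [zero_add] using
      matD_ae_matOne hsd hs hI R.vel_ae R.zeta (fun τ hτ => R.depth_ae hτ) hτ
  · simpa only [zero_add] using
      matD_ae_matOne hsd hs hI R.vel_ae R.eta (fun τ hτ => R.eta_ae' hτ) hτ

theorem matD_matD_depth (R : IsFlow s I ζ v η z z' z'' u u' u'' e e' e'')
    (hsd : (d : ℝ) / 2 < s) (hs : 2 ≤ s) (hI : UniqueDiffOn ℝ I) (ht : t ∈ I) :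
    matD I v (matD I v (depth ζ)) t =ᵐ[volume]
      toL2 (matTwo (fun i => u i t) (fun i => u' i t) (z t) (z' t) (z'' t)) :=
  matD_ae_matTwo hsd hs hI R.vel_ae R.vel R.zeta (fun _ hτ =>
    matD_ae_matOne hsd hs hI R.vel_ae R.zeta (fun _ hτ => R.depth_ae hτ) hτ) ht

theorem matD_matD_eta (R : IsFlow s I ζ v η z z' z'' u u' u'' e e' e'')
    (hsd : (d : ℝ) / 2 < s) (hs : 2 ≤ s) (hI : UniqueDiffOn ℝ I) (ht : t ∈ I) :
    matD I v (matD I v η) t =ᵐ[volume]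
      toL2 (matTwo (fun i => u i t) (fun i => u' i t) (e t) (e' t) (e'' t)) :=
  matD_ae_matTwo hsd hs hI R.vel_ae R.vel R.eta (fun _ hτ =>
    matD_ae_matOne hsd hs hI R.vel_ae R.eta (fun _ hτ => R.eta_ae' hτ) hτ) ht

theorem remainder_ae (R : IsFlow s I ζ v η z z' z'' u u' u'' e e' e'')
    (hsd : (d : ℝ) / 2 < s) (hs : 2 ≤ s) (hI : UniqueDiffOn ℝ I) (ht : t ∈ I) :
    remainder I ζ v η t =ᵐ[volume] toL2 (remSob (z t) (e t)
      (matTwo (fun i => u i t) (fun i => u' i t) (z t) (z' t) (z'' t))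
      (matTwo (fun i => u i t) (fun i => u' i t) (e t) (e' t) (e'' t))) := by
  filter_upwards [toL2_remSob hsd hs (z t) (e t)
    (matTwo (fun i => u i t) (fun i => u' i t) (z t) (z' t) (z'' t))
    (matTwo (fun i => u i t) (fun i => u' i t) (e t) (e' t) (e'' t)), R.depth_ae ht, R.eta_ae' ht,
    R.matD_matD_depth hsd hs hI ht, R.matD_matD_eta hsd hs hI ht] with x h1 h2 h3 h4 h5
  rw [h1, remainder, h2, h3, h4, h5]
  ring

theorem cnH_remainder (R : IsFlow s I ζ v η z z' z'' u u' u'' e e' e'')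
    (hsd : (d : ℝ) / 2 < s) (hs : 2 ≤ s) (hI : UniqueDiffOn ℝ I) :
    CnH 0 (s - 2) I (remainder I ζ v η) := by
  refine CnH_zero_of_continuousOn (by linarith) ?_ fun t ht => R.remainder_ae hsd hs hI ht
  have hE := continuousOn_matTwo hsd hs R.vel R.eta
  have hH := continuousOn_matTwo hsd hs R.vel R.zeta
  have hD : ∀ {x : ℝ → Sob D d (s - 2)}, ContinuousOn x I →
      ContinuousOn (fun t => depthMul (z t) (x t)) I := fun hx =>
    hx.add ((mul s (s - 2) (s - 2)).continuous₂.comp_continuousOn (R.zeta.fst.cont₀.prodMk hx))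
  exact (hD ((mul s (s - 2) (s - 2)).continuous₂.comp_continuousOn
    ((R.eta.fst.cont₀.sub R.zeta.fst.cont₀).prodMk hE))).neg.sub (hD (hD (hE.sub hH)))

/-- The second equation of the Green–Naghdi system, with remainder. -/
theorem gnMomentum (R : IsFlow s I ζ v η z z' z'' u u' u'' e e' e'')
    (hsd : (d : ℝ) / 2 < s) (hs : 2 ≤ s) (hI : UniqueDiffOn ℝ I) {lam mu hstar : ℝ}
    (h0 : 0 < hstar) (hh : ∀ t ∈ I, ∀ᵐ x, hstar ≤ depth ζ t x)
    (hsol : IsFGSolution lam mu I ζ v η w) : GNMomentum mu I ζ v (remainder I ζ v η) := by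
  intro t ht
  set H := matTwo (fun i => u i t) (fun i => u' i t) (z t) (z' t) (z'' t)
  set E := matTwo (fun i => u i t) (fun i => u' i t) (e t) (e' t) (e'' t)
  have hH := R.matD_matD_depth hsd hs hI ht
  have hE := R.matD_matD_eta hsd hs hI ht
  have hr := R.remainder_ae hsd hs hI ht
  have hdep := R.depth_ae ht
  have heta := R.eta_ae' ht
  set hH2 : XR D d := toL2 (depthMul (z t) (depthMul (z t) H)) with hH2def
  have hH2ae : (fun x => depth ζ t x ^ 2 * matD I v (matD I v (depth ζ)) t x) =ᵐ[volume] hH2 := by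
    filter_upwards [toL2_depthMul hsd hs (z t) (depthMul (z t) H), toL2_depthMul hsd hs (z t) H, hH,
      hdep] with x h1 h2 h3 h4
    rw [hH2def, h1, h2, h3, h4]; ring
  set r : XR D d := toL2 (remSob (z t) (e t) H E)
  -- The third equation identifies w with η̇, so the fourth is an equation for η̈.
  have hwE : toL2 E =ᵐ[volume] fun x => -(lam / depth ζ t x ^ 2) * (η t x - depth ζ t x) := by
    have h1 : matD I v w t =ᵐ[volume] toL2 E :=
      matD_ae_matTwo hsd hs hI R.vel_ae R.vel R.eta (fun τ hτ => by
        filter_upwards [hsol.eta_eq τ hτ,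
          matD_ae_matOne hsd hs hI R.vel_ae R.eta (fun _ hτ => R.eta_ae' hτ) hτ] with x h1 h2
        rw [← h1, h2]) ht
    filter_upwards [h1, hsol.w_eq t ht] with x h1 h2
    rw [← h1, h2]
  refine ⟨(memLp_congr_ae hH2ae).2 (Lp.memLp _), (memLp_congr_ae hr).2 (Lp.memLp _),
    fun i φ hφ => ?_⟩
  have hzpos : ∀ᵐ p, hstar ≤ 1 + toL2 (z t) p := by
    filter_upwards [hh t ht, hdep] with x h1 h2
    rwa [← h2]
  have hss : MulCond d s s s := ⟨by linarith, le_rfl, le_rfl, by linarith⟩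
  have hs1 : (1 : ℝ) ≤ s := by linarith
  -- This is η(η - h), with η = 1 + e and h = 1 + z; its quotient by h is the potential Y of the
  -- pressure term.
  set g : Sob D d 1 := incl s 1 ((e t - z t) + mul s s s (e t) (e t - z t)) with hg
  have hgae : toL2 g =ᵐ[volume] fun x => η t x * (η t x - depth ζ t x) := by
    rw [hg, toL2_incl zero_le_one hs1, map_add]
    filter_upwards [Lp.coeFn_add (toL2 (e t - z t)) (toL2 (mul s s s (e t) (e t - z t))),
      toL2_mul hss (e t) (e t - z t), Lp.coeFn_sub (toL2 (e t)) (toL2 (z t)), hdep, heta]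
      with x h1 h2 h3 h4 h5
    rw [h1, Pi.add_apply, h2, map_sub, h3, Pi.sub_apply, h4, h5]
    ring
  obtain ⟨Y, hY, -⟩ := exists_div hsd hs1 (z t) h0 hzpos g
  obtain ⟨p, hp⟩ := hφ.exists_sob (σ := 1) zero_le_one
  -- Φ = φ/h lies in H¹, and its gradient is the expression in `invDepthGrad`. The distributional
  -- equation thus becomes an integration by parts between Y and Φ.
  obtain ⟨Φ, hΦ, hΦ'⟩ := exists_div hsd hs1 (z t) h0 hzpos p
  have hpd := hφ.toL2_pd le_rfl (zero_add 1).le i hp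
  have hY' : (fun y => η t y / depth ζ t y * (η t y - depth ζ t y)) =ᵐ[volume]
      fun x => 0 + toL2 Y x := by
    filter_upwards [hY, hgae, hdep] with x h1 h2 h3
    rw [h1, h2, ← h3]; ring
  have hwdY := (hasWeakDeriv_of_sob le_rfl (zero_add 1).le hY' i).wd_ae
  have hz' : ζ t =ᵐ[volume] fun x => 0 + toL2 (z t) x := by
    simpa only [zero_add] using R.zeta_ae t ht
  have hwdζ := (hasWeakDeriv_of_sob le_rfl (by linarith : 0 + 1 ≤ s) hz' i).wd_ae
  have hinv : ∀ {F : Pt D d → ℝ} {f : XR D d}, F =ᵐ[volume] f →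
      invDepthGrad ζ t i F φ = -∫ x, f x * toL2 (pd 1 0 i Φ) x := fun {F f} hF => by
    rw [invDepthGrad]
    congr 1
    refine integral_congr_ae ?_
    filter_upwards [hF, hΦ' i, hwdζ, hdep, hp, hpd] with x h1 h2 h3 h4 h5 h6
    rw [h1, h2, h3, h4, h5, h6]
  have heul : ∫ x, euler I ζ v i t x * φ x =
      lam * mu / 3 * ∫ x, toL2 (pd 1 0 i Y) x * toL2 Φ x := by
    rw [← integral_const_mul]
    refine integral_congr_ae ?_
    filter_upwards [hsol.momentum i t ht, hwdY, hΦ, hp, hdep, hzpos] with x h1 h2 h3 h4 h5 h6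
    rw [sub_eq_zero.1 h1, h2, h3, h4, h5]
    have : 1 + toL2 (z t) x ≠ 0 := (h0.trans_le h6).ne'
    field_simp
  -- The central identity r = h²ḧ + λ(η/h)(η - h).
  have hrH : ∀ᵐ x, r x = hH2 x + lam * toL2 Y x := by
    filter_upwards [hr, hH2ae, hY, hgae, hE, hH, hwE, hdep, hzpos] with x h1 h2 h3 h4 h5 h6 h7 h8 h9
    have hne : 1 + toL2 (z t) x ≠ 0 := (h0.trans_le h9).ne'
    rw [h8] at h2 h4 h7
    rw [← h1, ← h2, h3, h4, remainder, h5, h6, h7, h8]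
    field_simp
    ring
  have i1 : Integrable fun x => hH2 x * toL2 (pd 1 0 i Φ) x := (Lp.memLp _).integrable_mul
    (Lp.memLp _)
  have i2 : Integrable fun x => toL2 Y x * toL2 (pd 1 0 i Φ) x := (Lp.memLp _).integrable_mul
    (Lp.memLp _)
  have hint : ∫ x, r x * toL2 (pd 1 0 i Φ) x =
      (∫ x, hH2 x * toL2 (pd 1 0 i Φ) x) + lam * ∫ x, toL2 Y x * toL2 (pd 1 0 i Φ) x := by
    rw [← integral_const_mul, ← integral_add i1 (i2.const_mul lam)]
    refine integral_congr_ae ?_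
    filter_upwards [hrH] with x h1
    rw [h1]; ring
  rw [hinv hH2ae, hinv hr, heul, hint, integral_pd_mul le_rfl le_rfl i Y Φ]
  ring

end IsFlow

/-! ### Division in L² and the quotient rule in time -/

variable {D : Geometry} {d : ℕ} {s : ℝ}

theorem IsC1Curve.const_mul {α β β' γ γ' : ℝ} {I : Set ℝ} {q : ℝ → Sob D d β} {q' : ℝ → Sob D d β'}
    (x : Sob D d α) (hq : IsC1Curve β β' I q q') (h : MulCond d α β γ) (h' : MulCond d α β' γ')
    (hβ : β' ≤ β) (hγ : γ' ≤ γ) :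
    IsC1Curve γ γ' I (fun t => FavrieGavrilyuk.mul α β γ x (q t))
      (fun t => FavrieGavrilyuk.mul α β' γ' x (q' t)) := by
  refine ⟨(FavrieGavrilyuk.mul α β γ x).continuous.comp_continuousOn hq.cont₀,
    (FavrieGavrilyuk.mul α β' γ' x).continuous.comp_continuousOn hq.cont₁, fun t ht => ?_⟩
  have h1 := (FavrieGavrilyuk.mul α β' γ' x).hasFDerivAt.comp_hasDerivWithinAt t (hq.deriv t ht)
  refine h1.congr (fun τ _ => ?_) ?_ <;>
  · refine toL2_injective h'.nonneg ?_
    rw [toL2_incl h'.nonneg hγ]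
    exact toL2_mul_congr h h' rfl (toL2_incl (h'.nonneg.trans h'.le_right) hβ _).symm

section InvMul

theorem invMul_bound {δ : ℝ} (hδ : 0 < δ) (m : XR D d) (p : Pt D d) :
    ‖(max δ (1 + m p))⁻¹‖ ≤ δ⁻¹ := by
  have h1 : δ ≤ max δ (1 + m p) := le_max_left _ _
  rw [norm_inv, Real.norm_of_nonneg (hδ.le.trans h1)]
  exact inv_anti₀ hδ h1

theorem memLp_invMul {δ : ℝ} (hδ : 0 < δ) (m : XR D d) :
    MemLp (fun p => (max δ (1 + m p))⁻¹) ⊤ volume :=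
  memLp_top_of_bound ((measurable_const.max
    (measurable_const.add (Lp.stronglyMeasurable m).measurable)).inv.aestronglyMeasurable) δ⁻¹
    (Eventually.of_forall (invMul_bound hδ m))

/-- Division by `1 + m`, if `1 + m ≥ δ`. -/
noncomputable def invMul {δ : ℝ} (hδ : 0 < δ) (m : XR D d) : XR D d →L[ℝ] XR D d :=
  -- Truncating the denominator at δ gives an operator of norm at most δ⁻¹ for every m; the lower
  -- bound on 1 + m is needed only to recognise the quotient.
  mulLp _ (memLp_invMul hδ m)

variable {δ : ℝ} (hδ : 0 < δ)

theorem norm_invMul_apply_le (m f : XR D d) : ‖invMul hδ m f‖ ≤ δ⁻¹ * ‖f‖ :=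
  norm_mulLp_apply_le _ _ (Eventually.of_forall (invMul_bound hδ m)) f

theorem invMul_ae {m : XR D d} (hm : ∀ᵐ p, δ ≤ 1 + m p) (f : XR D d) :
    invMul hδ m f =ᵐ[volume] fun p => f p / (1 + m p) := by
  filter_upwards [mulLp_ae _ (memLp_invMul hδ m) f, hm] with p h1 h2
  have h3 : invMul hδ m f p = (max δ (1 + m p))⁻¹ * f p := h1
  rw [h3, max_eq_right h2, div_eq_inv_mul]

theorem mulCond_sup (hsd : (d : ℝ) / 2 < s) (hs : 2 ≤ s) : MulCond d s 0 0 :=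
  ⟨le_rfl, by linarith, le_rfl, by linarith⟩

theorem mulCond_lTwo (hsd : (d : ℝ) / 2 < s) (hs : 2 ≤ s) : MulCond d (s - 1) (s - 1) 0 :=
  ⟨le_rfl, by linarith, by linarith, by linarith⟩

theorem exists_sob_zero (f : XR D d) : ∃ y : Sob D d 0, toL2 y = f := by
  obtain ⟨y, hy, -⟩ := exists_sob (D := D) le_rfl f (RT D d f) (by
    filter_upwards with ξ; simp [wt_zero])
  exact ⟨y, hy⟩

/-- With G = g/(1 + m₀), the difference of the quotients is ((f - g) - (m - m₀)G)/(1 + m). Division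
is bounded uniformly in m, and H^s · L² ⊂ L² makes the numerator small. -/
theorem tendsto_invMul (hsd : (d : ℝ) / 2 < s) (hs : 2 ≤ s) {l : Filter ℝ} {m : ℝ → Sob D d s}
    {m₀ : Sob D d s} (hm₀ : ∀ᵐ p, δ ≤ 1 + toL2 m₀ p)
    (hm : ∀ᶠ τ in l, ∀ᵐ p, δ ≤ 1 + toL2 (m τ) p) (hlim : Tendsto m l (𝓝 m₀)) {f : ℝ → XR D d}
    {g : XR D d} (hf : Tendsto f l (𝓝 g)) :
    Tendsto (fun τ => invMul hδ (toL2 (m τ)) (f τ)) l (𝓝 (invMul hδ (toL2 m₀) g)) := by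
  obtain ⟨G, hG⟩ := exists_sob_zero (invMul hδ (toL2 m₀) g)
  have key : ∀ᶠ τ in l, invMul hδ (toL2 (m τ)) (f τ) - invMul hδ (toL2 m₀) g =
      invMul hδ (toL2 (m τ)) ((f τ - g) - toL2 (mul s 0 0 (m τ - m₀) G)) := by
    filter_upwards [hm] with τ hτ
    apply Lp.ext
    filter_upwards [Lp.coeFn_sub (invMul hδ (toL2 (m τ)) (f τ)) (invMul hδ (toL2 m₀) g),
      invMul_ae hδ hτ (f τ), invMul_ae hδ hm₀ g,
      invMul_ae hδ hτ ((f τ - g) - toL2 (mul s 0 0 (m τ - m₀) G)),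
      Lp.coeFn_sub (f τ - g) (toL2 (mul s 0 0 (m τ - m₀) G)), Lp.coeFn_sub (f τ) g,
      toL2_mul (mulCond_sup hsd hs) (m τ - m₀) G, Lp.coeFn_sub (toL2 (m τ)) (toL2 m₀), hτ, hm₀]
      with p h1 h2 h3 h4 h5 h6 h7 h8 h9 h10
    rw [h1, Pi.sub_apply, h2, h3, h4, h5, Pi.sub_apply, h6, Pi.sub_apply, h7, map_sub, h8,
      Pi.sub_apply, hG, h3]
    have := (hδ.trans_le h9).ne'
    have := (hδ.trans_le h10).ne'
    field_simp
    ring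
  rw [tendsto_iff_norm_sub_tendsto_zero]
  have hb : Tendsto (fun τ => δ⁻¹ * ‖(f τ - g) - toL2 (mul s 0 0 (m τ - m₀) G)‖) l (𝓝 0) := by
    have h1 : Tendsto (fun τ => toL2 (mul s 0 0 (m τ - m₀) G)) l (𝓝 0) := by
      have h2 : Tendsto (fun τ => m τ - m₀) l (𝓝 0) := by
        simpa using hlim.sub_const m₀
      have h3 : Continuous fun x : Sob D d s => toL2 (mul s 0 0 x G) :=
        toL2.continuous.comp ((mul s 0 0).continuous.clm_apply continuous_const)
      have h4 := (h3.tendsto 0).comp h2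
      have e0 : toL2 (mul s 0 0 0 G) = 0 := by simp
      rw [e0] at h4
      exact h4
    have h2 : Tendsto (fun τ => f τ - g) l (𝓝 0) := by simpa using hf.sub_const g
    simpa using ((h2.sub h1).norm).const_mul δ⁻¹
  refine squeeze_zero' (Eventually.of_forall fun _ => norm_nonneg _) ?_ hb
  filter_upwards [key] with τ hτ
  rw [hτ]
  exact norm_invMul_apply_le _ _ _

variable {I : Set ℝ} {t : ℝ}

/-- The difference quotient of P/(1 + m) equals that of P, minus that of m times P(t)/(1 + m(t)),
all divided by 1 + m(τ). Since m is differentiable only in H^{s-1}, the product uses H^{s-1} ·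
H^{s-1} ⊂ L². -/
theorem hasDerivWithinAt_invMul (hsd : (d : ℝ) / 2 < s) (hs : 2 ≤ s) {m : ℝ → Sob D d s}
    {m' : ℝ → Sob D d (s - 1)} (hm : IsC1Curve s (s - 1) I m m')
    (hmδ : ∀ τ ∈ I, ∀ᵐ p, δ ≤ 1 + toL2 (m τ) p) {P : ℝ → Sob D d (s - 1)} {P' : XR D d}
    (ht : t ∈ I) (hP : HasDerivWithinAt (fun τ => toL2 (P τ)) P' I t) :
    HasDerivWithinAt (fun τ => invMul hδ (toL2 (m τ)) (toL2 (P τ)))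
      (invMul hδ (toL2 (m t)) (P' - invMul hδ (toL2 (m t))
        (toL2 (mul (s - 1) (s - 1) 0 (m' t) (P t))))) I t := by
  have hmd := hm.deriv t ht
  rw [hasDerivWithinAt_iff_tendsto_slope] at *
  set B : Sob D d (s - 1) →L[ℝ] XR D d :=
    toL2.comp ((mul (s - 1) (s - 1) 0).flip (P t)) with hB
  have hBa : ∀ x, B x = toL2 (mul (s - 1) (s - 1) 0 x (P t)) := fun x => rfl
  have hev : ∀ᶠ τ in 𝓝[I \ {t}] t, τ ∈ I := by
    filter_upwards [self_mem_nhdsWithin] with τ hτ using hτ.1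
  have hsl : ∀ᶠ τ in 𝓝[I \ {t}] t,
      invMul hδ (toL2 (m τ)) (slope (fun τ => toL2 (P τ)) t τ -
        invMul hδ (toL2 (m t)) (B (slope (fun τ => incl s (s - 1) (m τ)) t τ))) =
      slope (fun τ => invMul hδ (toL2 (m τ)) (toL2 (P τ))) t τ := by
    filter_upwards [hev] with τ hτ
    simp only [slope_def_module, map_smul, ← smul_sub]
    congr 1
    rw [← map_sub (incl s (s - 1)), hBa]
    apply Lp.ext
    set y := toL2 (mul (s - 1) (s - 1) 0 (incl s (s - 1) (m τ - m t)) (P t)) with hy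
    filter_upwards [invMul_ae hδ (hmδ τ hτ) ((toL2 (P τ) - toL2 (P t)) - invMul hδ (toL2 (m t)) y),
      Lp.coeFn_sub (toL2 (P τ) - toL2 (P t)) (invMul hδ (toL2 (m t)) y),
      Lp.coeFn_sub (toL2 (P τ)) (toL2 (P t)), invMul_ae hδ (hmδ t ht) y,
      toL2_mul (mulCond_lTwo hsd hs) (incl s (s - 1) (m τ - m t)) (P t),
      Lp.coeFn_sub (toL2 (m τ)) (toL2 (m t)),
      Lp.coeFn_sub (invMul hδ (toL2 (m τ)) (toL2 (P τ))) (invMul hδ (toL2 (m t)) (toL2 (P t))),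
      invMul_ae hδ (hmδ τ hτ) (toL2 (P τ)), invMul_ae hδ (hmδ t ht) (toL2 (P t)), hmδ τ hτ, hmδ t ht]
      with p h1 h2 h3 h4 h5 h6 h7 h8 h9 h10 h11
    rw [h1, h2, Pi.sub_apply, h3, Pi.sub_apply, h4, hy, h5, toL2_incl (by linarith) (by linarith),
      map_sub, h6, Pi.sub_apply, h7, Pi.sub_apply, h8, h9]
    have := (hδ.trans_le h10).ne'
    have := (hδ.trans_le h11).ne'
    field_simp
    ring
  refine Tendsto.congr' hsl (tendsto_invMul hδ hsd hs (hmδ t ht) (hev.mono fun τ hτ => hmδ τ hτ)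
    ((hm.cont₀ t ht).mono Set.sdiff_subset) (hP.sub ?_))
  exact (((invMul hδ (toL2 (m t))).continuous.comp B.continuous).tendsto _).comp hmd

end InvMul

/-! ### The second time derivative of the source relation -/

variable {D : Geometry} {d : ℕ} {s : ℝ} {I : Set ℝ} {t : ℝ}

theorem inner_eq_integral (f g : XR D d) : inner ℝ f g = ∫ x, g x * f x :=
  (integral_mul_eq_inner g f).symm

theorem integrable_lp_mul (f g : XR D d) : Integrable fun x => f x * g x :=
  (Lp.memLp f).integrable_mul (Lp.memLp g)

theorem integrable_lp_mul_add (f g h k : XR D d) : Integrable fun x => f x * g x + h x * k x :=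
  (integrable_lp_mul f g).add (integrable_lp_mul h k)

/-- Twice differentiating `lam A + (1 + m) q = 0` in time, if `q` has two derivatives in time of
which the second is only a distributional one. -/
theorem second_deriv_identity (hsd : (d : ℝ) / 2 < s) (hs : 2 ≤ s) (hI : UniqueDiffOn ℝ I)
    {δ : ℝ} (hδ : 0 < δ) {m : ℝ → Sob D d s} {m' : ℝ → Sob D d (s - 1)}
    {m'' : ℝ → Sob D d (s - 2)} (hm : IsC2Curve s I m m' m'')
    (hmδ : ∀ τ ∈ I, ∀ᵐ p, δ ≤ 1 + toL2 (m τ) p) {q : ℝ → Sob D d (s - 1)}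
    {q' : ℝ → Sob D d (s - 2)} (hq : IsC1Curve (s - 1) (s - 2) I q q') {lam : ℝ}
    {A' : ℝ → Sob D d (s - 1)} {A'' : ℝ → Sob D d (s - 2)}
    (hA : IsC1Curve (s - 1) (s - 2) I A' A'')
    (hid : ∀ τ ∈ I, ∀ᵐ p, lam * toL2 (A' τ) p + toL2 (m' τ) p * toL2 (q τ) p +
      (1 + toL2 (m τ) p) * toL2 (q' τ) p = 0) (ht : t ∈ I) {q'' : XR D d}
    (hq'' : ∀ φ : Pt D d → ℝ, IsTest φ →
      HasDerivWithinAt (fun τ => ∫ x, toL2 (q' τ) x * φ x) (∫ x, q'' x * φ x) I t) :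
    ∀ᵐ p, lam * toL2 (A'' t) p + toL2 (m'' t) p * toL2 (q t) p +
      2 * (toL2 (m' t) p * toL2 (q' t) p) + (1 + toL2 (m t) p) * q'' p = 0 := by
  have hs1 : 0 ≤ s - 1 := by linarith
  have hs2 : 0 ≤ s - 2 := by linarith
  have hs0 : 0 ≤ s := by linarith
  set Q : ℝ → XR D d →L[ℝ] XR D d := fun τ => invMul hδ (toL2 (m τ)) with hQdef
  have hQ : ∀ τ ∈ I, ∀ f, Q τ f =ᵐ[volume] fun p => f p / (1 + toL2 (m τ) p) := fun τ hτ f =>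
    invMul_ae hδ (hmδ τ hτ) f
  set N : XR D d := Q t (toL2 (A'' t)) with hN
  have hG : LocallyIntegrable (fun p => (-lam) * N p - toL2 (m'' t) p * Q t (toL2 (q t)) p -
      2 * (toL2 (m' t) p * Q t (toL2 (q' t)) p)) volume :=
    ((((Lp.memLp N).const_mul (-lam)).locallyIntegrable (by norm_num)).sub
      (integrable_lp_mul _ _).locallyIntegrable).sub
      ((integrable_lp_mul (toL2 (m' t)) (Q t (toL2 (q' t)))).const_mul 2).locallyIntegrable
  have key : q'' =ᵐ[volume] fun p => (-lam) * N p - toL2 (m'' t) p * Q t (toL2 (q t)) p -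
      2 * (toL2 (m' t) p * Q t (toL2 (q' t)) p) := by
    -- Since q'' is known only through smooth test functions, (1 + m)q' cannot be differentiated as
    -- a product. The relation is solved for q' instead, and the pairing of the quotient with φ is
    -- differentiated.
    refine ae_eq_of_integral_test (locallyIntegrable_lp q'') hG fun φ hφ => ?_
    obtain ⟨F, hF⟩ := hφ.exists_sob hs0
    set P₁ : Sob D d (s - 1) := incl s (s - 1) F with hP₁
    have hP₁a : toL2 P₁ =ᵐ[volume] φ := by
      rw [hP₁, toL2_incl hs1 (by linarith)]
      exact hF.symm
    have hc := hq.const_mul F (mulCond_zero_one hsd hs) (mulCond_zero_two hsd hs) (by linarith)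
      (by linarith)
    set P₂ : ℝ → Sob D d (s - 1) := fun τ => mul s (s - 1) (s - 1) F (q τ) with hP₂
    have hP₂a : ∀ τ, toL2 (P₂ τ) =ᵐ[volume] fun x => φ x * toL2 (q τ) x := fun τ => by
      filter_upwards [toL2_mul (mulCond_zero_one hsd hs) F (q τ), hF] with x h1 h2
      rw [hP₂, h1, h2]
    set R₂ : XR D d := toL2 (mul s (s - 2) (s - 2) F (q' t)) with hR₂
    have hR₂a : R₂ =ᵐ[volume] fun x => φ x * toL2 (q' t) x := by
      filter_upwards [toL2_mul (mulCond_zero_two hsd hs) F (q' t), hF] with x h1 h2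
      rw [hR₂, h1, h2]
    set b₁ : XR D d := toL2 (mul (s - 1) (s - 1) 0 (m' t) P₁) with hb₁
    set b₂ : XR D d := toL2 (mul (s - 1) (s - 1) 0 (m' t) (P₂ t)) with hb₂
    have d₁ : HasDerivWithinAt (fun τ => Q τ (toL2 P₁)) (Q t (0 - Q t b₁)) I t :=
      hasDerivWithinAt_invMul hδ hsd hs hm.fst hmδ (P := fun _ => P₁) ht
        (hasDerivWithinAt_const _ _ _)
    have d₂ : HasDerivWithinAt (fun τ => Q τ (toL2 (P₂ τ))) (Q t (R₂ - Q t b₂)) I t :=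
      hasDerivWithinAt_invMul hδ hsd hs hm.fst hmδ ht
        (hc.hasDerivWithinAt_toL2 hs2 (by linarith) ht)
    have dA := hA.hasDerivWithinAt_toL2 hs2 (by linarith) ht
    have dm := hm.snd.hasDerivWithinAt_toL2 hs2 (by linarith) ht
    -- The pairing is -λ⟨A', φ/(1 + m)⟩ - ⟨m', φq/(1 + m)⟩, and every curve in these inner products
    -- is differentiable in L².
    have hexp : ∀ τ ∈ I, ∫ x, toL2 (q' τ) x * φ x =
        -lam * inner ℝ (toL2 (A' τ)) (Q τ (toL2 P₁)) -
          inner ℝ (toL2 (m' τ)) (Q τ (toL2 (P₂ τ))) := by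
      intro τ hτ
      rw [inner_eq_integral, inner_eq_integral, ← integral_const_mul,
        ← integral_sub ((integrable_lp_mul _ _).const_mul _) (integrable_lp_mul _ _)]
      refine integral_congr_ae ?_
      filter_upwards [hid τ hτ, hQ τ hτ (toL2 P₁), hQ τ hτ (toL2 (P₂ τ)), hP₁a, hP₂a τ, hmδ τ hτ]
        with x h1 h2 h3 h4 h5 h6
      rw [h2, h3, h4, h5]
      have hne := (hδ.trans_le h6).ne'
      field_simp
      linear_combination φ x * h1
    have hder := ((dA.inner ℝ d₁).const_mul (-lam)).sub (dm.inner ℝ d₂)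
    have hder' : HasDerivWithinAt (fun τ => ∫ x, toL2 (q' τ) x * φ x) _ I t :=
      hder.congr hexp (hexp t ht)
    rw [(hI t ht).eq_deriv _ (hq'' φ hφ) hder']
    simp only [inner_eq_integral]
    rw [← integral_add (integrable_lp_mul _ _) (integrable_lp_mul _ _),
      ← integral_add (integrable_lp_mul _ _) (integrable_lp_mul _ _), ← integral_const_mul,
      ← integral_sub ((integrable_lp_mul_add _ _ _ _).const_mul _)
        (integrable_lp_mul_add _ _ _ _)]
    refine integral_congr_ae ?_
    filter_upwards [hid t ht, hQ t ht (0 - Q t b₁), Lp.coeFn_sub 0 (Q t b₁), Lp.coeFn_zero ℝ 2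
      (volume : Measure (Pt D d)), hQ t ht b₁, hQ t ht (R₂ - Q t b₂), Lp.coeFn_sub R₂ (Q t b₂),
      hQ t ht b₂, toL2_mul (mulCond_lTwo hsd hs) (m' t) P₁,
      toL2_mul (mulCond_lTwo hsd hs) (m' t) (P₂ t), hP₁a, hP₂a t, hR₂a, hmδ t ht,
      hQ t ht (toL2 (A'' t)), hQ t ht (toL2 (q t)), hQ t ht (toL2 (q' t)), hQ t ht (toL2 P₁),
      hQ t ht (toL2 (P₂ t))]
      with x h1 h2 h3 h4 h5 h6 h7 h8 h9 h10 h11 h12 h13 h14 h15 h16 h17 h18 h19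
    rw [h2, h3, Pi.sub_apply, h4, h5, h6, h7, Pi.sub_apply, h8, h13, hN, h15, h16, h17, h18, h19,
      hb₁, hb₂, h9, h10, h11, h12]
    have hne := (hδ.trans_le h14).ne'
    simp only [Pi.zero_apply]
    field_simp
    -- The quotients leave m'(λA' + m'q)/(1 + m)², which the relation at time t turns into -m'q'/(1
    -- + m): hence the factor 2 in front of m'q'.
    linear_combination φ x * toL2 (m' t) x * h1
  filter_upwards [key, hQ t ht (toL2 (A'' t)), hQ t ht (toL2 (q t)), hQ t ht (toL2 (q' t)), hmδ t ht]
    with p h1 h2 h3 h4 h5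
  rw [h1, hN, h2, h3, h4]
  have hne := (hδ.trans_le h5).ne'
  field_simp
  ring

/-! ### Time derivative of ∂ₜẇ against test functions -/

variable {D : Geometry} {d : ℕ} {s : ℝ} {I : Set ℝ} {t : ℝ}

theorem IsC1Curve.pd_two {σ : ℝ → Sob D d s} {σ' : ℝ → Sob D d (s - 1)} (hs : 2 ≤ s)
    (h : IsC1Curve s (s - 1) I σ σ') (i : Fin d) :
    IsC1Curve (s - 1) (s - 2) I (fun t => FavrieGavrilyuk.pd s (s - 1) i (σ t))
      (fun t => FavrieGavrilyuk.pd (s - 1) (s - 2) i (σ' t)) := by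
  have := h.pd (by linarith) (by linarith) i
  rwa [show s - 1 - 1 = s - 2 by ring] at this

/-- The distributional time derivative of `∂ₜ(v ∂ᵢy)` when `∂ₜ²y` is in `H^{s-1}`. -/
theorem hasDerivWithinAt_transport_test (hsd : (d : ℝ) / 2 < s) (hs : 2 ≤ s)
    {v : ℝ → Sob D d s} {v' : ℝ → Sob D d (s - 1)}
    {v'' : ℝ → Sob D d (s - 2)} (hv : IsC2Curve s I v v' v'') {y : ℝ → Sob D d s}
    {y' : ℝ → Sob D d (s - 1)} {y'' : ℝ → Sob D d (s - 2)} (hy : IsC2Curve s I y y' y'')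
    (ht : t ∈ I) {w₂ : Sob D d (s - 1)} (h₂ : toL2 w₂ = toL2 (y'' t)) (i : Fin d)
    {φ : Pt D d → ℝ} (hφ : IsTest φ) :
    HasDerivWithinAt (fun τ => ∫ x, (toL2 (v' τ) x * toL2 (pd s 0 i (y τ)) x +
        toL2 (v τ) x * toL2 (pd (s - 1) 0 i (y' τ)) x) * φ x)
      (∫ x, (toL2 (v'' t) x * toL2 (pd s 0 i (y t)) x +
        2 * (toL2 (v' t) x * toL2 (pd (s - 1) 0 i (y' t)) x) +
        toL2 (v t) x * toL2 (pd (s - 1) 0 i w₂) x) * φ x) I t := by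
  have hs2 : 0 ≤ s - 2 := by linarith
  have hss : MulCond d s s s := ⟨by linarith, le_rfl, le_rfl, by linarith⟩
  obtain ⟨F, hF⟩ := hφ.exists_sob (by linarith : 0 ≤ s)
  have c₁ := (hy.fst.pd_two hs i).const_mul F (mulCond_zero_one hsd hs) (mulCond_zero_two hsd hs)
    (by linarith) (by linarith)
  have c₂ := (hv.fst.const_mul F hss (mulCond_zero_one hsd hs) (by linarith)
    (by linarith)).pd_two hs i
  have ep : ∀ x : Sob D d s, toL2 (pd s (s - 1) i x) = toL2 (pd s 0 i x) := fun x =>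
    toL2_pd_congr (by linarith) (by linarith) le_rfl (by linarith) i rfl
  have ep' : ∀ x : Sob D d (s - 1), toL2 (pd (s - 1) (s - 2) i x) = toL2 (pd (s - 1) 0 i x) :=
    fun x => toL2_pd_congr (by linarith) (by linarith) le_rfl (by linarith) i rfl
  have m₁ : ∀ x : Sob D d s, toL2 (mul s (s - 1) (s - 1) F (pd s (s - 1) i x)) =ᵐ[volume]
      fun p => φ p * toL2 (pd s 0 i x) p := fun x => by
    filter_upwards [toL2_mul (mulCond_zero_one hsd hs) F (pd s (s - 1) i x), hF] with p e1 e2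
    rw [e1, e2, ep]
  have m₂ : ∀ x : Sob D d (s - 1), toL2 (mul s (s - 2) (s - 2) F (pd (s - 1) (s - 2) i x))
      =ᵐ[volume] fun p => φ p * toL2 (pd (s - 1) 0 i x) p := fun x => by
    filter_upwards [toL2_mul (mulCond_zero_two hsd hs) F (pd (s - 1) (s - 2) i x), hF] with p e1 e2
    rw [e1, e2, ep']
  have n₁ : ∀ x : Sob D d s, toL2 (mul s s s F x) =ᵐ[volume] fun p => φ p * toL2 x p := fun x => by
    filter_upwards [toL2_mul hss F x, hF] with p e1 e2
    rw [e1, e2]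
  have n₂ : ∀ x : Sob D d (s - 1), toL2 (mul s (s - 1) (s - 1) F x) =ᵐ[volume]
      fun p => φ p * toL2 x p := fun x => by
    filter_upwards [toL2_mul (mulCond_zero_one hsd hs) F x, hF] with p e1 e2
    rw [e1, e2]
  -- The space derivative of y' is moved onto φv: y' is differentiable in L², but its gradient need
  -- not be.
  have hexp : ∀ τ ∈ I, ∫ x, (toL2 (v' τ) x * toL2 (pd s 0 i (y τ)) x +
        toL2 (v τ) x * toL2 (pd (s - 1) 0 i (y' τ)) x) * φ x =
      inner ℝ (toL2 (v' τ)) (toL2 (mul s (s - 1) (s - 1) F (pd s (s - 1) i (y τ)))) -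
        inner ℝ (toL2 (y' τ)) (toL2 (pd s (s - 1) i (mul s s s F (v τ)))) := fun τ _ => by
    rw [inner_eq_integral, inner_eq_integral, ep, integral_pd_mul (by linarith) (by linarith),
      sub_neg_eq_add, ← integral_add (integrable_lp_mul _ _) (integrable_lp_mul _ _)]
    refine integral_congr_ae ?_
    filter_upwards [m₁ (y τ), n₁ (v τ)] with x e1 e2
    rw [e1, e2]
    ring
  have dv := hv.snd.hasDerivWithinAt_toL2 hs2 (by linarith) ht
  have dy := hy.snd.hasDerivWithinAt_toL2 hs2 (by linarith) ht
  have d₁ := c₁.hasDerivWithinAt_toL2 hs2 (by linarith) ht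
  have d₂ := c₂.hasDerivWithinAt_toL2 hs2 (by linarith) ht
  have hder := ((dv.inner ℝ d₁).sub (dy.inner ℝ d₂)).congr hexp (hexp t ht)
  refine hder.congr_deriv ?_
  -- At the time t itself the second derivative of y is in H^{s-1}, so the integration by parts can
  -- be undone.
  rw [← h₂]
  simp only [inner_eq_integral]
  rw [ep, ep', integral_pd_mul (by linarith) (by linarith),
    integral_pd_mul (by linarith) (by linarith), ← neg_add, sub_neg_eq_add,
    ← integral_add (integrable_lp_mul _ _) (integrable_lp_mul _ _),
    ← integral_add (integrable_lp_mul _ _) (integrable_lp_mul _ _),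
    ← integral_add (integrable_lp_mul_add _ _ _ _) (integrable_lp_mul_add _ _ _ _)]
  refine integral_congr_ae ?_
  filter_upwards [m₁ (y t), m₂ (y' t), n₁ (v t), n₂ (v' t)] with x e1 e2 e3 e4
  rw [e1, e2, e3, e4]
  ring

theorem toL2_matOneDeriv (hsd : (d : ℝ) / 2 < s) (hs : 2 ≤ s) (u : Fin d → Sob D d s)
    (u' : Fin d → Sob D d (s - 1)) (a : Sob D d s) (b : Sob D d (s - 1)) (c : Sob D d (s - 2)) :
    toL2 (matOneDeriv u u' a b c) =ᵐ[volume] fun x => toL2 c x +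
      ∑ i, (toL2 (u' i) x * toL2 (pd s 0 i a) x + toL2 (u i) x * toL2 (pd (s - 1) 0 i b) x) := by
  rw [matOneDeriv, map_add, map_sum]
  have e := fun i => toL2_pd_congr (β := s - 1) (by linarith) (by linarith) le_rfl
    (by linarith : 0 + 1 ≤ s) i (rfl : toL2 a = toL2 a)
  have e' := fun i => toL2_pd_congr (β := s - 2) (by linarith) (by linarith) le_rfl
    (by linarith : 0 + 1 ≤ s - 1) i (rfl : toL2 b = toL2 b)
  set X := fun i => mul (s - 1) (s - 1) (s - 2) (u' i) (pd s (s - 1) i a)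
  set Y := fun i => mul s (s - 2) (s - 2) (u i) (pd (s - 1) (s - 2) i b)
  filter_upwards [Lp.coeFn_add (toL2 c) (∑ i, toL2 (X i + Y i)),
    coeFn_lp_sum Finset.univ fun i => toL2 (X i + Y i),
    ae_all_iff.2 fun i => Lp.coeFn_add (toL2 (X i)) (toL2 (Y i)),
    ae_all_iff.2 fun i => toL2_mul (mulCond_one_one hsd hs) (u' i) (pd s (s - 1) i a),
    ae_all_iff.2 fun i => toL2_mul (mulCond_zero_two hsd hs) (u i) (pd (s - 1) (s - 2) i b)]
    with x h1 h2 h3 h4 h5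
  rw [h1, Pi.add_apply, h2]
  congr 1
  refine Finset.sum_congr rfl fun i _ => ?_
  rw [map_add, h3, Pi.add_apply, h4, h5, e, e']

/-- The second time derivative of the material derivative of `w`, in terms of representatives of
`∂ₜʲ w` in `H^{s+1-j}`. -/
noncomputable def matOneDeriv₂ (u : Fin d → Sob D d s) (u' : Fin d → Sob D d (s - 1))
    (u'' : Fin d → Sob D d (s - 2)) (w₀ : Sob D d (s + 1)) (w₁ : Sob D d s) (w₂ : Sob D d (s - 1))
    (w₃ : Sob D d (s - 2)) : Sob D d (s - 2) :=
  w₃ + ∑ i, (mul s (s - 2) (s - 2) (pd (s + 1) s i w₀) (u'' i) +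
    (2 : ℝ) • mul (s - 1) (s - 1) (s - 2) (u' i) (pd s (s - 1) i w₁) +
    mul s (s - 2) (s - 2) (u i) (pd (s - 1) (s - 2) i w₂))

theorem toL2_matOneDeriv₂ (hsd : (d : ℝ) / 2 < s) (hs : 2 ≤ s) (u : Fin d → Sob D d s)
    (u' : Fin d → Sob D d (s - 1)) (u'' : Fin d → Sob D d (s - 2)) (w₀ : Sob D d (s + 1))
    (w₁ : Sob D d s) (w₂ : Sob D d (s - 1)) (w₃ : Sob D d (s - 2)) :
    toL2 (matOneDeriv₂ u u' u'' w₀ w₁ w₂ w₃) =ᵐ[volume] fun x => toL2 w₃ x +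
      ∑ i, (toL2 (u'' i) x * toL2 (pd (s + 1) 0 i w₀) x +
        2 * (toL2 (u' i) x * toL2 (pd s 0 i w₁) x) +
        toL2 (u i) x * toL2 (pd (s - 1) 0 i w₂) x) := by
  rw [matOneDeriv₂, map_add, map_sum]
  have e := fun i => toL2_pd_congr (α := s + 1) (β := s) (by linarith) (by linarith) le_rfl
    (by linarith : 0 + 1 ≤ s + 1) i (rfl : toL2 w₀ = toL2 w₀)
  have e' := fun i => toL2_pd_congr (β := s - 1) (by linarith) (by linarith) le_rfl
    (by linarith : 0 + 1 ≤ s) i (rfl : toL2 w₁ = toL2 w₁)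
  have e'' := fun i => toL2_pd_congr (β := s - 2) (by linarith) (by linarith) le_rfl
    (by linarith : 0 + 1 ≤ s - 1) i (rfl : toL2 w₂ = toL2 w₂)
  set X := fun i => mul s (s - 2) (s - 2) (pd (s + 1) s i w₀) (u'' i)
  set Y := fun i => mul (s - 1) (s - 1) (s - 2) (u' i) (pd s (s - 1) i w₁)
  set Z := fun i => mul s (s - 2) (s - 2) (u i) (pd (s - 1) (s - 2) i w₂)
  filter_upwards [Lp.coeFn_add (toL2 w₃) (∑ i, toL2 (X i + (2 : ℝ) • Y i + Z i)),
    coeFn_lp_sum Finset.univ fun i => toL2 (X i + (2 : ℝ) • Y i + Z i),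
    ae_all_iff.2 fun i => Lp.coeFn_add (toL2 (X i) + (2 : ℝ) • toL2 (Y i)) (toL2 (Z i)),
    ae_all_iff.2 fun i => Lp.coeFn_add (toL2 (X i)) ((2 : ℝ) • toL2 (Y i)),
    ae_all_iff.2 fun i => Lp.coeFn_smul (2 : ℝ) (toL2 (Y i)),
    ae_all_iff.2 fun i => toL2_mul (mulCond_zero_two hsd hs) (pd (s + 1) s i w₀) (u'' i),
    ae_all_iff.2 fun i => toL2_mul (mulCond_one_one hsd hs) (u' i) (pd s (s - 1) i w₁),
    ae_all_iff.2 fun i => toL2_mul (mulCond_zero_two hsd hs) (u i) (pd (s - 1) (s - 2) i w₂)]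
    with x h1 h2 h3 h4 h5 h6 h7 h8
  rw [h1, Pi.add_apply, h2]
  congr 1
  refine Finset.sum_congr rfl fun i _ => ?_
  rw [map_add, map_add, map_smul, h3, Pi.add_apply, h4, Pi.add_apply, h5, Pi.smul_apply, h6, h7, h8,
    e, e', e'', smul_eq_mul]
  ring

/-- The elements w₀, …, w₃ express the additional regularity at the single time t; at other times
only the regularity of the curves is used. -/
theorem hasDerivWithinAt_matOneDeriv_test (hsd : (d : ℝ) / 2 < s) (hs : 2 ≤ s)
    {u : Fin d → ℝ → Sob D d s} {u' : Fin d → ℝ → Sob D d (s - 1)}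
    {u'' : Fin d → ℝ → Sob D d (s - 2)} (hu : ∀ i, IsC2Curve s I (u i) (u' i) (u'' i))
    {y : ℝ → Sob D d s} {y' : ℝ → Sob D d (s - 1)} {y'' : ℝ → Sob D d (s - 2)}
    (hy : IsC2Curve s I y y' y'') (ht : t ∈ I) {w₀ : Sob D d (s + 1)} {w₁ : Sob D d s}
    {w₂ : Sob D d (s - 1)} {w₃ : Sob D d (s - 2)} (h₀ : toL2 w₀ = toL2 (y t))
    (h₁ : toL2 w₁ = toL2 (y' t)) (h₂ : toL2 w₂ = toL2 (y'' t)) {φ : Pt D d → ℝ} (hφ : IsTest φ)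
    (h₃ : HasDerivWithinAt (fun τ => ∫ x, toL2 (y'' τ) x * φ x) (∫ x, toL2 w₃ x * φ x) I t) :
    HasDerivWithinAt (fun τ => ∫ x, toL2 (matOneDeriv (fun i => u i τ) (fun i => u' i τ) (y τ)
        (y' τ) (y'' τ)) x * φ x)
      (∫ x, toL2 (matOneDeriv₂ (fun i => u i t) (fun i => u' i t) (fun i => u'' i t)
        w₀ w₁ w₂ w₃) x * φ x) I t := by
  obtain ⟨C, hC⟩ := hφ.exists_bound
  have hint : ∀ f g : XR D d, Integrable fun x => f x * g x * φ x := fun f g =>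
    (integrable_lp_mul f g).mul_bdd (c := C) hφ.continuous.aestronglyMeasurable
      (Eventually.of_forall hC)
  have hint0 : ∀ f : XR D d, Integrable fun x => f x * φ x := fun f =>
    (Lp.memLp f).integrable_mul (hφ.memLp 2)
  have e0 := fun i => toL2_pd_congr (α := s + 1) (α' := s) (β := 0) (β' := 0) le_rfl (by linarith)
    le_rfl (by linarith) i h₀
  have e1 := fun i => toL2_pd_congr (α := s) (α' := s - 1) (β := 0) (β' := 0) le_rfl (by linarith)
    le_rfl (by linarith) i h₁
  have hexp : ∀ τ, ∫ x, toL2 (matOneDeriv (fun i => u i τ) (fun i => u' i τ) (y τ)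
        (y' τ) (y'' τ)) x * φ x = (∫ x, toL2 (y'' τ) x * φ x) +
      ∑ i, ∫ x, (toL2 (u' i τ) x * toL2 (pd s 0 i (y τ)) x +
        toL2 (u i τ) x * toL2 (pd (s - 1) 0 i (y' τ)) x) * φ x := fun τ => by
    have hi : ∀ i, Integrable fun x => (toL2 (u' i τ) x * toL2 (pd s 0 i (y τ)) x +
        toL2 (u i τ) x * toL2 (pd (s - 1) 0 i (y' τ)) x) * φ x := fun i => by
      simp only [add_mul]
      exact (hint _ _).add (hint _ _)
    rw [← integral_finsetSum _ fun i _ => hi i,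
      ← integral_add (hint0 _) (integrable_finsetSum _ fun i _ => hi i)]
    refine integral_congr_ae ?_
    filter_upwards [toL2_matOneDeriv hsd hs (fun i => u i τ) (fun i => u' i τ) (y τ) (y' τ) (y'' τ)]
      with x hx
    rw [hx, add_mul, Finset.sum_mul]
  have hder := h₃.fun_add (HasDerivWithinAt.fun_sum (u := Finset.univ) fun i _ =>
    hasDerivWithinAt_transport_test hsd hs (hu i) hy ht h₂ i hφ)
  refine (hder.congr (fun τ _ => hexp τ) (hexp t)).congr_deriv ?_
  have hi : ∀ i, Integrable fun x => (toL2 (u'' i t) x * toL2 (pd s 0 i (y t)) x +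
      2 * (toL2 (u' i t) x * toL2 (pd (s - 1) 0 i (y' t)) x) +
      toL2 (u i t) x * toL2 (pd (s - 1) 0 i w₂) x) * φ x := fun i => by
    simp only [add_mul, mul_assoc (2 : ℝ)]
    exact ((hint _ _).add ((hint _ _).const_mul 2)).add (hint _ _)
  rw [← integral_finsetSum _ fun i _ => hi i,
    ← integral_add (hint0 _) (integrable_finsetSum _ fun i _ => hi i)]
  refine integral_congr_ae ?_
  filter_upwards [toL2_matOneDeriv₂ hsd hs (fun i => u i t) (fun i => u' i t) (fun i => u'' i t)
    w₀ w₁ w₂ w₃] with x hx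
  rw [hx, add_mul, Finset.sum_mul]
  simp only [e0, e1]

/-! ### Bounds on η - h in terms of w -/

variable {D : Geometry} {d : ℕ} {s : ℝ} {I : Set ℝ} {t : ℝ}

theorem mulCond_zero_zero (hsd : (d : ℝ) / 2 < s) (hs : 2 ≤ s) : MulCond d s s s :=
  ⟨by linarith, le_rfl, le_rfl, by linarith⟩

theorem coeFn_toL2_add {σ : ℝ} (x y : Sob D d σ) :
    toL2 (x + y) =ᵐ[volume] fun p => toL2 x p + toL2 y p := by
  rw [map_add]
  exact Lp.coeFn_add _ _

theorem coeFn_toL2_sub {σ : ℝ} (x y : Sob D d σ) :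
    toL2 (x - y) =ᵐ[volume] fun p => toL2 x p - toL2 y p := by
  rw [map_sub]
  exact Lp.coeFn_sub _ _

theorem coeFn_toL2_smul {σ : ℝ} (c : ℝ) (x : Sob D d σ) :
    toL2 (c • x) =ᵐ[volume] fun p => c * toL2 x p := by
  rw [map_smul]
  exact Lp.coeFn_smul _ _

section Square

/-- `(1 + ζ)² - 1`. -/
noncomputable def sqSub (z : Sob D d s) : Sob D d s := z + z + mul s s s z z

/-- The first time derivative of `(1 + ζ)² - 1`. -/
noncomputable def sqSubDeriv (z : Sob D d s) (z' : Sob D d (s - 1)) : Sob D d (s - 1) :=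
  z' + z' + (mul s (s - 1) (s - 1) z z' + mul s (s - 1) (s - 1) z z')

/-- The second time derivative of `(1 + ζ)² - 1`. -/
noncomputable def sqSubDeriv₂ (z : Sob D d s) (z' : Sob D d (s - 1)) (z'' : Sob D d (s - 2)) :
    Sob D d (s - 2) :=
  z'' + z'' + ((mul (s - 1) (s - 1) (s - 2) z' z' + mul s (s - 2) (s - 2) z z'') +
    (mul (s - 1) (s - 1) (s - 2) z' z' + mul s (s - 2) (s - 2) z z''))

theorem toL2_sqSub (hsd : (d : ℝ) / 2 < s) (hs : 2 ≤ s) (z : Sob D d s) :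
    toL2 (sqSub z) =ᵐ[volume] fun p => (1 + toL2 z p) ^ 2 - 1 := by
  filter_upwards [coeFn_toL2_add (z + z) (mul s s s z z), coeFn_toL2_add z z,
    toL2_mul (mulCond_zero_zero hsd hs) z z] with p h1 h2 h3
  rw [sqSub, h1, h2, h3]
  ring

theorem IsC2Curve.sqSub (hsd : (d : ℝ) / 2 < s) (hs : 2 ≤ s) {z : ℝ → Sob D d s}
    {z' : ℝ → Sob D d (s - 1)} {z'' : ℝ → Sob D d (s - 2)} (h : IsC2Curve s I z z' z'') :
    IsC2Curve s I (fun t => FavrieGavrilyuk.sqSub (z t)) (fun t => sqSubDeriv (z t) (z' t))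
      (fun t => sqSubDeriv₂ (z t) (z' t) (z'' t)) := by
  have hc : MulCond d (s - 1) s (s - 1) := ⟨by linarith, le_rfl, by linarith, by linarith⟩
  have e : ∀ (x : Sob D d (s - 1)) (y : Sob D d s),
      mul (s - 1) s (s - 1) x y = mul s (s - 1) (s - 1) y x := fun x y => by
    refine toL2_injective (by linarith) (Lp.ext ?_)
    filter_upwards [toL2_mul hc x y, toL2_mul (mulCond_zero_one hsd hs) y x] with p h1 h2
    rw [h1, h2, mul_comm]
  have h1 := h.fst.mul h.fst (mulCond_zero_zero hsd hs) hc (mulCond_zero_one hsd hs) (by linarith)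
    (by linarith) (by linarith)
  simp only [e] at h1
  have h2 := h.fst.mul h.snd (mulCond_zero_one hsd hs) (mulCond_one_one hsd hs)
    (mulCond_zero_two hsd hs) (by linarith) (by linarith) (by linarith)
  exact ⟨(h.fst.add h.fst).add h1, (h.snd.add h.snd).add (h2.add h2)⟩

variable {M : ℝ}

/-- In this bound and the two on time derivatives below, the constants 3, 4, 6 count the terms, each
at most (K(1 + M))² with K = `mulBound D d s`. -/
theorem norm_sqSub_le {z : Sob D d s} (hz : ‖z‖ ≤ M) :
    ‖sqSub z‖ ≤ 3 * (mulBound D d s * (1 + M)) ^ 2 := by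
  have hK := one_le_mulBound (D := D) (d := d) (s := s)
  have hM0 : 0 ≤ M := (norm_nonneg z).trans hz
  have h1 : ‖mul s s s z z‖ ≤ mulBound D d s * M * M :=
    (norm_mul_zero_zero_le z z).trans (by gcongr)
  have h2 := norm_add₃_le (a := z) (b := z) (c := mul s s s z z)
  refine (h2.trans (add_le_add (add_le_add hz hz) h1)).trans ?_
  nlinarith [mul_nonneg (sub_nonneg.2 hK) hM0, mul_nonneg (sub_nonneg.2 hK) (mul_nonneg hM0 hM0),
    sq_nonneg (mulBound D d s - 1), mul_nonneg (mul_nonneg (sub_nonneg.2 hK) hM0) hM0,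
    mul_nonneg (sq_nonneg (mulBound D d s - 1)) (sq_nonneg (1 + M))]

theorem norm_sqSubDeriv_le {z : Sob D d s} {z' : Sob D d (s - 1)} (hz : ‖z‖ ≤ M) (hz' : ‖z'‖ ≤ M) :
    ‖sqSubDeriv z z'‖ ≤ 4 * (mulBound D d s * (1 + M)) ^ 2 := by
  have hK := one_le_mulBound (D := D) (d := d) (s := s)
  have hM0 : 0 ≤ M := (norm_nonneg z).trans hz
  have h1 : ‖mul s (s - 1) (s - 1) z z'‖ ≤ mulBound D d s * M * M :=
    (norm_mul_zero_one_le z z').trans (by gcongr)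
  have h2 := norm_add₃_le (a := z') (b := z')
    (c := mul s (s - 1) (s - 1) z z' + mul s (s - 1) (s - 1) z z')
  refine (h2.trans (add_le_add (add_le_add hz' hz')
    ((norm_add_le _ _).trans (add_le_add h1 h1)))).trans ?_
  nlinarith [mul_nonneg (sub_nonneg.2 hK) hM0, mul_nonneg (sub_nonneg.2 hK) (mul_nonneg hM0 hM0),
    sq_nonneg (mulBound D d s - 1), mul_nonneg (sq_nonneg (mulBound D d s - 1)) (sq_nonneg (1 + M))]

theorem norm_sqSubDeriv₂_le {z : Sob D d s} {z' : Sob D d (s - 1)} {z'' : Sob D d (s - 2)}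
    (hz : ‖z‖ ≤ M) (hz' : ‖z'‖ ≤ M) (hz'' : ‖z''‖ ≤ M) :
    ‖sqSubDeriv₂ z z' z''‖ ≤ 6 * (mulBound D d s * (1 + M)) ^ 2 := by
  have hK := one_le_mulBound (D := D) (d := d) (s := s)
  have hM0 : 0 ≤ M := (norm_nonneg z).trans hz
  have h1 : ‖mul s (s - 2) (s - 2) z z''‖ ≤ mulBound D d s * M * M :=
    (norm_mul_zero_two_le z z'').trans (by gcongr)
  have h1' : ‖mul (s - 1) (s - 1) (s - 2) z' z'‖ ≤ mulBound D d s * M * M :=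
    (norm_mul_one_one_le z' z').trans (by gcongr)
  have h3 := (norm_add_le (mul (s - 1) (s - 1) (s - 2) z' z') (mul s (s - 2) (s - 2) z z'')).trans
    (add_le_add h1' h1)
  have h2 := norm_add₃_le (a := z'') (b := z'')
    (c := (mul (s - 1) (s - 1) (s - 2) z' z' + mul s (s - 2) (s - 2) z z'') +
      (mul (s - 1) (s - 1) (s - 2) z' z' + mul s (s - 2) (s - 2) z z''))
  refine (h2.trans (add_le_add (add_le_add hz'' hz'')
    ((norm_add_le _ _).trans (add_le_add h3 h3)))).trans ?_
  nlinarith [mul_nonneg (sub_nonneg.2 hK) hM0, mul_nonneg (sub_nonneg.2 hK) (mul_nonneg hM0 hM0),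
    sq_nonneg (mulBound D d s - 1), mul_nonneg (sq_nonneg (mulBound D d s - 1)) (sq_nonneg (1 + M))]

end Square

section Source

/-- The material derivative of `w`, in terms of `w ∈ H^{s+1}` and `∂ₜw ∈ H^s`. -/
noncomputable def matSmooth (u : Fin d → Sob D d s) (w₀ : Sob D d (s + 1)) (w₁ : Sob D d s) :
    Sob D d s :=
  w₁ + ∑ i, mul s s s (u i) (pd (s + 1) s i w₀)

/-- The time derivative of the material derivative of `w`, in terms of `∂ₜʲw ∈ H^{s+1-j}`. -/
noncomputable def matSmoothDeriv (u : Fin d → Sob D d s) (u' : Fin d → Sob D d (s - 1))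
    (w₀ : Sob D d (s + 1)) (w₁ : Sob D d s) (w₂ : Sob D d (s - 1)) : Sob D d (s - 1) :=
  w₂ + ∑ i, (mul s (s - 1) (s - 1) (pd (s + 1) s i w₀) (u' i) +
    mul s (s - 1) (s - 1) (u i) (pd s (s - 1) i w₁))

variable {u : Fin d → Sob D d s} {u' : Fin d → Sob D d (s - 1)} {u'' : Fin d → Sob D d (s - 2)}
  {w₀ : Sob D d (s + 1)} {w₁ : Sob D d s} {w₂ : Sob D d (s - 1)} {w₃ : Sob D d (s - 2)} {M : ℝ}

/-- One more order on w and ∂ₜw at time t upgrades ẇ from H^{s-1} to H^s, the order required to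
bound η - h in H^s. -/
theorem toL2_matSmooth (hsd : (d : ℝ) / 2 < s) (hs : 2 ≤ s) {a : Sob D d s} {b : Sob D d (s - 1)}
    (h₀ : toL2 w₀ = toL2 a) (h₁ : toL2 w₁ = toL2 b) :
    toL2 (matSmooth u w₀ w₁) = toL2 (matOne u a b) := by
  rw [matSmooth, matOne, map_add, map_add, map_sum, map_sum, h₁]
  congr 1
  refine Finset.sum_congr rfl fun i _ => ?_
  exact toL2_mul_congr (mulCond_zero_zero hsd hs) (mulCond_zero_one hsd hs) rfl
    (toL2_pd_congr (by linarith) (by linarith) (by linarith) (by linarith) i h₀)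

theorem toL2_matSmoothDeriv (hsd : (d : ℝ) / 2 < s) (hs : 2 ≤ s) {a : Sob D d s}
    {b : Sob D d (s - 1)} {c : Sob D d (s - 2)} (h₀ : toL2 w₀ = toL2 a) (h₁ : toL2 w₁ = toL2 b)
    (h₂ : toL2 w₂ = toL2 c) :
    toL2 (matSmoothDeriv u u' w₀ w₁ w₂) = toL2 (matOneDeriv u u' a b c) := by
  rw [matSmoothDeriv, matOneDeriv, map_add, map_add, map_sum, map_sum, h₂]
  congr 1
  refine Finset.sum_congr rfl fun i _ => ?_
  rw [map_add, map_add]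
  congr 1
  · apply Lp.ext
    have e := toL2_pd_congr (β := s) (β' := s - 1) (by linarith) (by linarith) (by linarith)
      (by linarith) i h₀
    filter_upwards [toL2_mul (mulCond_zero_one hsd hs) (pd (s + 1) s i w₀) (u' i),
      toL2_mul (mulCond_one_one hsd hs) (u' i) (pd s (s - 1) i a)] with p h3 h4
    rw [h3, h4, e, mul_comm]
  · exact toL2_mul_congr (mulCond_zero_one hsd hs) (mulCond_zero_two hsd hs) rfl
      (toL2_pd_congr (by linarith) (by linarith) (by linarith) (by linarith) i h₁)

theorem norm_matSmooth_le (hs : 2 ≤ s) (hM : ∑ i, ‖u i‖ ≤ M) :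
    ‖matSmooth u w₀ w₁‖ ≤ mulBound D d s * (1 + M) * (‖w₀‖ + ‖w₁‖) := by
  have hK := one_le_mulBound (D := D) (d := d) (s := s)
  have hM0 : 0 ≤ M := (Finset.sum_nonneg fun i _ => norm_nonneg _).trans hM
  have h1 : ‖∑ i, mul s s s (u i) (pd (s + 1) s i w₀)‖ ≤ mulBound D d s * M * ‖w₀‖ :=
    norm_sum_mul_le (by linarith) (norm_nonneg _) (fun i =>
      (norm_mul_zero_zero_le _ _).trans (by
        gcongr
        exact norm_pd_le (by linarith) le_rfl i w₀)) hM
  refine (norm_add_le _ _).trans ((add_le_add le_rfl h1).trans ?_)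
  have : ‖w₁‖ ≤ mulBound D d s * ‖w₁‖ := le_mul_of_one_le_left (norm_nonneg _) hK
  nlinarith [mul_nonneg (zero_le_one.trans hK) (norm_nonneg w₀),
    mul_nonneg (mul_nonneg (zero_le_one.trans hK) hM0) (norm_nonneg w₁)]

theorem norm_matSmoothDeriv_le (hs : 2 ≤ s) (hM : ∑ i, ‖u i‖ ≤ M) (hM' : ∑ i, ‖u' i‖ ≤ M) :
    ‖matSmoothDeriv u u' w₀ w₁ w₂‖ ≤ mulBound D d s * (1 + M) * (‖w₀‖ + ‖w₁‖ + ‖w₂‖) := by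
  have hK := one_le_mulBound (D := D) (d := d) (s := s)
  have hM0 : 0 ≤ M := (Finset.sum_nonneg fun i _ => norm_nonneg _).trans hM
  have h1 : ‖∑ i, mul s (s - 1) (s - 1) (pd (s + 1) s i w₀) (u' i)‖ ≤
      mulBound D d s * M * ‖w₀‖ :=
    norm_sum_mul_le (by linarith) (norm_nonneg _) (fun i =>
      (norm_mul_zero_one_le _ _).trans (by
        rw [mul_right_comm]
        gcongr
        exact norm_pd_le (by linarith) le_rfl i w₀)) hM'
  have h2 : ‖∑ i, mul s (s - 1) (s - 1) (u i) (pd s (s - 1) i w₁)‖ ≤ mulBound D d s * M * ‖w₁‖ :=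
    norm_sum_mul_le (by linarith) (norm_nonneg _) (fun i =>
      (norm_mul_zero_one_le _ _).trans (by
        gcongr
        exact norm_pd_le (by linarith) (by linarith) i w₁)) hM
  rw [matSmoothDeriv, Finset.sum_add_distrib]
  refine (norm_add_le _ _).trans ((add_le_add le_rfl ((norm_add_le _ _).trans
    (add_le_add h1 h2))).trans ?_)
  have : ‖w₂‖ ≤ mulBound D d s * ‖w₂‖ := le_mul_of_one_le_left (norm_nonneg _) hK
  nlinarith [mul_nonneg (zero_le_one.trans hK) (norm_nonneg w₀),
    mul_nonneg (zero_le_one.trans hK) (norm_nonneg w₁),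
    mul_nonneg (mul_nonneg (zero_le_one.trans hK) hM0) (norm_nonneg w₂)]

theorem norm_matOneDeriv₂_le (hs : 2 ≤ s) (hM : ∑ i, ‖u i‖ ≤ M) (hM' : ∑ i, ‖u' i‖ ≤ M)
    (hM'' : ∑ i, ‖u'' i‖ ≤ M) : ‖matOneDeriv₂ u u' u'' w₀ w₁ w₂ w₃‖ ≤
      2 * (mulBound D d s * (1 + M)) * (‖w₀‖ + ‖w₁‖ + ‖w₂‖ + ‖w₃‖) := by
  have hK := one_le_mulBound (D := D) (d := d) (s := s)
  have hM0 : 0 ≤ M := (Finset.sum_nonneg fun i _ => norm_nonneg _).trans hM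
  have h1 : ‖∑ i, mul s (s - 2) (s - 2) (pd (s + 1) s i w₀) (u'' i)‖ ≤
      mulBound D d s * M * ‖w₀‖ :=
    norm_sum_mul_le (by linarith) (norm_nonneg _) (fun i =>
      (norm_mul_zero_two_le _ _).trans (by
        rw [mul_right_comm]
        gcongr
        exact norm_pd_le (by linarith) le_rfl i w₀)) hM''
  have h2 : ‖∑ i, mul (s - 1) (s - 1) (s - 2) (u' i) (pd s (s - 1) i w₁)‖ ≤
      mulBound D d s * M * ‖w₁‖ :=
    norm_sum_mul_le (by linarith) (norm_nonneg _) (fun i =>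
      (norm_mul_one_one_le _ _).trans (by
        gcongr
        exact norm_pd_le (by linarith) (by linarith) i w₁)) hM'
  have h3 : ‖∑ i, mul s (s - 2) (s - 2) (u i) (pd (s - 1) (s - 2) i w₂)‖ ≤
      mulBound D d s * M * ‖w₂‖ :=
    norm_sum_mul_le (by linarith) (norm_nonneg _) (fun i =>
      (norm_mul_zero_two_le _ _).trans (by
        gcongr
        exact norm_pd_le (by linarith) (by linarith) i w₂)) hM
  have h4 : ‖(2 : ℝ) • ∑ i, mul (s - 1) (s - 1) (s - 2) (u' i) (pd s (s - 1) i w₁)‖ ≤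
      2 * (mulBound D d s * M * ‖w₁‖) := by
    rw [norm_smul, Real.norm_ofNat]
    gcongr
  rw [matOneDeriv₂, Finset.sum_add_distrib, Finset.sum_add_distrib, ← Finset.smul_sum]
  refine (norm_add_le _ _).trans ((add_le_add le_rfl (norm_add₃_le.trans
    (add_le_add (add_le_add h1 h4) h3))).trans ?_)
  have : ‖w₃‖ ≤ mulBound D d s * ‖w₃‖ := le_mul_of_one_le_left (norm_nonneg _) hK
  have k0 := mul_nonneg (zero_le_one.trans hK) (norm_nonneg w₀)
  have k1 := mul_nonneg (zero_le_one.trans hK) (norm_nonneg w₁)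
  have k2 := mul_nonneg (zero_le_one.trans hK) (norm_nonneg w₂)
  have k3 := mul_nonneg (zero_le_one.trans hK) (norm_nonneg w₃)
  nlinarith [mul_nonneg hM0 k0, mul_nonneg hM0 k1, mul_nonneg hM0 k2, mul_nonneg hM0 k3]

end Source

variable {D : Geometry} {d : ℕ} {s : ℝ} {I : Set ℝ} {t : ℝ}

theorem coeFn_smul_add_add (c : ℝ) (f g h : XR D d) :
    (c • f + g + h : XR D d) =ᵐ[volume] fun p => c * f p + g p + h p := by
  filter_upwards [Lp.coeFn_add (c • f + g) h, Lp.coeFn_add (c • f) g, Lp.coeFn_smul c f]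
    with p h1 h2 h3
  rw [h1, Pi.add_apply, h2, Pi.add_apply, h3, Pi.smul_apply, smul_eq_mul]

section Estimates

variable {lam L W : ℝ}

/-- Turns the almost everywhere relation into an equality in H^s, from which the norm of λ(η - h) is
read off without dividing by h. -/
theorem eq_neg_of_source_eq (hsd : (d : ℝ) / 2 < s) (hs : 2 ≤ s) {a m₀ q₀ : Sob D d s}
    (h : ∀ᵐ p, lam * toL2 a p + (1 + toL2 m₀ p) * toL2 q₀ p = 0) :
    lam • a = -(q₀ + mul s s s m₀ q₀) := by
  refine toL2_injective (by linarith) (Lp.ext ?_)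
  rw [map_neg]
  filter_upwards [h, coeFn_toL2_smul lam a, Lp.coeFn_neg (toL2 (q₀ + mul s s s m₀ q₀)),
    coeFn_toL2_add q₀ (mul s s s m₀ q₀), toL2_mul (mulCond_zero_zero hsd hs) m₀ q₀]
    with p b1 b2 b3 b4 b5
  rw [b2, b3, Pi.neg_apply, b4, b5]
  linear_combination b1

theorem eq_neg_of_source_deriv_eq (hsd : (d : ℝ) / 2 < s) (hs : 2 ≤ s) {m₀ q₀ : Sob D d s}
    {b m₁ q₁ : Sob D d (s - 1)}
    (h : ∀ᵐ p, lam * toL2 b p + toL2 m₁ p * toL2 q₀ p + (1 + toL2 m₀ p) * toL2 q₁ p = 0) :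
    lam • b = -(q₁ + (mul s (s - 1) (s - 1) q₀ m₁ + mul s (s - 1) (s - 1) m₀ q₁)) := by
  refine toL2_injective (by linarith) (Lp.ext ?_)
  rw [map_neg]
  filter_upwards [h, coeFn_toL2_smul lam b,
    Lp.coeFn_neg (toL2 (q₁ + (mul s (s - 1) (s - 1) q₀ m₁ + mul s (s - 1) (s - 1) m₀ q₁))),
    coeFn_toL2_add q₁ (mul s (s - 1) (s - 1) q₀ m₁ + mul s (s - 1) (s - 1) m₀ q₁),
    coeFn_toL2_add (mul s (s - 1) (s - 1) q₀ m₁) (mul s (s - 1) (s - 1) m₀ q₁),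
    toL2_mul (mulCond_zero_one hsd hs) q₀ m₁, toL2_mul (mulCond_zero_one hsd hs) m₀ q₁]
    with p b1 b2 b3 b4 b5 b6 b7
  rw [b2, b3, Pi.neg_apply, b4, b5, b6, b7]
  linear_combination b1

theorem eq_neg_of_source_deriv₂_eq (hsd : (d : ℝ) / 2 < s) (hs : 2 ≤ s) {m₀ q₀ : Sob D d s}
    {m₁ q₁ : Sob D d (s - 1)} {c m₂ q₂ : Sob D d (s - 2)}
    (h : ∀ᵐ p, lam * toL2 c p + toL2 m₂ p * toL2 q₀ p + 2 * (toL2 m₁ p * toL2 q₁ p) +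
      (1 + toL2 m₀ p) * toL2 q₂ p = 0) :
    lam • c = -(q₂ + (mul s (s - 2) (s - 2) q₀ m₂ +
      (2 : ℝ) • mul (s - 1) (s - 1) (s - 2) m₁ q₁ + mul s (s - 2) (s - 2) m₀ q₂)) := by
  refine toL2_injective (by linarith) (Lp.ext ?_)
  rw [map_neg]
  generalize hX₁ : mul s (s - 2) (s - 2) q₀ m₂ = X₁
  generalize hX₂ : mul (s - 1) (s - 1) (s - 2) m₁ q₁ = X₂
  generalize hX₃ : mul s (s - 2) (s - 2) m₀ q₂ = X₃
  filter_upwards [h, coeFn_toL2_smul lam c,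
    Lp.coeFn_neg (toL2 (q₂ + (X₁ + (2 : ℝ) • X₂ + X₃))),
    coeFn_toL2_add q₂ (X₁ + (2 : ℝ) • X₂ + X₃), coeFn_toL2_add (X₁ + (2 : ℝ) • X₂) X₃,
    coeFn_toL2_add X₁ ((2 : ℝ) • X₂), coeFn_toL2_smul 2 X₂,
    toL2_mul (mulCond_zero_two hsd hs) q₀ m₂, toL2_mul (mulCond_one_one hsd hs) m₁ q₁,
    toL2_mul (mulCond_zero_two hsd hs) m₀ q₂]
    with p b1 b2 b3 b4 b5 b6 b7 b8 b9 b10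
  rw [hX₁] at b8
  rw [hX₂] at b9
  rw [hX₃] at b10
  rw [b2, b3, Pi.neg_apply, b4, b5, b6, b7, b8, b9, b10]
  linear_combination b1

variable {m₀ q₀ : Sob D d s} {m₁ q₁ : Sob D d (s - 1)} {m₂ q₂ : Sob D d (s - 2)}

/-- LW + L · 3L² · LW ≤ 4L⁴W, as L ≥ 1. -/
theorem norm_smul_le_of_source_eq (hL1 : 1 ≤ L) (hKL : mulBound D d s ≤ L) (hW : 0 ≤ W)
    (hlam : 0 < lam) (hq₀ : ‖q₀‖ ≤ L * W) (hm₀ : ‖m₀‖ ≤ 3 * L ^ 2) {a : Sob D d s}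
    (h : lam • a = -(q₀ + mul s s s m₀ q₀)) : lam * ‖a‖ ≤ 4 * (L ^ 4 * W) := by
  have hL0 : 0 ≤ L := zero_le_one.trans hL1
  have hLW : L * W ≤ L ^ 4 * W :=
    mul_le_mul_of_nonneg_right (le_self_pow₀ hL1 (by norm_num)) hW
  have f : ‖mul s s s m₀ q₀‖ ≤ L * (3 * L ^ 2) * (L * W) :=
    (norm_mul_zero_zero_le _ _).trans (by gcongr)
  rw [← abs_of_pos hlam, ← Real.norm_eq_abs, ← norm_smul, h, norm_neg]
  refine (norm_add_le _ _).trans ((add_le_add hq₀ f).trans ?_)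
  linarith

theorem norm_smul_le_of_source_deriv_eq (hL1 : 1 ≤ L) (hKL : mulBound D d s ≤ L) (hW : 0 ≤ W)
    (hlam : 0 < lam) (hq₀ : ‖q₀‖ ≤ L * W) (hq₁ : ‖q₁‖ ≤ L * W) (hm₀ : ‖m₀‖ ≤ 3 * L ^ 2)
    (hm₁ : ‖m₁‖ ≤ 4 * L ^ 2) {b : Sob D d (s - 1)}
    (h : lam • b = -(q₁ + (mul s (s - 1) (s - 1) q₀ m₁ + mul s (s - 1) (s - 1) m₀ q₁))) :
    lam * ‖b‖ ≤ 8 * (L ^ 4 * W) := by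
  have hL0 : 0 ≤ L := zero_le_one.trans hL1
  have hLW : L * W ≤ L ^ 4 * W :=
    mul_le_mul_of_nonneg_right (le_self_pow₀ hL1 (by norm_num)) hW
  have f₁ : ‖mul s (s - 1) (s - 1) q₀ m₁‖ ≤ L * (L * W) * (4 * L ^ 2) :=
    (norm_mul_zero_one_le _ _).trans (by gcongr)
  have f₂ : ‖mul s (s - 1) (s - 1) m₀ q₁‖ ≤ L * (3 * L ^ 2) * (L * W) :=
    (norm_mul_zero_one_le _ _).trans (by gcongr)
  rw [← abs_of_pos hlam, ← Real.norm_eq_abs, ← norm_smul, h, norm_neg]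
  refine (norm_add_le _ _).trans ((add_le_add hq₁ ((norm_add_le _ _).trans
    (add_le_add f₁ f₂))).trans ?_)
  linarith

/-- The terms contribute 2, 6, 2 · 4 and 3 · 2 times L⁴W, in all 22. -/
theorem norm_smul_le_of_source_deriv₂_eq (hL1 : 1 ≤ L) (hKL : mulBound D d s ≤ L) (hW : 0 ≤ W)
    (hlam : 0 < lam) (hq₀ : ‖q₀‖ ≤ L * W) (hq₁ : ‖q₁‖ ≤ L * W) (hq₂ : ‖q₂‖ ≤ 2 * L * W)
    (hm₀ : ‖m₀‖ ≤ 3 * L ^ 2) (hm₁ : ‖m₁‖ ≤ 4 * L ^ 2) (hm₂ : ‖m₂‖ ≤ 6 * L ^ 2)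
    {c : Sob D d (s - 2)}
    (h : lam • c = -(q₂ + (mul s (s - 2) (s - 2) q₀ m₂ +
      (2 : ℝ) • mul (s - 1) (s - 1) (s - 2) m₁ q₁ + mul s (s - 2) (s - 2) m₀ q₂))) :
    lam * ‖c‖ ≤ 22 * (L ^ 4 * W) := by
  have hL0 : 0 ≤ L := zero_le_one.trans hL1
  have hLW : L * W ≤ L ^ 4 * W :=
    mul_le_mul_of_nonneg_right (le_self_pow₀ hL1 (by norm_num)) hW
  have f₃ : ‖mul s (s - 2) (s - 2) q₀ m₂‖ ≤ L * (L * W) * (6 * L ^ 2) :=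
    (norm_mul_zero_two_le _ _).trans (by gcongr)
  have f₄ : ‖(2 : ℝ) • mul (s - 1) (s - 1) (s - 2) m₁ q₁‖ ≤ 2 * (L * (4 * L ^ 2) * (L * W)) := by
    rw [norm_smul, Real.norm_ofNat]
    gcongr
    exact (norm_mul_one_one_le _ _).trans (by gcongr)
  have f₅ : ‖mul s (s - 2) (s - 2) m₀ q₂‖ ≤ L * (3 * L ^ 2) * (2 * L * W) :=
    (norm_mul_zero_two_le _ _).trans (by gcongr)
  rw [← abs_of_pos hlam, ← Real.norm_eq_abs, ← norm_smul, h, norm_neg]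
  refine (norm_add_le _ _).trans ((add_le_add hq₂ (norm_add₃_le.trans
    (add_le_add (add_le_add f₃ f₄) f₅))).trans ?_)
  linarith

end Estimates

namespace IsFlow

variable {ζ : ℝ → Pt D d → ℝ} {v : Fin d → ℝ → Pt D d → ℝ} {η w : ℝ → Pt D d → ℝ}
  {z : ℝ → Sob D d s} {z' : ℝ → Sob D d (s - 1)} {z'' : ℝ → Sob D d (s - 2)}
  {u : Fin d → ℝ → Sob D d s} {u' : Fin d → ℝ → Sob D d (s - 1)}
  {u'' : Fin d → ℝ → Sob D d (s - 2)} {e : ℝ → Sob D d s} {e' : ℝ → Sob D d (s - 1)}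
  {e'' : ℝ → Sob D d (s - 2)} {y : ℝ → Sob D d s} {y' : ℝ → Sob D d (s - 1)}
  {y'' : ℝ → Sob D d (s - 2)} {lam mu hstar : ℝ}

/-- `lam (η - h) + h² ẇ = 0`. -/
theorem source_eq (R : IsFlow s I ζ v η z z' z'' u u' u'' e e' e'') (hsd : (d : ℝ) / 2 < s)
    (hs : 2 ≤ s) (hI : UniqueDiffOn ℝ I) (hy : IsC2Curve s I y y' y'')
    (hw : ∀ τ ∈ I, w τ =ᵐ[volume] toL2 (y τ)) (h0 : 0 < hstar)
    (hh : ∀ t ∈ I, ∀ᵐ x, hstar ≤ depth ζ t x) (hsol : IsFGSolution lam mu I ζ v η w) (ht : t ∈ I) :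
    ∀ᵐ p, lam * toL2 (e t - z t) p + (1 + toL2 (sqSub (z t)) p) *
      toL2 (matOne (fun i => u i t) (y t) (y' t)) p = 0 := by
  have hw' : ∀ τ ∈ I, w τ =ᵐ[volume] fun x => 0 + toL2 (y τ) x := by
    simpa only [zero_add] using hw
  filter_upwards [hsol.w_eq t ht, matD_ae_matOne hsd hs hI R.vel_ae hy hw' ht, R.depth_ae ht,
    R.eta_ae' ht, coeFn_toL2_sub (e t) (z t), toL2_sqSub hsd hs (z t), hh t ht]
    with p h1 h2 h3 h4 h5 h6 h7
  rw [h2, h3, h4] at h1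
  rw [h3] at h7
  rw [h1, h5, h6]
  have := (h0.trans_le h7).ne'
  field_simp
  ring

/-- At first order all terms are differentiable curves in L², and their sum is the zero curve. -/
theorem source_deriv_eq (R : IsFlow s I ζ v η z z' z'' u u' u'' e e' e'')
    (hsd : (d : ℝ) / 2 < s) (hs : 2 ≤ s) (hI : UniqueDiffOn ℝ I) (hy : IsC2Curve s I y y' y'')
    (hw : ∀ τ ∈ I, w τ =ᵐ[volume] toL2 (y τ)) (h0 : 0 < hstar)
    (hh : ∀ t ∈ I, ∀ᵐ x, hstar ≤ depth ζ t x) (hsol : IsFGSolution lam mu I ζ v η w) (ht : t ∈ I) :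
    ∀ᵐ p, lam * toL2 (e' t - z' t) p + toL2 (sqSubDeriv (z t) (z' t)) p *
        toL2 (matOne (fun i => u i t) (y t) (y' t)) p +
      (1 + toL2 (sqSub (z t)) p) *
        toL2 (matOneDeriv (fun i => u i t) (fun i => u' i t) (y t) (y' t) (y'' t)) p = 0 := by
  have hm := R.zeta.sqSub hsd hs
  have hq := isC1Curve_matOne hsd hs R.vel hy
  have hmq := hm.fst.mul hq (mulCond_zero_one hsd hs) (mulCond_one_one hsd hs)
    (mulCond_zero_two hsd hs) (by linarith) (by linarith) (by linarith)
  have hA := R.eta.fst.sub R.zeta.fst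
  have hs2 : 0 ≤ s - 2 := by linarith
  have hd := (((hA.hasDerivWithinAt_toL2 (by linarith) (by linarith) ht).fun_const_smul lam).fun_add
    (hq.hasDerivWithinAt_toL2 hs2 (by linarith) ht)).fun_add
    (hmq.hasDerivWithinAt_toL2 hs2 (by linarith) ht)
  have hz : ∀ τ ∈ I, (lam • toL2 (e τ - z τ) + toL2 (matOne (fun i => u i τ) (y τ) (y' τ)) +
      toL2 (mul s (s - 1) (s - 1) (sqSub (z τ)) (matOne (fun i => u i τ) (y τ) (y' τ)))) = 0 := by
    intro τ hτ
    apply Lp.ext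
    filter_upwards [coeFn_smul_add_add lam (toL2 (e τ - z τ))
      (toL2 (matOne (fun i => u i τ) (y τ) (y' τ)))
      (toL2 (mul s (s - 1) (s - 1) (sqSub (z τ)) (matOne (fun i => u i τ) (y τ) (y' τ)))),
      Lp.coeFn_zero ℝ 2 (volume : Measure (Pt D d)), R.source_eq hsd hs hI hy hw h0 hh hsol hτ,
      toL2_mul (mulCond_zero_one hsd hs) (sqSub (z τ)) (matOne (fun i => u i τ) (y τ) (y' τ))]
      with p h1 h2 h3 h4
    rw [h1, h2, h4, Pi.zero_apply, ← h3]
    ring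
  have h1 := (hI t ht).eq_deriv _ hd ((hasDerivWithinAt_const t I (0 : XR D d)).congr hz (hz t ht))
  set q := matOne (fun i => u i t) (y t) (y' t)
  set q' := matOneDeriv (fun i => u i t) (fun i => u' i t) (y t) (y' t) (y'' t)
  set X := mul (s - 1) (s - 1) (s - 2) (sqSubDeriv (z t) (z' t)) q
  set Y := mul s (s - 2) (s - 2) (sqSub (z t)) q'
  have h2 := coeFn_smul_add_add lam (toL2 (e' t - z' t)) (toL2 q') (toL2 (X + Y))
  rw [h1] at h2
  filter_upwards [h2, Lp.coeFn_zero ℝ 2 (volume : Measure (Pt D d)), coeFn_toL2_add X Y,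
    toL2_mul (mulCond_one_one hsd hs) (sqSubDeriv (z t) (z' t)) q,
    toL2_mul (mulCond_zero_two hsd hs) (sqSub (z t)) q'] with p h3 h4 h5 h6 h7
  rw [h4, h5, h6, h7, Pi.zero_apply] at h3
  rw [h3]
  ring

/-- The second time derivative of `lam (η - h) + h² ẇ = 0`. -/
theorem source_deriv₂_eq (R : IsFlow s I ζ v η z z' z'' u u' u'' e e' e'')
    (hsd : (d : ℝ) / 2 < s) (hs : 2 ≤ s) (hI : UniqueDiffOn ℝ I) (hy : IsC2Curve s I y y' y'')
    (hw : ∀ τ ∈ I, w τ =ᵐ[volume] toL2 (y τ)) (h0 : 0 < hstar)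
    (hh : ∀ t ∈ I, ∀ᵐ x, hstar ≤ depth ζ t x) (hsol : IsFGSolution lam mu I ζ v η w) (ht : t ∈ I)
    {w₀ : Sob D d (s + 1)} {w₁ : Sob D d s} {w₂ : Sob D d (s - 1)} {w₃ : Sob D d (s - 2)}
    (h₀ : toL2 w₀ = toL2 (y t)) (h₁ : toL2 w₁ = toL2 (y' t)) (h₂ : toL2 w₂ = toL2 (y'' t))
    (h₃ : ∀ φ : Pt D d → ℝ, IsTest φ → HasDerivWithinAt (fun τ => ∫ x, toL2 (y'' τ) x * φ x)
      (∫ x, toL2 w₃ x * φ x) I t) :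
    ∀ᵐ p, lam * toL2 (e'' t - z'' t) p + toL2 (sqSubDeriv₂ (z t) (z' t) (z'' t)) p *
        toL2 (matSmooth (fun i => u i t) w₀ w₁) p +
      2 * (toL2 (sqSubDeriv (z t) (z' t)) p *
        toL2 (matSmoothDeriv (fun i => u i t) (fun i => u' i t) w₀ w₁ w₂) p) +
      (1 + toL2 (sqSub (z t)) p) *
        toL2 (matOneDeriv₂ (fun i => u i t) (fun i => u' i t) (fun i => u'' i t) w₀ w₁ w₂ w₃) p
      = 0 := by
  rw [toL2_matSmooth hsd hs h₀ h₁, toL2_matSmoothDeriv hsd hs h₀ h₁ h₂]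
  have hδ : 0 < hstar ^ 2 := by positivity
  -- Used with m = h² - 1, q = ẇ and A' the time derivative of η - h; the lower bound for 1 + m is
  -- the square of that for h.
  refine second_deriv_identity hsd hs hI hδ (R.zeta.sqSub hsd hs) (fun τ hτ => ?_)
    (isC1Curve_matOne hsd hs R.vel hy) (R.eta.snd.sub R.zeta.snd)
    (fun τ hτ => R.source_deriv_eq hsd hs hI hy hw h0 hh hsol hτ) ht
    fun φ hφ => hasDerivWithinAt_matOneDeriv_test hsd hs R.vel hy ht h₀ h₁ h₂ hφ (h₃ φ hφ)
  filter_upwards [toL2_sqSub hsd hs (z τ), hh τ hτ, R.depth_ae hτ] with p e1 e2 e3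
  rw [e3] at e2
  rw [e1, add_sub_cancel]
  gcongr

/-- The bound on `η - h` and its first two time derivatives in terms of `w`. -/
theorem norm_sub_le (R : IsFlow s I ζ v η z z' z'' u u' u'' e e' e'')
    (hsd : (d : ℝ) / 2 < s) (hs : 2 ≤ s) (hI : UniqueDiffOn ℝ I) (hy : IsC2Curve s I y y' y'')
    (hw : ∀ τ ∈ I, w τ =ᵐ[volume] toL2 (y τ)) (hlam : 0 < lam) (h0 : 0 < hstar)
    (hh : ∀ t ∈ I, ∀ᵐ x, hstar ≤ depth ζ t x) (hsol : IsFGSolution lam mu I ζ v η w) (ht : t ∈ I)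
    {w₀ : Sob D d (s + 1)} {w₁ : Sob D d s} {w₂ : Sob D d (s - 1)} {w₃ : Sob D d (s - 2)}
    (h₀ : toL2 w₀ = toL2 (y t)) (h₁ : toL2 w₁ = toL2 (y' t)) (h₂ : toL2 w₂ = toL2 (y'' t))
    (h₃ : ∀ φ : Pt D d → ℝ, IsTest φ → HasDerivWithinAt (fun τ => ∫ x, toL2 (y'' τ) x * φ x)
      (∫ x, toL2 w₃ x * φ x) I t) {M : ℝ} (hM : ∑ i, ‖u i t‖ ≤ M) (hM' : ∑ i, ‖u' i t‖ ≤ M)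
    (hM'' : ∑ i, ‖u'' i t‖ ≤ M) (hz : ‖z t‖ ≤ M) (hz' : ‖z' t‖ ≤ M) (hz'' : ‖z'' t‖ ≤ M) :
    ‖e t - z t‖ + ‖e' t - z' t‖ + ‖e'' t - z'' t‖ ≤ lam⁻¹ *
      (34 * (mulBound D d s * (1 + M)) ^ 4 * (‖w₀‖ + ‖w₁‖ + ‖w₂‖ + ‖w₃‖)) := by
  have hK := one_le_mulBound (D := D) (d := d) (s := s)
  have hM0 : 0 ≤ M := (norm_nonneg _).trans hz
  have i₀ := R.source_eq hsd hs hI hy hw h0 hh hsol ht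
  have i₁ := R.source_deriv_eq hsd hs hI hy hw h0 hh hsol ht
  have i₂ := R.source_deriv₂_eq hsd hs hI hy hw h0 hh hsol ht h₀ h₁ h₂ h₃
  rw [← toL2_matSmooth hsd hs (u := fun i => u i t) h₀ h₁] at i₀ i₁
  rw [← toL2_matSmoothDeriv hsd hs (u := fun i => u i t) (u' := fun i => u' i t) h₀ h₁ h₂] at i₁
  have hL1 : 1 ≤ mulBound D d s * (1 + M) := by nlinarith
  have hKL : mulBound D d s ≤ mulBound D d s * (1 + M) := by nlinarith
  have hL0 := zero_le_one.trans hL1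
  have hq₀ : ‖matSmooth (fun i => u i t) w₀ w₁‖ ≤
      mulBound D d s * (1 + M) * (‖w₀‖ + ‖w₁‖ + ‖w₂‖ + ‖w₃‖) :=
    (norm_matSmooth_le hs hM).trans (mul_le_mul_of_nonneg_left
      (by linarith [norm_nonneg w₂, norm_nonneg w₃]) hL0)
  have hq₁ : ‖matSmoothDeriv (fun i => u i t) (fun i => u' i t) w₀ w₁ w₂‖ ≤
      mulBound D d s * (1 + M) * (‖w₀‖ + ‖w₁‖ + ‖w₂‖ + ‖w₃‖) :=
    (norm_matSmoothDeriv_le hs hM hM').trans (mul_le_mul_of_nonneg_left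
      (by linarith [norm_nonneg w₃]) hL0)
  have hq₂ := norm_matOneDeriv₂_le (w₀ := w₀) (w₁ := w₁) (w₂ := w₂) (w₃ := w₃) hs hM hM' hM''
  have hW : 0 ≤ ‖w₀‖ + ‖w₁‖ + ‖w₂‖ + ‖w₃‖ := by positivity
  have g₀ := norm_smul_le_of_source_eq hL1 hKL hW hlam hq₀ (norm_sqSub_le hz)
    (eq_neg_of_source_eq hsd hs i₀)
  have g₁ := norm_smul_le_of_source_deriv_eq hL1 hKL hW hlam hq₀ hq₁ (norm_sqSub_le hz)
    (norm_sqSubDeriv_le hz hz') (eq_neg_of_source_deriv_eq hsd hs i₁)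
  have g₂ := norm_smul_le_of_source_deriv₂_eq hL1 hKL hW hlam hq₀ hq₁ hq₂ (norm_sqSub_le hz)
    (norm_sqSubDeriv_le hz hz') (norm_sqSubDeriv₂_le hz hz' hz'')
    (eq_neg_of_source_deriv₂_eq hsd hs i₂)
  -- The three bounds add up to 4 + 8 + 22 = 34.
  rw [← div_eq_inv_mul, le_div_iff₀ hlam]
  linarith

end IsFlow

/-! ### The norms of the statement, and the conclusion -/

variable {D : Geometry} {d : ℕ} {s : ℝ} {I : Set ℝ} {t : ℝ}

namespace IsC2Curve

variable {a : ℝ → Sob D d s} {b : ℝ → Sob D d (s - 1)} {c : ℝ → Sob D d (s - 2)}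
  {f : ℝ → Pt D d → ℝ}

theorem dt_ae (h : IsC2Curve s I a b c) (hs : 2 ≤ s) (hI : UniqueDiffOn ℝ I)
    (hf : ∀ τ ∈ I, f τ =ᵐ[volume] toL2 (a τ)) (ht : t ∈ I) : dt I f t =ᵐ[volume] toL2 (b t) :=
  h.fst.dt_ae (κ := 0) (by linarith) (by linarith) hI (by simpa only [zero_add] using hf) ht

theorem dt_dt_ae (h : IsC2Curve s I a b c) (hs : 2 ≤ s) (hI : UniqueDiffOn ℝ I)
    (hf : ∀ τ ∈ I, f τ =ᵐ[volume] toL2 (a τ)) (ht : t ∈ I) :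
    (dt I)^[2] f t =ᵐ[volume] toL2 (c t) :=
  h.snd.dt_ae (κ := 0) (by linarith) (by linarith) hI
    (fun τ hτ => by simpa only [zero_add] using h.dt_ae hs hI hf hτ) ht

theorem hNorm_eq (h : IsC2Curve s I a b c) (hs : 2 ≤ s) (hI : UniqueDiffOn ℝ I)
    (hf : ∀ τ ∈ I, f τ =ᵐ[volume] toL2 (a τ)) (ht : t ∈ I) :
    hNorm s ((dt I)^[0] f t) = ‖a t‖ ∧ hNorm (s - 1) ((dt I)^[1] f t) = ‖b t‖ ∧
      hNorm (s - 2) ((dt I)^[2] f t) = ‖c t‖ :=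
  ⟨FavrieGavrilyuk.hNorm_eq (by linarith) _ (hf t ht),
    FavrieGavrilyuk.hNorm_eq (by linarith) _ (h.dt_ae hs hI hf ht),
    FavrieGavrilyuk.hNorm_eq (by linarith) _ (h.dt_dt_ae hs hI hf ht)⟩

end IsC2Curve

namespace IsFlow

variable {ζ : ℝ → Pt D d → ℝ} {v : Fin d → ℝ → Pt D d → ℝ} {η w : ℝ → Pt D d → ℝ}
  {z : ℝ → Sob D d s} {z' : ℝ → Sob D d (s - 1)} {z'' : ℝ → Sob D d (s - 2)}
  {u : Fin d → ℝ → Sob D d s} {u' : Fin d → ℝ → Sob D d (s - 1)}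
  {u'' : Fin d → ℝ → Sob D d (s - 2)} {e : ℝ → Sob D d s} {e' : ℝ → Sob D d (s - 1)}
  {e'' : ℝ → Sob D d (s - 2)} {y : ℝ → Sob D d s} {y' : ℝ → Sob D d (s - 1)}
  {y'' : ℝ → Sob D d (s - 2)}

theorem stateNorm_eq (R : IsFlow s I ζ v η z z' z'' u u' u'' e e' e'') (hs : 2 ≤ s)
    (hI : UniqueDiffOn ℝ I) (hy : IsC2Curve s I y y' y'')
    (hw : ∀ τ ∈ I, w τ =ᵐ[volume] toL2 (y τ)) (ht : t ∈ I) :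
    stateNorm I 0 s ζ v η w t = ‖z t‖ + ∑ i, ‖u i t‖ + ‖e t‖ + ‖y t‖ ∧
    stateNorm I 1 (s - 1) ζ v η w t = ‖z' t‖ + ∑ i, ‖u' i t‖ + ‖e' t‖ + ‖y' t‖ ∧
    stateNorm I 2 (s - 2) ζ v η w t = ‖z'' t‖ + ∑ i, ‖u'' i t‖ + ‖e'' t‖ + ‖y'' t‖ := by
  obtain ⟨a₀, a₁, a₂⟩ := R.zeta.hNorm_eq hs hI R.zeta_ae ht
  obtain ⟨b₀, b₁, b₂⟩ := R.eta.hNorm_eq hs hI R.eta_ae ht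
  obtain ⟨c₀, c₁, c₂⟩ := hy.hNorm_eq hs hI hw ht
  have hv := fun i => (R.vel i).hNorm_eq hs hI (R.vel_ae i) ht
  refine ⟨?_, ?_, ?_⟩
  · rw [stateNorm, a₀, b₀, c₀, Finset.sum_congr rfl fun i _ => (hv i).1]
  · rw [stateNorm, a₁, b₁, c₁, Finset.sum_congr rfl fun i _ => (hv i).2.1]
  · rw [stateNorm, a₂, b₂, c₂, Finset.sum_congr rfl fun i _ => (hv i).2.2]

theorem sum_hNorm_sub_eq (R : IsFlow s I ζ v η z z' z'' u u' u'' e e' e'') (hs : 2 ≤ s)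
    (hI : UniqueDiffOn ℝ I) (ht : t ∈ I) :
    ∑ j ∈ Finset.range 3, hNorm (s - j) ((dt I)^[j] (fun τ x => η τ x - depth ζ τ x) t) =
      ‖e t - z t‖ + ‖e' t - z' t‖ + ‖e'' t - z'' t‖ := by
  have h : IsC2Curve s I (fun t => e t - z t) (fun t => e' t - z' t) (fun t => e'' t - z'' t) :=
    ⟨R.eta.fst.sub R.zeta.fst, R.eta.snd.sub R.zeta.snd⟩
  obtain ⟨h₀, h₁, h₂⟩ := h.hNorm_eq (f := fun τ x => η τ x - depth ζ τ x) hs hI (fun τ hτ => by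
    filter_upwards [R.depth_ae hτ, R.eta_ae' hτ, coeFn_toL2_sub (e τ) (z τ)] with x h1 h2 h3
    rw [h1, h2, h3]
    ring) ht
  simp only [Finset.sum_range_succ, Finset.sum_range_zero, zero_add, Nat.cast_zero, Nat.cast_one,
    Nat.cast_ofNat, sub_zero]
  rw [h₀, h₁, h₂]

theorem hNorm_remainder_le (R : IsFlow s I ζ v η z z' z'' u u' u'' e e' e'')
    (hsd : (d : ℝ) / 2 < s) (hs : 2 ≤ s) (hI : UniqueDiffOn ℝ I) (ht : t ∈ I) {M : ℝ}
    (hM : ∑ i, ‖u i t‖ ≤ M) (hM' : ∑ i, ‖u' i t‖ ≤ M) (hz : ‖z t‖ ≤ M)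
    (he : ‖e t‖ + ‖e' t‖ + ‖e'' t‖ ≤ M) :
    hNorm (s - 2) (remainder I ζ v η t) ≤ 4 * (mulBound D d s * (1 + M)) ^ 4 *
      (‖e t - z t‖ + ‖e' t - z' t‖ + ‖e'' t - z'' t‖) := by
  rw [hNorm_eq (by linarith) _ (R.remainder_ae hsd hs hI ht)]
  exact norm_remSob_le hs hM hM' hz he

/-- The bound on the remainder in terms of `w`. -/
theorem hNorm_remainder_le_inv (R : IsFlow s I ζ v η z z' z'' u u' u'' e e' e'')
    (hsd : (d : ℝ) / 2 < s) (hs : 2 ≤ s) (hI : UniqueDiffOn ℝ I) (hy : IsC2Curve s I y y' y'')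
    (hw : ∀ τ ∈ I, w τ =ᵐ[volume] toL2 (y τ)) {lam mu hstar : ℝ} (hlam : 0 < lam) (h0 : 0 < hstar)
    (hh : ∀ t ∈ I, ∀ᵐ x, hstar ≤ depth ζ t x) (hsol : IsFGSolution lam mu I ζ v η w) (ht : t ∈ I)
    {w₃ : Pt D d → ℝ} (hw₃ : HasTimeDerivAt I ((dt I)^[2] w) t w₃)
    (hmem : ∀ j ∈ Finset.range 3, MemH (s + 1 - j) ((dt I)^[j] w t)) (hmem₃ : MemH (s - 2) w₃)
    {M : ℝ} (hM : ∑ i, ‖u i t‖ ≤ M) (hM' : ∑ i, ‖u' i t‖ ≤ M) (hM'' : ∑ i, ‖u'' i t‖ ≤ M)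
    (hz : ‖z t‖ ≤ M) (hz' : ‖z' t‖ ≤ M) (hz'' : ‖z'' t‖ ≤ M)
    (he : ‖e t‖ + ‖e' t‖ + ‖e'' t‖ ≤ M) :
    hNorm (s - 2) (remainder I ζ v η t) ≤ lam⁻¹ * (136 * (mulBound D d s * (1 + M)) ^ 8) *
      ((∑ j ∈ Finset.range 3, hNorm (s + 1 - j) ((dt I)^[j] w t)) + hNorm (s - 2) w₃) := by
  have hm₀ : MemH (s + 1) (w t) := by simpa using hmem 0 (by simp)
  have hm₁ : MemH s (dt I w t) := by simpa using hmem 1 (by simp)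
  have hm₂ : MemH (s - 1) ((dt I)^[2] w t) := by
    have := hmem 2 (by simp)
    rwa [Nat.cast_ofNat, show s + 1 - 2 = s - 1 by ring] at this
  obtain ⟨W₀, e₀⟩ := hm₀.exists_sob (by linarith)
  obtain ⟨W₁, e₁⟩ := hm₁.exists_sob (by linarith)
  obtain ⟨W₂, e₂⟩ := hm₂.exists_sob (by linarith)
  obtain ⟨W₃, e₃⟩ := hmem₃.exists_sob (by linarith)
  have hsum : (∑ j ∈ Finset.range 3, hNorm (s + 1 - j) ((dt I)^[j] w t)) + hNorm (s - 2) w₃ =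
      ‖W₀‖ + ‖W₁‖ + ‖W₂‖ + ‖W₃‖ := by
    simp only [Finset.sum_range_succ, Finset.sum_range_zero, zero_add, Nat.cast_zero, Nat.cast_one,
      Nat.cast_ofNat, sub_zero, add_sub_cancel_right, show s + 1 - 2 = s - 1 by ring]
    rw [← hNorm_eq (by linarith) W₀ e₀, ← hNorm_eq (by linarith) W₁ e₁,
      ← hNorm_eq (by linarith) W₂ e₂, ← hNorm_eq (by linarith) W₃ e₃]
    rfl
  have h₃ : ∀ φ : Pt D d → ℝ, IsTest φ → HasDerivWithinAt (fun τ => ∫ x, toL2 (y'' τ) x * φ x)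
      (∫ x, toL2 W₃ x * φ x) I t := by
    intro φ hφ
    have hc : ∀ τ ∈ I, ∫ x, toL2 (y'' τ) x * φ x = ∫ x, (dt I)^[2] w τ x * φ x := fun τ hτ => by
      refine integral_congr_ae ?_
      filter_upwards [hy.dt_dt_ae hs hI hw hτ] with x h1
      rw [h1]
    have h := (hw₃.2.2 φ hφ).congr hc (hc t ht)
    have hc₃ : ∫ x, w₃ x * φ x = ∫ x, toL2 W₃ x * φ x := by
      refine integral_congr_ae ?_
      filter_upwards [e₃] with x h1
      rw [h1]
    rwa [hc₃] at h
  have hb := R.norm_sub_le hsd hs hI hy hw hlam h0 hh hsol ht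
    (Lp.ext (e₀.symm.trans (hw t ht))) (Lp.ext (e₁.symm.trans (hy.dt_ae hs hI hw ht)))
    (Lp.ext (e₂.symm.trans (hy.dt_dt_ae hs hI hw ht))) h₃ hM hM' hM'' hz hz' hz''
  have hL : 0 ≤ (mulBound D d s * (1 + M)) ^ 4 := by positivity
  rw [hsum]
  -- With L = K(1 + M) and K = `mulBound D d s`, the two estimates multiply to 4L⁴ · 34L⁴ = 136L⁸.
  refine (R.hNorm_remainder_le hsd hs hI ht hM hM' hz he).trans
    ((mul_le_mul_of_nonneg_left hb (by linarith)).trans_eq ?_)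
  ring

end IsFlow

end FavrieGavrilyuk

theorem mainTheorem3 (D : Geometry) (d : ℕ) (hd : d = 1 ∨ d = 2) (s : ℝ)
    (hsd : (d : ℝ) / 2 < s) (hs : 2 ≤ s) :
    ∃ C C' : ℝ × ℝ × ℝ × ℝ → ℝ,
      (∀ p, 0 ≤ C p) ∧ Monotone C ∧ (∀ p, 0 ≤ C' p) ∧ Monotone C' ∧
      ∀ (lam mu hstar : ℝ) (T : EReal), 0 < lam → 0 < mu → 0 < hstar → 0 < T →
      ∀ (ζ : ℝ → Pt D d → ℝ) (u : Fin d → ℝ → Pt D d → ℝ) (η w : ℝ → Pt D d → ℝ),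
        Regular s (timeInterval T) ζ →
        (∀ i, Regular s (timeInterval T) (u i)) →
        Regular s (timeInterval T) (fun t x => η t x - 1) →
        Regular s (timeInterval T) w →
        IsFGSolution lam mu (timeInterval T) ζ u η w →
        (∀ t ∈ timeInterval T, ∀ᵐ x, hstar ≤ depth ζ t x) →
        -- the material derivatives of `h`, `η` up to order two are well defined
        MatDifferentiable (timeInterval T) (depth ζ) ∧
        MatDifferentiable (timeInterval T) (matD (timeInterval T) u (depth ζ)) ∧
        MatDifferentiable (timeInterval T) η ∧
        MatDifferentiable (timeInterval T) (matD (timeInterval T) u η) ∧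
        -- the Green–Naghdi system with remainder
        MassEq (timeInterval T) ζ u ∧
        GNMomentum mu (timeInterval T) ζ u (remainder (timeInterval T) ζ u η) ∧
        CnH 0 (s - 2) (timeInterval T) (remainder (timeInterval T) ζ u η) ∧
        -- the first estimate
        (∀ t ∈ timeInterval T,
          hNorm (s - 2) (remainder (timeInterval T) ζ u η t) ≤
            C (hstar⁻¹, stateNorm (timeInterval T) 0 s ζ u η w t,
                stateNorm (timeInterval T) 1 (s - 1) ζ u η w t,
                stateNorm (timeInterval T) 2 (s - 2) ζ u η w t) *
              ∑ j ∈ Finset.range 3,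
                hNorm (s - j) ((dt (timeInterval T))^[j] (fun τ x => η τ x - depth ζ τ x) t)) ∧
        -- the second estimate, at each time at which its right-hand side is finite;
        -- `w₃` is the third time derivative of `w` at time `t`
        (∀ t ∈ timeInterval T, ∀ w₃ : Pt D d → ℝ,
          HasTimeDerivAt (timeInterval T) ((dt (timeInterval T))^[2] w) t w₃ →
          (∀ j ∈ Finset.range 3, MemH (s + 1 - j) ((dt (timeInterval T))^[j] w t)) →
          MemH (s - 2) w₃ →
          hNorm (s - 2) (remainder (timeInterval T) ζ u η t) ≤
            lam⁻¹ * C' (hstar⁻¹, stateNorm (timeInterval T) 0 s ζ u η w t,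
                stateNorm (timeInterval T) 1 (s - 1) ζ u η w t,
                stateNorm (timeInterval T) 2 (s - 2) ζ u η w t) *
              ((∑ j ∈ Finset.range 3, hNorm (s + 1 - j) ((dt (timeInterval T))^[j] w t))
                + hNorm (s - 2) w₃)) := by
  have hK := one_le_mulBound (D := D) (d := d) (s := s)
  have hK0 := zero_le_one.trans hK
  -- M is the sum of the three state norms. Positive parts make the constants nonnegative and
  -- monotone on all of ℝ⁴, and disappear on actual norms. The first argument does not occur, as the
  -- estimates involve no division by h.
  have hmono : Monotone fun p : ℝ × ℝ × ℝ × ℝ =>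
      mulBound D d s * (1 + (max p.2.1 0 + max p.2.2.1 0 + max p.2.2.2 0)) := fun p q hpq =>
    mul_le_mul_of_nonneg_left (add_le_add le_rfl (add_le_add (add_le_add
      (max_le_max_right 0 hpq.2.1) (max_le_max_right 0 hpq.2.2.1))
      (max_le_max_right 0 hpq.2.2.2))) hK0
  have hnonneg : ∀ p : ℝ × ℝ × ℝ × ℝ,
      0 ≤ mulBound D d s * (1 + (max p.2.1 0 + max p.2.2.1 0 + max p.2.2.2 0)) := fun p => by
    positivity
  refine ⟨fun p => 4 * (mulBound D d s * (1 + (max p.2.1 0 + max p.2.2.1 0 + max p.2.2.2 0))) ^ 4,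
    fun p => 136 * (mulBound D d s * (1 + (max p.2.1 0 + max p.2.2.1 0 + max p.2.2.2 0))) ^ 8,
    fun p => mul_nonneg (by norm_num) (pow_nonneg (hnonneg p) _),
    fun p q hpq => mul_le_mul_of_nonneg_left
      (pow_le_pow_left₀ (hnonneg p) (hmono hpq) _) (by norm_num),
    fun p => mul_nonneg (by norm_num) (pow_nonneg (hnonneg p) _),
    fun p q hpq => mul_le_mul_of_nonneg_left
      (pow_le_pow_left₀ (hnonneg p) (hmono hpq) _) (by norm_num), ?_⟩
  intro lam mu hstar T hlam hmu h0 hT ζ v η w hζ hv hη hw hsol hh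
  have hI := uniqueDiffOn_timeInterval hT
  obtain ⟨z, z', z'', hz, hz_ae⟩ := hζ.exists_curve hs hI
  choose u u' u'' hu hu_ae using fun i => (hv i).exists_curve hs hI
  obtain ⟨e, e', e'', he, he_ae⟩ := hη.exists_curve hs hI
  obtain ⟨y, y', y'', hy, hy_ae⟩ := hw.exists_curve hs hI
  have R : IsFlow s (timeInterval T) ζ v η z z' z'' u u' u'' e e' e'' :=
    ⟨hz, hu, he, hz_ae, hu_ae, he_ae⟩
  obtain ⟨m₁, m₂, m₃, m₄⟩ := R.matDifferentiable hsd hs hI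
  refine ⟨m₁, m₂, m₃, m₄, hsol.mass, R.gnMomentum hsd hs hI h0 hh hsol,
    R.cnH_remainder hsd hs hI, fun t ht => ?_, fun t ht w₃ hw₃ hmem hmem₃ => ?_⟩
  all_goals
    obtain ⟨s₀, s₁, s₂⟩ := R.stateNorm_eq hs hI hy hy_ae ht
    have u₀ : 0 ≤ ∑ i, ‖u i t‖ := by positivity
    have u₁ : 0 ≤ ∑ i, ‖u' i t‖ := by positivity
    have u₂ : 0 ≤ ∑ i, ‖u'' i t‖ := by positivity
    have n₀ := norm_nonneg (z t)
    have n₁ := norm_nonneg (z' t)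
    have n₂ := norm_nonneg (z'' t)
    have n₃ := norm_nonneg (e t)
    have n₄ := norm_nonneg (e' t)
    have n₅ := norm_nonneg (e'' t)
    have n₆ := norm_nonneg (y t)
    have n₇ := norm_nonneg (y' t)
    have n₈ := norm_nonneg (y'' t)
    rw [s₀, s₁, s₂]
    dsimp only
    rw [max_eq_left (by linarith : 0 ≤ ‖z t‖ + ∑ i, ‖u i t‖ + ‖e t‖ + ‖y t‖),
      max_eq_left (by linarith : 0 ≤ ‖z' t‖ + ∑ i, ‖u' i t‖ + ‖e' t‖ + ‖y' t‖),
      max_eq_left (by linarith : 0 ≤ ‖z'' t‖ + ∑ i, ‖u'' i t‖ + ‖e'' t‖ + ‖y'' t‖)]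
  · rw [R.sum_hNorm_sub_eq hs hI ht]
    apply R.hNorm_remainder_le hsd hs hI ht <;> linarith
  · apply R.hNorm_remainder_le_inv hsd hs hI hy hy_ae hlam h0 hh hsol ht hw₃ hmem hmem₃ <;> linarith
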